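/- For $R>0$ let $B_R=\{x\in\mathbb R^3: |x|\le R\}$ and $\dot B_4=B_4\setminus\{0\}$. Let $C_S(B_4)$ be the space of continuous functions $f:B_4\to\mathbb R$ that are invariant under the three reflections $x_i\mapsto -x_i$ $(i=1,2,3)$. **Steady state.** Let $E_0\in\mathbb R$ and let $\varphi\in C^1(\mathbb R)$ satisfy $\varphi(E)=0$ for $E\ge E_0$, $\varphi(E)>0$ for $E<E_0$, and be strictly decreasing on $(-\infty,E_0)$. Suppose that $f_0(x,v)=\varphi(\tfrac12|v|^2+U_0(x))$ together with $\rho_0,U_0$ is a spherically symmetric time-independent solution of the Vlasov–Poisson system $$v\cdot\nabla_x f_0-\nabla U_0\cdot\nabla_v f_0=0,\qquad \Delta U_0=4\pi\rho_0,\qquad \rho_0(x)=\int_{\mathbb R^3} f_0(x,v)\,dv,$$ with $\rho_0\in C^1(\mathbb R^3)$, $\operatorname{supp}\rho_0=B_1$, $U_0\in C^2(\mathbb R^3)$ and $\lim_{|x|\to\infty}U_0(x)=0$. Write $E_1=U_0(2)-E_0$, where $U_0(2)$ is the value of $U_0$ at radius $2$, and $r(x)=\sqrt{x_1^2+x_2^2}$,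 and put $$\tilde h(\omega,r,u)=\int_{\mathbb R^3}\varphi\big(\tfrac12|v|^2+u-\tfrac12\omega^2r^2\big)\,dv\ \text{ if } u<E_0+E_1,\qquad \tilde h(\omega,r,u)=0\ \text{ otherwise.}$$ **Spaces.** Let $X$ be the space of all $f\in C_S(B_4)$ with $f(0)=0$, $f\in C^1(\dot B_4)$, $\nabla f$ bounded on $\dot B_4$, and such that $\lim_{t\to0+}\nabla f(tx)$ exists uniformly in $|x|=1$; its norm is $\|f\|_X=\sup_{x\in\dot B_4}|\nabla f(x)|$. Let $Y$ be the space of all $f\in C_S(B_4)$ with $f(0)=0$, $f\in C^1(B_4)$, $|\nabla f(x)|\le C|x|$ on $B_4$ for some $C$, and such that $\lim_{t\to0+}\nabla f(tx)/t$ exists uniformly in $|x|=1$; its norm is $\|f\|_Y=\sup_{x\in\dot B_4}|\nabla f(x)|/|x|$. **Operator.** For $\zeta\in X$ let $g_\zeta:B_4\to\mathbb R^3$, $g_\zeta(x)=x+\zeta(x)\,x/|x|$ for $x\neq0$, $g_\zeta(0)=0$, and for $x\in B_4$ put $$T(\omega,\zeta)(x)=U_0(x)+\int_{B_3}\frac{\tilde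 h(\omega,r(y),U_0(g_\zeta^{-1}(y)))}{|g_\zeta(x)-y|}\,dy-U_0(0)-\int_{B_3}\frac{\tilde h(\omega,r(y),U_0(g_\zeta^{-1}(y)))}{|y|}\,dy .$$ **Proposition.** There is $r>0$ such that for every $\zeta\in X$ with $\|\zeta\|_X<r$ the map $g_\zeta$ is injective on $B_4$ with $B_3\subset g_\zeta(B_4)$, and $T(0,\zeta)\in Y$. The map $\zeta\mapsto T(0,\zeta)$ from $\{\zeta\in X:\|\zeta\|_X<r\}$ to $Y$ is Fréchet differentiable at $\zeta=0$, and its derivative $\partial_\zeta T(0,0):X\to Y$ is a linear isomorphism (a bounded linear bijection with bounded inverse). -/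

import Mathlib

open Set Filter Topology MeasureTheory
open scoped Laplacian

noncomputable section

namespace RotatingVP

/-- Euclidean space `ℝ³`, used for positions and for velocities. -/
abbrev E3 : Type := EuclideanSpace ℝ (Fin 3)

/-- The closed ball `B_R` of radius `R` about the origin. -/
abbrev B (R : ℝ) : Set E3 := Metric.closedBall 0 R

/-- The punctured closed ball `B_4 \ {0}`. -/
abbrev B4' : Set E3 := B 4 \ {0}

/-- The reflection changing the sign of the `i`-th coordinate.  The set `S` of symmetries consists
of these three maps. -/
def reflect (i : Fin 3) (x : E3) : E3 := WithLp.toLp 2 (Function.update x i (-x i))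

/-- The gradient of a function on the closed ball `B_4`, as a linear form (its norm is the
Euclidean length of the gradient vector).  At boundary points this is the
derivative within `B_4`. -/
def grad (f : E3 → ℝ) (x : E3) : E3 →L[ℝ] ℝ := fderivWithin ℝ f (B 4) x

/-! ### The function spaces

A function on `B_4` is represented by its extension by `0` to `ℝ³`, so that two elements are
equal if and only if they agree on `B_4`. -/

/-- `C_S(B_4)`: continuous functions on `B_4` that are invariant under the reflections. -/
structure MemCS (f : E3 → ℝ) : Prop where
  eq_zero_off : ∀ x, x ∉ B 4 → f x = 0
  continuousOn : ContinuousOn f (B 4)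
  symm : ∀ i : Fin 3, ∀ x ∈ B 4, f (reflect i x) = f x

/-- Membership in `X`. -/
structure MemX (f : E3 → ℝ) : Prop extends MemCS f where
  map_zero : f 0 = 0
  contDiffOn : ContDiffOn ℝ 1 f B4'
  bound : ∃ C : ℝ, ∀ x ∈ B4', ‖grad f x‖ ≤ C
  radial_limit : ∃ G : E3 → (E3 →L[ℝ] ℝ),
    TendstoUniformlyOn (fun (t : ℝ) (x : E3) => grad f (t • x)) G (𝓝[>] 0)
      (Metric.sphere (0 : E3) 1)

/-- Membership in `Y`. -/
structure MemY (f : E3 → ℝ) : Prop extends MemCS f where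
  map_zero : f 0 = 0
  contDiffOn : ContDiffOn ℝ 1 f (B 4)
  bound : ∃ C : ℝ, ∀ x ∈ B 4, ‖grad f x‖ ≤ C * ‖x‖
  radial_limit : ∃ G : E3 → (E3 →L[ℝ] ℝ),
    TendstoUniformlyOn (fun (t : ℝ) (x : E3) => t⁻¹ • grad f (t • x)) G (𝓝[>] 0)
      (Metric.sphere (0 : E3) 1)

theorem uniqueDiff_B4 : UniqueDiffOn ℝ (B 4) := by
  apply uniqueDiffOn_convex (convex_closedBall (0 : E3) 4)
  rw [interior_closedBall _ (by norm_num)]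
  exact ⟨0, Metric.mem_ball_self (by norm_num)⟩

theorem grad_add {f g : E3 → ℝ} {x : E3} (hx : x ∈ B 4)
    (hf : DifferentiableWithinAt ℝ f (B 4) x) (hg : DifferentiableWithinAt ℝ g (B 4) x) :
    grad (f + g) x = grad f x + grad g x :=
  fderivWithin_add (uniqueDiff_B4 x hx) hf hg

theorem grad_smul {f : E3 → ℝ} {x : E3} (c : ℝ) (hx : x ∈ B 4)
    (hf : DifferentiableWithinAt ℝ f (B 4) x) : grad (c • f) x = c • grad f x :=
  fderivWithin_const_smul (uniqueDiff_B4 x hx) hf c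

theorem grad_zero (x : E3) : grad 0 x = 0 := by
  unfold grad
  simp

theorem MemX.diff {f : E3 → ℝ} (hf : MemX f) {x : E3} (hx : x ∈ B4') :
    DifferentiableWithinAt ℝ f (B 4) x := by
  have h := hf.contDiffOn.differentiableOn (by norm_num) x hx
  refine h.mono_of_mem_nhdsWithin ?_
  exact inter_mem self_mem_nhdsWithin
    (mem_nhdsWithin_of_mem_nhds (isOpen_compl_singleton.mem_nhds hx.2))

theorem MemY.diff {f : E3 → ℝ} (hf : MemY f) {x : E3} (hx : x ∈ B 4) :
    DifferentiableWithinAt ℝ f (B 4) x :=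
  hf.contDiffOn.differentiableOn (by norm_num) x hx

theorem ray_mem {x : E3} (hx : x ∈ Metric.sphere (0 : E3) 1) {t : ℝ} (ht : t ∈ Ioo (0 : ℝ) 4) :
    t • x ∈ B4' := by
  have hx1 : ‖x‖ = 1 := by simpa using hx
  have ht0 : 0 < t := ht.1
  have hn : ‖t • x‖ = t := by rw [norm_smul, hx1, Real.norm_eq_abs, abs_of_pos ht0, mul_one]
  refine ⟨?_, ?_⟩
  · rw [mem_closedBall_zero_iff, hn]; exact ht.2.le
  · intro h
    have h0 : t • x = 0 := h
    rw [h0, norm_zero] at hn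
    exact ht0.ne hn

theorem eventually_Ioo : ∀ᶠ t : ℝ in 𝓝[>] 0, t ∈ Ioo (0 : ℝ) 4 :=
  Ioo_mem_nhdsGT (by norm_num)

theorem MemCS.zero : MemCS 0 := ⟨fun _ _ => rfl, continuousOn_const, fun _ _ _ => rfl⟩

theorem MemCS.add {f g : E3 → ℝ} (hf : MemCS f) (hg : MemCS g) : MemCS (f + g) where
  eq_zero_off x hx := by simp [hf.eq_zero_off x hx, hg.eq_zero_off x hx]
  continuousOn := hf.continuousOn.add hg.continuousOn
  symm i x hx := by simp [hf.symm i x hx, hg.symm i x hx]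

theorem MemCS.smul {f : E3 → ℝ} (c : ℝ) (hf : MemCS f) : MemCS (c • f) where
  eq_zero_off x hx := by simp [hf.eq_zero_off x hx]
  continuousOn := hf.continuousOn.const_smul c
  symm i x hx := by simp [hf.symm i x hx]

theorem MemX.zero : MemX 0 where
  toMemCS := MemCS.zero
  map_zero := rfl
  contDiffOn := contDiffOn_const
  bound := ⟨0, fun x _ => by simp [grad_zero]⟩
  radial_limit := ⟨0, by
    intro u hu
    refine Eventually.of_forall fun t x _ => ?_
    simpa [grad_zero] using refl_mem_uniformity hu⟩

theorem MemX.add {f g : E3 → ℝ} (hf : MemX f) (hg : MemX g) : MemX (f + g) where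
  toMemCS := hf.toMemCS.add hg.toMemCS
  map_zero := by simp [hf.map_zero, hg.map_zero]
  contDiffOn := hf.contDiffOn.add hg.contDiffOn
  bound := by
    obtain ⟨C, hC⟩ := hf.bound
    obtain ⟨D, hD⟩ := hg.bound
    refine ⟨C + D, fun x hx => ?_⟩
    rw [grad_add hx.1 (hf.diff hx) (hg.diff hx)]
    exact (norm_add_le _ _).trans (add_le_add (hC x hx) (hD x hx))
  radial_limit := by
    obtain ⟨G, hG⟩ := hf.radial_limit
    obtain ⟨H, hH⟩ := hg.radial_limit
    refine ⟨G + H, (hG.add hH).congr ?_⟩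
    filter_upwards [eventually_Ioo] with t ht x hx
    have h := ray_mem hx ht
    exact (grad_add h.1 (hf.diff h) (hg.diff h)).symm

theorem MemX.smul {f : E3 → ℝ} (c : ℝ) (hf : MemX f) : MemX (c • f) where
  toMemCS := hf.toMemCS.smul c
  map_zero := by simp [hf.map_zero]
  contDiffOn := hf.contDiffOn.const_smul c
  bound := by
    obtain ⟨C, hC⟩ := hf.bound
    refine ⟨‖c‖ * C, fun x hx => ?_⟩
    rw [grad_smul c hx.1 (hf.diff hx), norm_smul]
    exact mul_le_mul_of_nonneg_left (hC x hx) (norm_nonneg _)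
  radial_limit := by
    obtain ⟨G, hG⟩ := hf.radial_limit
    refine ⟨fun x => c • G x,
      ((uniformContinuous_const_smul c).comp_tendstoUniformlyOn hG).congr ?_⟩
    filter_upwards [eventually_Ioo] with t ht x hx
    have h := ray_mem hx ht
    exact (grad_smul c h.1 (hf.diff h)).symm

theorem MemY.zero : MemY 0 where
  toMemCS := MemCS.zero
  map_zero := rfl
  contDiffOn := contDiffOn_const
  bound := ⟨0, fun x _ => by simp [grad_zero]⟩
  radial_limit := ⟨0, by
    intro u hu
    refine Eventually.of_forall fun t x _ => ?_
    simpa [grad_zero] using refl_mem_uniformity hu⟩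

theorem MemY.add {f g : E3 → ℝ} (hf : MemY f) (hg : MemY g) : MemY (f + g) where
  toMemCS := hf.toMemCS.add hg.toMemCS
  map_zero := by simp [hf.map_zero, hg.map_zero]
  contDiffOn := hf.contDiffOn.add hg.contDiffOn
  bound := by
    obtain ⟨C, hC⟩ := hf.bound
    obtain ⟨D, hD⟩ := hg.bound
    refine ⟨C + D, fun x hx => ?_⟩
    rw [grad_add hx (hf.diff hx) (hg.diff hx), add_mul]
    exact (norm_add_le _ _).trans (add_le_add (hC x hx) (hD x hx))
  radial_limit := by
    obtain ⟨G, hG⟩ := hf.radial_limit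
    obtain ⟨H, hH⟩ := hg.radial_limit
    refine ⟨G + H, (hG.add hH).congr ?_⟩
    filter_upwards [eventually_Ioo] with t ht x hx
    have h := (ray_mem hx ht).1
    simp only [Pi.add_apply]
    rw [grad_add h (hf.diff h) (hg.diff h), smul_add]

theorem MemY.smul {f : E3 → ℝ} (c : ℝ) (hf : MemY f) : MemY (c • f) where
  toMemCS := hf.toMemCS.smul c
  map_zero := by simp [hf.map_zero]
  contDiffOn := hf.contDiffOn.const_smul c
  bound := by
    obtain ⟨C, hC⟩ := hf.bound
    refine ⟨‖c‖ * C, fun x hx => ?_⟩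
    rw [grad_smul c hx (hf.diff hx), norm_smul, mul_assoc]
    exact mul_le_mul_of_nonneg_left (hC x hx) (norm_nonneg _)
  radial_limit := by
    obtain ⟨G, hG⟩ := hf.radial_limit
    refine ⟨fun x => c • G x,
      ((uniformContinuous_const_smul c).comp_tendstoUniformlyOn hG).congr ?_⟩
    filter_upwards [eventually_Ioo] with t ht x hx
    have h := (ray_mem hx ht).1
    simp only [Function.comp]
    rw [grad_smul c h (hf.diff h), smul_comm]

/-- `X` as a linear subspace of the real functions on `ℝ³`. -/
def submoduleX : Submodule ℝ (E3 → ℝ) where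
  carrier := {f | MemX f}
  zero_mem' := MemX.zero
  add_mem' hf hg := MemX.add hf hg
  smul_mem' c _ hf := MemX.smul c hf

/-- `Y` as a linear subspace of the real functions on `ℝ³`. -/
def submoduleY : Submodule ℝ (E3 → ℝ) where
  carrier := {f | MemY f}
  zero_mem' := MemY.zero
  add_mem' hf hg := MemY.add hf hg
  smul_mem' c _ hf := MemY.smul c hf

/-- The space `X` of deformations. -/
def SpaceX : Type := ↥submoduleX

/-- The space `Y`, the range of the operator. -/
def SpaceY : Type := ↥submoduleY

instance : AddCommGroup SpaceX := inferInstanceAs (AddCommGroup ↥submoduleX)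
instance : Module ℝ SpaceX := inferInstanceAs (Module ℝ ↥submoduleX)
instance : AddCommGroup SpaceY := inferInstanceAs (AddCommGroup ↥submoduleY)
instance : Module ℝ SpaceY := inferInstanceAs (Module ℝ ↥submoduleY)

/-- The function underlying an element of `X`. -/
def SpaceX.fn (f : SpaceX) : E3 → ℝ := Subtype.val (p := fun g => g ∈ submoduleX) f

/-- The function underlying an element of `Y`. -/
def SpaceY.fn (f : SpaceY) : E3 → ℝ := Subtype.val (p := fun g => g ∈ submoduleY) f

theorem SpaceX.mem (f : SpaceX) : MemX f.fn := Subtype.property (p := fun g => g ∈ submoduleX) f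
theorem SpaceY.mem (f : SpaceY) : MemY f.fn := Subtype.property (p := fun g => g ∈ submoduleY) f
theorem SpaceX.fn_injective : Function.Injective SpaceX.fn := Subtype.val_injective
theorem SpaceY.fn_injective : Function.Injective SpaceY.fn := Subtype.val_injective
theorem SpaceX.fn_add (f g : SpaceX) : (f + g).fn = f.fn + g.fn := rfl
theorem SpaceY.fn_add (f g : SpaceY) : (f + g).fn = f.fn + g.fn := rfl
theorem SpaceX.fn_smul (c : ℝ) (f : SpaceX) : (c • f).fn = c • f.fn := rfl
theorem SpaceY.fn_smul (c : ℝ) (f : SpaceY) : (c • f).fn = c • f.fn := rfl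
theorem SpaceX.fn_zero : (0 : SpaceX).fn = 0 := rfl
theorem SpaceY.fn_zero : (0 : SpaceY).fn = 0 := rfl

/-- `‖f‖_X = sup { |∇f(x)| : 0 < |x| ≤ 4 }`. -/
instance : Norm SpaceX := ⟨fun f => ⨆ x : B4', ‖grad f.fn x‖⟩

/-- `‖f‖_Y = sup { |∇f(x)| / |x| : 0 < |x| ≤ 4 }`. -/
instance : Norm SpaceY := ⟨fun f => ⨆ x : B4', ‖grad f.fn x‖ / ‖(x : E3)‖⟩

theorem SpaceX.norm_def (f : SpaceX) : ‖f‖ = ⨆ x : B4', ‖grad f.fn x‖ := rfl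
theorem SpaceY.norm_def (f : SpaceY) : ‖f‖ = ⨆ x : B4', ‖grad f.fn x‖ / ‖(x : E3)‖ := rfl

theorem SpaceX.grad_le (f : SpaceX) {x : E3} (hx : x ∈ B4') : ‖grad f.fn x‖ ≤ ‖f‖ := by
  obtain ⟨C, hC⟩ := f.mem.bound
  exact le_ciSup (f := fun x : B4' => ‖grad f.fn x‖)
    ⟨C, by rintro _ ⟨y, rfl⟩; exact hC y y.2⟩ ⟨x, hx⟩

theorem SpaceY.grad_le (f : SpaceY) {x : E3} (hx : x ∈ B4') :
    ‖grad f.fn x‖ / ‖x‖ ≤ ‖f‖ := by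
  obtain ⟨C, hC⟩ := f.mem.bound
  refine le_ciSup (f := fun x : B4' => ‖grad f.fn x‖ / ‖(x : E3)‖)
    ⟨C, ?_⟩ ⟨x, hx⟩
  rintro _ ⟨y, rfl⟩
  have hy : 0 < ‖(y : E3)‖ := norm_pos_iff.2 y.2.2
  exact (div_le_iff₀ hy).2 (hC y y.2.1)

theorem SpaceX.norm_nonneg' (f : SpaceX) : 0 ≤ ‖f‖ := by
  rw [SpaceX.norm_def]
  exact Real.iSup_nonneg fun _ => norm_nonneg _

theorem SpaceY.norm_nonneg' (f : SpaceY) : 0 ≤ ‖f‖ := by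
  rw [SpaceY.norm_def]
  exact Real.iSup_nonneg fun _ => div_nonneg (norm_nonneg _) (norm_nonneg _)

/-- A continuous function on `B_4` that vanishes at the origin and has vanishing gradient away
from it is zero on `B_4`. -/
theorem eq_zero_of_grad {f : E3 → ℝ} (hc : ContinuousOn f (B 4)) (h0 : f 0 = 0)
    (hd : ∀ x ∈ B4', DifferentiableWithinAt ℝ f (B 4) x) (hg : ∀ x ∈ B4', grad f x = 0)
    {x : E3} (hx : x ∈ B 4) : f x = 0 := by
  by_cases hx0 : x = 0
  · rw [hx0, h0]
  have hxn : ‖x‖ ≤ 4 := by simpa using hx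
  have hxp : 0 < ‖x‖ := norm_pos_iff.2 hx0
  have hcont : ContinuousOn (fun t : ℝ => f (t • x)) (Icc 0 1) := by
    refine hc.comp (by fun_prop) ?_
    intro t ht
    rw [mem_closedBall_zero_iff, norm_smul, Real.norm_eq_abs, abs_of_nonneg ht.1]
    nlinarith [ht.2]
  have hder : ∀ t ∈ Ioo (0 : ℝ) 1, HasDerivAt (fun t : ℝ => f (t • x)) 0 t := by
    intro t ht
    have hn : ‖t • x‖ < 4 := by
      rw [norm_smul, Real.norm_eq_abs, abs_of_pos ht.1]
      nlinarith [ht.1, ht.2]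
    have hm : t • x ∈ B4' := ⟨by rw [mem_closedBall_zero_iff]; exact hn.le,
      fun h => (smul_ne_zero ht.1.ne' hx0) h⟩
    have h1 := (hd _ hm).hasFDerivWithinAt
    change HasFDerivWithinAt f (grad f (t • x)) (B 4) (t • x) at h1
    rw [hg _ hm] at h1
    have h2 : HasFDerivAt f 0 (t • x) := h1.hasFDerivAt
      (mem_of_superset (Metric.isOpen_ball.mem_nhds (mem_ball_zero_iff.2 hn))
        Metric.ball_subset_closedBall)
    have h3 : HasDerivAt (fun t : ℝ => t • x) x t := by
      simpa using (hasDerivAt_id t).smul_const x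
    have h4 := h2.comp_hasDerivAt t h3
    rw [_root_.zero_apply] at h4
    exact h4
  obtain ⟨c, _, hc2⟩ := exists_hasDerivAt_eq_slope (fun t : ℝ => f (t • x)) (fun _ => 0)
    (by norm_num : (0 : ℝ) < 1) hcont hder
  simp [h0] at hc2
  exact hc2.symm

theorem coreX : NormedSpace.Core ℝ SpaceX where
  norm_nonneg := SpaceX.norm_nonneg'
  norm_smul c f := by
    simp only [SpaceX.norm_def, SpaceX.fn_smul]
    rw [Real.mul_iSup_of_nonneg (norm_nonneg c)]
    congr 1
    funext x
    rw [grad_smul c x.2.1 (f.mem.diff x.2), norm_smul]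
  norm_triangle f g := by
    rw [SpaceX.norm_def (f + g)]
    refine Real.iSup_le (fun x => ?_) (add_nonneg f.norm_nonneg' g.norm_nonneg')
    rw [SpaceX.fn_add, grad_add x.2.1 (f.mem.diff x.2) (g.mem.diff x.2)]
    exact (norm_add_le _ _).trans (add_le_add (f.grad_le x.2) (g.grad_le x.2))
  norm_eq_zero_iff f := by
    constructor
    · intro h
      apply SpaceX.fn_injective
      funext x
      by_cases hx : x ∈ B 4
      · refine eq_zero_of_grad f.mem.continuousOn f.mem.map_zero (fun y hy => f.mem.diff hy)
          (fun y hy => ?_) hx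
        exact norm_le_zero_iff.1 (h ▸ f.grad_le hy)
      · exact f.mem.eq_zero_off x hx
    · rintro rfl
      simp [SpaceX.norm_def, SpaceX.fn_zero, grad_zero]

theorem coreY : NormedSpace.Core ℝ SpaceY where
  norm_nonneg := SpaceY.norm_nonneg'
  norm_smul c f := by
    simp only [SpaceY.norm_def, SpaceY.fn_smul]
    rw [Real.mul_iSup_of_nonneg (norm_nonneg c)]
    congr 1
    funext x
    rw [grad_smul c x.2.1 (f.mem.diff x.2.1), norm_smul, mul_div_assoc]
  norm_triangle f g := by
    rw [SpaceY.norm_def (f + g)]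
    refine Real.iSup_le (fun x => ?_) (add_nonneg f.norm_nonneg' g.norm_nonneg')
    rw [SpaceY.fn_add, grad_add x.2.1 (f.mem.diff x.2.1) (g.mem.diff x.2.1)]
    refine le_trans ?_ (add_le_add (f.grad_le x.2) (g.grad_le x.2))
    rw [← add_div]
    exact div_le_div_of_nonneg_right (norm_add_le _ _) (norm_nonneg _)
  norm_eq_zero_iff f := by
    constructor
    · intro h
      apply SpaceY.fn_injective
      funext x
      by_cases hx : x ∈ B 4
      · refine eq_zero_of_grad f.mem.continuousOn f.mem.map_zero (fun y hy => f.mem.diff hy.1)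
          (fun y hy => ?_) hx
        have h1 := h ▸ f.grad_le hy
        have hy' : 0 < ‖y‖ := norm_pos_iff.2 hy.2
        rw [div_le_iff₀ hy', zero_mul] at h1
        exact norm_le_zero_iff.1 h1
      · exact f.mem.eq_zero_off x hx
    · rintro rfl
      simp [SpaceY.norm_def, SpaceY.fn_zero, grad_zero]

instance : NormedAddCommGroup SpaceX := NormedAddCommGroup.ofCore coreX
instance : NormedSpace ℝ SpaceX := NormedSpace.ofCore coreX
instance : NormedAddCommGroup SpaceY := NormedAddCommGroup.ofCore coreY
instance : NormedSpace ℝ SpaceY := NormedSpace.ofCore coreY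

/-! ### The steady state -/

/-- The assumptions on the microscopic equation of state `φ` with cut-off energy `E₀`: it is
continuously differentiable, vanishes on `[E₀, ∞)`, and is positive and strictly decreasing
on `(-∞, E₀)`. -/
structure IsAnsatz (φ : ℝ → ℝ) (E₀ : ℝ) : Prop where
  contDiff : ContDiff ℝ 1 φ
  eq_zero : ∀ E, E₀ ≤ E → φ E = 0
  pos : ∀ E, E < E₀ → 0 < φ E
  strictAnti : StrictAntiOn φ (Iio E₀)

/-- `(f, ρ, U)` is a time-independent solution of the Vlasov-Poisson system. -/
structure IsStationarySolution (f : E3 → E3 → ℝ) (ρ U : E3 → ℝ) : Prop where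
  vlasov : ∀ x v : E3, fderiv ℝ (fun y => f y v) x v
    - fderiv ℝ (fun w => f x w) v (gradient U x) = 0
  poisson : ∀ x : E3, Δ U x = 4 * Real.pi * ρ x
  density : ∀ x : E3, Integrable (f x) ∧ ρ x = ∫ v : E3, f x v

/-- The spherically symmetric steady state generated by the ansatz `f₀ = φ(E)`, where
`E = |v|² / 2 + U₀(x)`, normalised so that the support of its density is the unit ball. -/
structure IsSphericalSteadyState (φ : ℝ → ℝ) (f₀ : E3 → E3 → ℝ) (ρ₀ U₀ : E3 → ℝ) : Prop where
  ansatz : ∀ x v : E3, f₀ x v = φ (‖v‖ ^ 2 / 2 + U₀ x)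
  solution : IsStationarySolution f₀ ρ₀ U₀
  symm_f : ∀ (A : E3 ≃ₗᵢ[ℝ] E3) (x v : E3), f₀ (A x) (A v) = f₀ x v
  symm_ρ : ∀ (A : E3 ≃ₗᵢ[ℝ] E3) (x : E3), ρ₀ (A x) = ρ₀ x
  symm_U : ∀ (A : E3 ≃ₗᵢ[ℝ] E3) (x : E3), U₀ (A x) = U₀ x
  contDiff_ρ : ContDiff ℝ 1 ρ₀
  tsupport_ρ : tsupport ρ₀ = B 1
  contDiff_U : ContDiff ℝ 2 U₀
  tendsto_U : Tendsto U₀ (cocompact E3) (𝓝 0)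

/-! ### The operator -/

/-- `U₀(2)`, the value of the spherically symmetric potential at radius `2`. -/
def potentialAtTwo (U₀ : E3 → ℝ) : ℝ := U₀ (EuclideanSpace.single 0 2)

/-- The constant `E₁ = U₀(2) - E₀`. -/
def E₁ (E₀ : ℝ) (U₀ : E3 → ℝ) : ℝ := potentialAtTwo U₀ - E₀

/-- The distance `r(x)` of `x` from the axis of rotation (the third coordinate axis). -/
def axisDist (x : E3) : ℝ := √(x 0 ^ 2 + x 1 ^ 2)

/-- The function `h̃(ω, r, u)`: the density induced by `φ(|v|²/2 + u - ω² r²/2)`, cut off where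
`u ≥ E₀ + E₁`. -/
def hTilde (φ : ℝ → ℝ) (E₀ : ℝ) (U₀ : E3 → ℝ) (ω r u : ℝ) : ℝ :=
  open Classical in
  if u < E₀ + E₁ E₀ U₀ then ∫ v : E3, φ (‖v‖ ^ 2 / 2 + u - ω ^ 2 * r ^ 2 / 2) else 0

/-- The deformation `g_ζ(x) = x + ζ(x) x/|x|` of `B_4`, with `g_ζ(0) = 0`. -/
def deform (ζ : E3 → ℝ) (x : E3) : E3 := x + (ζ x / ‖x‖) • x

/-- The inverse `g_ζ⁻¹` of `g_ζ : B_4 → g_ζ(B_4)`. -/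
def deformInv (ζ : E3 → ℝ) (y : E3) : E3 := Function.invFunOn (deform ζ) (B 4) y

/-- The density `y ↦ h̃(ω, r(y), U₀(g_ζ⁻¹(y)))`. -/
def deformedDensity (φ : ℝ → ℝ) (E₀ : ℝ) (U₀ : E3 → ℝ) (ω : ℝ) (ζ : E3 → ℝ) (y : E3) : ℝ :=
  hTilde φ E₀ U₀ ω (axisDist y) (U₀ (deformInv ζ y))

/-- The operator `T(ω, ζ)`, evaluated at the point `x` of `B_4`. -/
def opT (φ : ℝ → ℝ) (E₀ : ℝ) (U₀ : E3 → ℝ) (ω : ℝ) (ζ : E3 → ℝ) (x : E3) : ℝ :=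
  U₀ x + (∫ y in B 3, deformedDensity φ E₀ U₀ ω ζ y / ‖deform ζ x - y‖)
    - U₀ 0 - ∫ y in B 3, deformedDensity φ E₀ U₀ ω ζ y / ‖y‖

end RotatingVP

end

/-! Reduction. At `ω = 0` the deformed density is `ρ₀ ∘ g_ζ⁻¹` (`hTilde_zero_eq`), and Newton's
shell theorem gives `U₀ - U₀(0) = -(pot ρ₀ - pot ρ₀ 0)`. With `σ = ρ₀ ∘ g_ζ⁻¹ - ρ₀` on `B_3`, the
operator splits as `[U₀ - U₀ ∘ g_ζ] + [pot σ ∘ g_ζ - pot σ 0]` (`opT_eq`). Let `u`, `r` be the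
radial profiles of `U₀`, `ρ₀`. Since `|g_ζ(x)| = |x| + ζ(x)`, the first bracket is `-u' ζ` and `σ`
is `-r' ζ`, both to first order. With `q = -r'/u'` and `W = u' ζ` the derivative is therefore `S W -
W`, where `S W = pot (q W) - pot (q W) 0`.

Analysis. A density with `|f(y)| ≤ M |y|` has a potential whose gradient is Lipschitz at the origin
and differentiable there, provided the third powers in the derivative of the Coulomb field are
compensated by the factor `|y|`. If `f` also has the reflection symmetries, the gradient vanishes at
the origin, and the normalised potential lies in `Y`. The kernel remainders are dominated by the
integrable power `|z|^(-5/2)`; this yields the bounds in the norm of `Y` and differentiability at `ζ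
= 0` (`isLittleO_val`).

Isomorphism. Since `u'(s)` is comparable with `s`, multiplication by `u'` identifies `X` with `Y`
(`mulEquiv`). The operator `S` is compact on the continuous functions on `B_4`, so on those with the
reflection symmetries `1 - S` is invertible once it is injective (`exists_solution`). A continuous
solution of `W - S W = F` with `F` in `Y` is `O(|x|)`, so `S W`, and with it `W`, lies in `Y`.

Injectivity (`eq_zero_of_linearized`). Let `W = S W` be invariant under the reflections. Rotate `W`
about the third axis and subtract the reflection in the second coordinate: the constant cancels, and
the difference `Z` solves `Z = pot (q Z)` and is odd in two coordinates. The derivative `∂₀ U₀`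
solves the same equation, is odd in only one of these coordinates, and has the sign of that
coordinate. After symmetrisation, the kernel acting on `Z` is strictly dominated by the one acting
on `∂₀ U₀`; pairing the two equations forces `Z = 0` (`eq_zero_of_odd`). Hence `W` is symmetric
about every plane through the axis. The same applied to a second axis makes `W` radial; for radial
`W` the shell theorem turns the equation into a Volterra equation, whose only solution is zero. -/

noncomputable section

namespace RotatingVP

/-! ### The Newtonian kernel -/

/-- The locally integrable majorant `|z|^(-5/2)`. -/
def kap (z : E3) : ℝ := (√‖z‖ ^ 5)⁻¹

/-- The Coulomb field `z / |z|³`. -/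
def Kv (z : E3) : E3 := (‖z‖ ^ 3)⁻¹ • z

/-- The derivative of the Coulomb field at `z`, applied to `h`. -/
def DKv (z h : E3) : E3 := (‖z‖ ^ 3)⁻¹ • h - (3 * inner ℝ z h / ‖z‖ ^ 5) • z

theorem kap_nonneg (z : E3) : 0 ≤ kap z := by unfold kap; positivity

theorem kap_neg (z : E3) : kap (-z) = kap z := by simp [kap]

theorem Kv_neg (z : E3) : Kv (-z) = -Kv z := by simp [Kv]

theorem kap_eq (z : E3) : kap z = (√‖z‖)⁻¹ ^ 5 := by simp [kap]

theorem inv_norm_eq (z : E3) : ‖z‖⁻¹ = (√‖z‖)⁻¹ ^ 2 := by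
  rw [inv_pow, Real.sq_sqrt (norm_nonneg z)]

theorem inv_norm_le (z : E3) : ‖z‖⁻¹ ≤ 1 + kap z := by
  rw [kap_eq, inv_norm_eq]
  have : 0 ≤ (√‖z‖)⁻¹ := by positivity
  generalize (√‖z‖)⁻¹ = x at *
  rcases le_total x 1 with h | h
  · have := pow_le_one₀ (n := 2) this h
    have : 0 ≤ x ^ 5 := by positivity
    linarith
  · have := pow_le_pow_right₀ h (show 2 ≤ 5 by norm_num)
    linarith

theorem inv_norm_sq_le (z : E3) : (‖z‖ ^ 2)⁻¹ ≤ 1 + kap z := by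
  rw [← inv_pow, kap_eq, inv_norm_eq]
  have : 0 ≤ (√‖z‖)⁻¹ := by positivity
  generalize (√‖z‖)⁻¹ = x at *
  rcases le_total x 1 with h | h
  · have := pow_le_one₀ (n := 4) this h
    have : 0 ≤ x ^ 5 := by positivity
    nlinarith
  · have := pow_le_pow_right₀ h (show 4 ≤ 5 by norm_num)
    nlinarith

theorem norm_Kv (z : E3) : ‖Kv z‖ = (‖z‖ ^ 2)⁻¹ := by
  rcases eq_or_ne z 0 with rfl | hz
  · simp [Kv]
  have : ‖z‖ ≠ 0 := norm_ne_zero_iff.2 hz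
  rw [Kv, norm_smul, norm_inv, norm_pow, norm_norm]
  field_simp

theorem norm_Kv_le (z : E3) : ‖Kv z‖ ≤ 1 + kap z := norm_Kv z ▸ inv_norm_sq_le z

theorem pow_four_mul_le {x y : ℝ} (hx : 0 ≤ x) (hy : 0 ≤ y) : x ^ 4 * y ≤ x ^ 5 + y ^ 5 := by
  rcases le_total x y with h | h
  · have : x ^ 4 ≤ y ^ 4 := by gcongr
    nlinarith [pow_nonneg hx 5]
  · have : 0 ≤ x ^ 4 := by positivity
    nlinarith [pow_nonneg hy 5]

/-- Interpolation between a second-order Taylor bound and a triangle-inequality bound, with `δ =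
√|h|` and `x`, `y` the inverse square roots of `|z|`, `|z + h|`. The switch takes place where `δ x`
or `δ y` crosses `1`. The result keeps only fifth powers, that is `|z|^(-5/2)`, which is integrable,
at the price of the rate `|h|^(3/2)` instead of `|h|²`. -/
theorem remainder_scalar_le {x y δ : ℝ} (hx : 0 ≤ x) (hy : 0 ≤ y) (hδ : 0 ≤ δ) :
    min (δ ^ 4 * (x ^ 6 / 2 + x ^ 4 * y ^ 2)) (x ^ 2 + y ^ 2 + δ ^ 2 * x ^ 4)
      ≤ 3 * δ ^ 3 * (x ^ 5 + y ^ 5) := by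
  have hX : 0 ≤ δ ^ 3 * x ^ 5 := by positivity
  have hY : 0 ≤ δ ^ 3 * y ^ 5 := by positivity
  rcases le_total (δ * x) 1 with h | h
  · refine (min_le_left _ _).trans ?_
    have h1 : δ ^ 3 * x ^ 5 * (δ * x) ≤ δ ^ 3 * x ^ 5 := mul_le_of_le_one_right hX h
    have h2 : δ ^ 4 * (x ^ 4 * y ^ 2) ≤ δ ^ 3 * x ^ 5 + δ ^ 3 * y ^ 5 := by
      rcases le_total (δ * y) 1 with h' | h'
      · have : δ ^ 3 * (x ^ 4 * y) * (δ * y) ≤ δ ^ 3 * (x ^ 4 * y) :=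
          mul_le_of_le_one_right (by positivity) h'
        have := mul_le_mul_of_nonneg_left (pow_four_mul_le hx hy) (pow_nonneg hδ 3)
        linarith
      · have h3 : y ^ 2 * (δ * x) ^ 4 ≤ y ^ 2 :=
          mul_le_of_le_one_right (by positivity) (pow_le_one₀ (by positivity) h)
        have h4 : y ^ 2 ≤ y ^ 2 * (δ * y) ^ 3 :=
          le_mul_of_one_le_right (by positivity) (one_le_pow₀ h')
        nlinarith
    nlinarith
  · refine (min_le_right _ _).trans ?_
    have h1 : x ^ 2 ≤ x ^ 2 * (δ * x) ^ 3 :=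
      le_mul_of_one_le_right (by positivity) (one_le_pow₀ h)
    have h2 : δ ^ 2 * x ^ 4 ≤ δ ^ 2 * x ^ 4 * (δ * x) := le_mul_of_one_le_right (by positivity) h
    have h3 : y ^ 2 ≤ δ ^ 3 * x ^ 5 + δ ^ 3 * y ^ 5 := by
      rcases le_total (δ * y) 1 with h' | h'
      · have hδ0 : 0 < δ := by
          rcases hδ.eq_or_lt with rfl | h0
          · norm_num at h
          · exact h0
        have : y ≤ x := le_of_mul_le_mul_left (h'.trans h) hδ0
        have : y ^ 2 ≤ x ^ 2 := by gcongr
        nlinarith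
      · have : y ^ 2 ≤ y ^ 2 * (δ * y) ^ 3 :=
          le_mul_of_one_le_right (by positivity) (one_le_pow₀ h')
        nlinarith
    nlinarith

/-- The same interpolation one order lower: it trades a full power of the increment for a square
root, so that the Coulomb field becomes Hölder continuous with an integrable constant. -/
theorem holder_scalar_le {x y δ : ℝ} (hx : 0 ≤ x) (hy : 0 ≤ y) (hδ : 0 ≤ δ) :
    min (δ ^ 2 * (x ^ 4 * y ^ 2 + x ^ 2 * y ^ 4)) (x ^ 4 + y ^ 4)
      ≤ 2 * δ * (x ^ 5 + y ^ 5) := by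
  wlog hxy : y ≤ x generalizing x y
  · have := this hy hx (le_of_not_ge hxy)
    rw [add_comm (y ^ 4), add_comm (y ^ 5)] at this
    convert this using 3
    ring
  have hX : 0 ≤ δ * x ^ 5 := by positivity
  have hY : 0 ≤ δ * y ^ 5 := by positivity
  have h4 : y ^ 4 ≤ x ^ 4 := by gcongr
  rcases le_total (δ * x) 1 with h | h
  · refine (min_le_left _ _).trans ?_
    have h' : δ * y ≤ 1 := (mul_le_mul_of_nonneg_left hxy hδ).trans h
    have h1 : δ * (x ^ 4 * y) * (δ * y) ≤ δ * (x ^ 4 * y) :=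
      mul_le_of_le_one_right (by positivity) h'
    have h2 : δ * (y ^ 4 * x) * (δ * x) ≤ δ * (y ^ 4 * x) :=
      mul_le_of_le_one_right (by positivity) h
    have h3 := mul_le_mul_of_nonneg_left (pow_four_mul_le hx hy) hδ
    have h5 := mul_le_mul_of_nonneg_left (pow_four_mul_le hy hx) hδ
    nlinarith
  · refine (min_le_right _ _).trans ?_
    have h2 : x ^ 4 ≤ x ^ 4 * (δ * x) := le_mul_of_one_le_right (by positivity) h
    nlinarith

/-- The field is `|z|⁻¹` times the inversion `z / |z|²`, and the distance of two inverted points is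
known exactly. What remains is the variation of the scalar factor. -/
theorem norm_Kv_sub_le {z z' : E3} (hz : z ≠ 0) (hz' : z' ≠ 0) :
    ‖Kv z - Kv z'‖ ≤ ‖z - z'‖ * ((‖z‖ ^ 2 * ‖z'‖)⁻¹ + (‖z‖ * ‖z'‖ ^ 2)⁻¹) := by
  have ha : 0 < ‖z‖ := norm_pos_iff.2 hz
  have hb : 0 < ‖z'‖ := norm_pos_iff.2 hz'
  have h1 := dist_div_norm_sq_smul hz hz' 1
  rw [dist_eq_norm, dist_eq_norm] at h1
  have h2 : Kv z - Kv z' = ‖z‖⁻¹ • ((1 / ‖z‖) ^ 2 • z - (1 / ‖z'‖) ^ 2 • z')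
      + ((‖z‖⁻¹ - ‖z'‖⁻¹) * (‖z'‖ ^ 2)⁻¹) • z' := by
    simp only [Kv, smul_sub, smul_smul, sub_mul, sub_smul]
    have e1 : ‖z‖⁻¹ * (1 / ‖z‖) ^ 2 = (‖z‖ ^ 3)⁻¹ := by field_simp
    have e2 : ‖z'‖⁻¹ * (‖z'‖ ^ 2)⁻¹ = (‖z'‖ ^ 3)⁻¹ := by field_simp
    have e3 : ‖z‖⁻¹ * (1 / ‖z'‖) ^ 2 = ‖z‖⁻¹ * (‖z'‖ ^ 2)⁻¹ := by field_simp
    rw [e1, e2, e3]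
    abel
  rw [h2]
  refine (norm_add_le _ _).trans ?_
  rw [norm_smul, h1, norm_smul, norm_mul, norm_inv, norm_norm, norm_inv, norm_pow, norm_norm,
    Real.norm_eq_abs]
  have h3 : |‖z‖⁻¹ - ‖z'‖⁻¹| ≤ ‖z - z'‖ * (‖z‖ * ‖z'‖)⁻¹ := by
    have : ‖z‖⁻¹ - ‖z'‖⁻¹ = (‖z'‖ - ‖z‖) * (‖z‖ * ‖z'‖)⁻¹ := by field_simp
    rw [this, abs_mul, abs_of_pos (by positivity : 0 < (‖z‖ * ‖z'‖)⁻¹)]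
    gcongr
    rw [abs_sub_comm]
    exact abs_norm_sub_norm_le z z'
  calc _ ≤ ‖z‖⁻¹ * (1 ^ 2 / (‖z‖ * ‖z'‖) * ‖z - z'‖)
      + ‖z - z'‖ * (‖z‖ * ‖z'‖)⁻¹ * (‖z'‖ ^ 2)⁻¹ * ‖z'‖ := by gcongr
    _ = _ := by field_simp

theorem norm_Kv_sub_le_holder {z z' : E3} (hz : z ≠ 0) (hz' : z' ≠ 0) :
    ‖Kv z - Kv z'‖ ≤ 2 * √‖z - z'‖ * (kap z + kap z') := by
  rw [kap_eq, kap_eq]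
  refine le_trans (le_min ?_ ?_) (holder_scalar_le (by positivity) (by positivity)
    (Real.sqrt_nonneg _))
  · refine (norm_Kv_sub_le hz hz').trans (le_of_eq ?_)
    rw [Real.sq_sqrt (norm_nonneg _), mul_inv, mul_inv, ← inv_pow, ← inv_pow, inv_norm_eq,
      inv_norm_eq]
    ring
  · refine (norm_sub_le _ _).trans (le_of_eq ?_)
    rw [norm_Kv, norm_Kv, ← inv_pow, ← inv_pow, inv_norm_eq, inv_norm_eq]
    ring

theorem inv_norm_add_remainder_le {z h : E3} (hz : z ≠ 0) (hzh : z + h ≠ 0) :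
    |‖z + h‖⁻¹ - ‖z‖⁻¹ + inner ℝ (Kv z) h| ≤ 3 * √‖h‖ ^ 3 * (kap z + kap (z + h)) := by
  have ha : 0 < ‖z‖ := norm_pos_iff.2 hz
  have hb : 0 < ‖z + h‖ := norm_pos_iff.2 hzh
  have hp : ‖z + h‖ ^ 2 = ‖z‖ ^ 2 + 2 * inner ℝ z h + ‖h‖ ^ 2 := norm_add_sq_real z h
  have hin : inner ℝ (Kv z) h = inner ℝ z h / ‖z‖ ^ 3 := by
    rw [Kv, real_inner_smul_left]; field_simp
  have hcs : |inner ℝ z h| ≤ ‖z‖ * ‖h‖ := abs_real_inner_le_norm z h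
  have hd : |‖z + h‖ - ‖z‖| ≤ ‖h‖ := by simpa using abs_norm_sub_norm_le (z + h) z
  rw [kap_eq, kap_eq]
  refine le_trans (le_min ?_ ?_) (remainder_scalar_le (by positivity) (by positivity)
    (Real.sqrt_nonneg _))
  · have e1 : (√‖z‖)⁻¹ ^ 6 = (‖z‖⁻¹) ^ 3 := by rw [inv_norm_eq]; ring
    have e2 : (√‖z‖)⁻¹ ^ 4 = (‖z‖⁻¹) ^ 2 := by rw [inv_norm_eq]; ring
    have e3 : √‖h‖ ^ 4 = ‖h‖ ^ 2 := by
      rw [show √‖h‖ ^ 4 = (√‖h‖ ^ 2) ^ 2 by ring, Real.sq_sqrt (norm_nonneg _)]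
    rw [e1, e2, e3, ← inv_norm_eq, hin]
    generalize ‖z‖ = a at *
    generalize ‖z + h‖ = b at *
    generalize ‖h‖ = d at *
    generalize inner ℝ z h = p at *
    have hp' : p = (b ^ 2 - a ^ 2 - d ^ 2) / 2 := by linarith
    -- Once the inner product is eliminated by polarisation, the remainder is an exact rational
    -- function of the three lengths, visibly quadratic in `b - a` and `d`.
    have : b⁻¹ - a⁻¹ + p / a ^ 3 = ((b - a) ^ 2 * (b + 2 * a) - b * d ^ 2) / (2 * a ^ 3 * b) := by
      rw [hp']; field_simp; ring
    have h2 : d ^ 2 * (a⁻¹ ^ 3 / 2 + a⁻¹ ^ 2 * b⁻¹) = d ^ 2 * (b + 2 * a) / (2 * a ^ 3 * b) := by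
      field_simp
    rw [this, h2, abs_div, abs_of_pos (by positivity : 0 < 2 * a ^ 3 * b)]
    gcongr
    have h3 : (b - a) ^ 2 ≤ d ^ 2 := sq_le_sq' (by linarith [abs_le.1 hd]) (by linarith [abs_le.1 hd])
    rw [abs_le]
    constructor <;> nlinarith [sq_nonneg (b - a), sq_nonneg d]
  · have e2 : (√‖z‖)⁻¹ ^ 4 = (‖z‖⁻¹) ^ 2 := by rw [inv_norm_eq]; ring
    rw [e2, ← inv_norm_eq, ← inv_norm_eq, Real.sq_sqrt (norm_nonneg _), hin]
    have h1 : |inner ℝ z h / ‖z‖ ^ 3| ≤ ‖h‖ * ‖z‖⁻¹ ^ 2 := by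
      rw [abs_div, abs_of_pos (by positivity : 0 < ‖z‖ ^ 3), div_le_iff₀ (by positivity)]
      refine hcs.trans (le_of_eq ?_)
      field_simp
    have h2 := abs_add_le (‖z + h‖⁻¹ - ‖z‖⁻¹) (inner ℝ z h / ‖z‖ ^ 3)
    have h3 := abs_sub (‖z + h‖⁻¹) (‖z‖⁻¹)
    rw [abs_of_pos (inv_pos.2 ha), abs_of_pos (inv_pos.2 hb)] at h3
    linarith

theorem norm_DKv_le (z h : E3) : ‖DKv z h‖ ≤ 4 * ‖h‖ * (‖z‖ ^ 3)⁻¹ := by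
  rcases eq_or_ne z 0 with rfl | hz
  · simp [DKv]
  have ha : 0 < ‖z‖ := norm_pos_iff.2 hz
  have hcs : |inner ℝ z h| ≤ ‖z‖ * ‖h‖ := abs_real_inner_le_norm z h
  refine (norm_sub_le _ _).trans ?_
  rw [norm_smul, norm_smul, norm_inv, norm_pow, norm_norm, norm_div, norm_mul, norm_pow, norm_norm,
    Real.norm_eq_abs, Real.norm_eq_abs, abs_of_pos (by norm_num : (0 : ℝ) < 3)]
  calc _ ≤ (‖z‖ ^ 3)⁻¹ * ‖h‖ + 3 * (‖z‖ * ‖h‖) / ‖z‖ ^ 5 * ‖z‖ := by gcongr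
    _ = _ := by field_simp; ring

theorem norm_Kv_taylor_le {z h : E3} (hz : z ≠ 0) (hh : ‖h‖ ≤ ‖z‖ / 2) :
    ‖Kv (z + h) - Kv z - DKv z h‖ ≤ 170 * ‖h‖ ^ 2 * (‖z‖ ^ 4)⁻¹ := by
  have ha : 0 < ‖z‖ := norm_pos_iff.2 hz
  have hd : |‖z + h‖ - ‖z‖| ≤ ‖h‖ := by simpa using abs_norm_sub_norm_le (z + h) z
  have hp : ‖z + h‖ ^ 2 = ‖z‖ ^ 2 + 2 * inner ℝ z h + ‖h‖ ^ 2 := norm_add_sq_real z h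
  have hd0 := norm_nonneg h
  have key : Kv (z + h) - Kv z - DKv z h = ((‖z + h‖ ^ 3)⁻¹ - (‖z‖ ^ 3)⁻¹) • h
      + ((‖z + h‖ ^ 3)⁻¹ - (‖z‖ ^ 3)⁻¹ + 3 * inner ℝ z h / ‖z‖ ^ 5) • z := by
    simp only [Kv, DKv]
    module
  rw [key]
  refine (norm_add_le _ _).trans ?_
  rw [norm_smul, norm_smul, Real.norm_eq_abs, Real.norm_eq_abs]
  generalize ‖z‖ = a at *
  generalize ‖z + h‖ = b at *
  generalize ‖h‖ = d at *
  generalize inner ℝ z h = p at *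
  have hb1 : a / 2 ≤ b := by linarith [abs_le.1 hd]
  have hb2 : b ≤ 3 / 2 * a := by linarith [abs_le.1 hd]
  have hb : 0 < b := by linarith
  have hp' : p = (b ^ 2 - a ^ 2 - d ^ 2) / 2 := by linarith
  -- Insert `b ≤ 3a/2` in the numerator and `a/2 ≤ b` in the denominator: `38 = 8 (1 + 3/2 + 9/4)`.
  have h1 : |(b ^ 3)⁻¹ - (a ^ 3)⁻¹| ≤ 38 * d * (a ^ 4)⁻¹ := by
    have e : (b ^ 3)⁻¹ - (a ^ 3)⁻¹ = (a - b) * ((a ^ 2 + a * b + b ^ 2) / (a ^ 3 * b ^ 3)) := by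
      field_simp; ring
    rw [e, abs_mul, abs_of_pos (a := _ / _) (by positivity), abs_sub_comm]
    calc _ ≤ d * ((a ^ 2 + a * (3 / 2 * a) + (3 / 2 * a) ^ 2) / (a ^ 3 * (a / 2) ^ 3)) := by gcongr
      _ = 38 * d * (a ^ 4)⁻¹ := by field_simp; ring
  have h2 : |(b ^ 3)⁻¹ - (a ^ 3)⁻¹ + 3 * p / a ^ 5| ≤ 132 * d ^ 2 * (a ^ 5)⁻¹ := by
    have e : (b ^ 3)⁻¹ - (a ^ 3)⁻¹ + 3 * p / a ^ 5
        = (b - a) ^ 2 * ((3 * b ^ 3 + 6 * a * b ^ 2 + 4 * a ^ 2 * b + 2 * a ^ 3)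
          / (2 * a ^ 5 * b ^ 3)) - 3 / 2 * d ^ 2 * (a ^ 5)⁻¹ := by
      rw [hp']; field_simp; ring
    have h3 : (b - a) ^ 2 ≤ d ^ 2 :=
      sq_le_sq' (by linarith [abs_le.1 hd]) (by linarith [abs_le.1 hd])
    have h4 : (b - a) ^ 2 * ((3 * b ^ 3 + 6 * a * b ^ 2 + 4 * a ^ 2 * b + 2 * a ^ 3)
          / (2 * a ^ 5 * b ^ 3)) ≤ 130 * d ^ 2 * (a ^ 5)⁻¹ := by
      calc _ ≤ d ^ 2 * ((3 * (3 / 2 * a) ^ 3 + 6 * a * (3 / 2 * a) ^ 2 + 4 * a ^ 2 * (3 / 2 * a)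
            + 2 * a ^ 3) / (2 * a ^ 5 * (a / 2) ^ 3)) := by gcongr
        _ = 253 / 2 * (d ^ 2 * (a ^ 5)⁻¹) := by field_simp; ring
        _ ≤ 130 * (d ^ 2 * (a ^ 5)⁻¹) := by gcongr; norm_num
        _ = _ := by ring
    have h5 : 0 ≤ (b - a) ^ 2 * ((3 * b ^ 3 + 6 * a * b ^ 2 + 4 * a ^ 2 * b + 2 * a ^ 3)
          / (2 * a ^ 5 * b ^ 3)) := by positivity
    have h6 : 0 ≤ d ^ 2 * (a ^ 5)⁻¹ := by positivity
    rw [e, abs_le]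
    constructor <;> nlinarith
  calc _ ≤ 38 * d * (a ^ 4)⁻¹ * d + 132 * d ^ 2 * (a ^ 5)⁻¹ * a := by gcongr
    _ = _ := by field_simp; ring

/-- The weight `|y|` comes from a density vanishing linearly at the origin. For `|x| ≤ |y|/2`
Taylor's formula leaves `|x|² |y|⁻³`, of which half a power is exchanged for `|x|`; otherwise `|y|`
and `|x - y|` are at most of order `|x|`, and the three terms are bounded separately. -/
theorem norm_mul_Kv_taylor_le {x y : E3} (hy : y ≠ 0) (hxy : x - y ≠ 0) :
    ‖y‖ * ‖Kv (x - y) - Kv (-y) - DKv (-y) x‖ ≤ 170 * √‖x‖ ^ 3 * (kap y + kap (x - y)) := by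
  have ha : 0 < ‖y‖ := norm_pos_iff.2 hy
  have hb : 0 < ‖x - y‖ := norm_pos_iff.2 hxy
  have hX : 0 ≤ √‖x‖ ^ 3 * kap y := by have := kap_nonneg y; positivity
  have hY : 0 ≤ √‖x‖ ^ 3 * kap (x - y) := by have := kap_nonneg (x - y); positivity
  have hx2 : ‖x‖ = √‖x‖ ^ 2 := (Real.sq_sqrt (norm_nonneg _)).symm
  rcases le_total ‖x‖ (‖y‖ / 2) with h | h
  · have h1 := norm_Kv_taylor_le (z := -y) (h := x) (neg_ne_zero.2 hy) (by simpa using h)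
    rw [neg_add_eq_sub, norm_neg] at h1
    calc _ ≤ ‖y‖ * (170 * ‖x‖ ^ 2 * (‖y‖ ^ 4)⁻¹) := by gcongr
      _ = 170 * (‖x‖ ^ 2 * ‖y‖⁻¹ ^ 3) := by field_simp
      _ = 170 * (√‖x‖ ^ 3 * (√‖y‖)⁻¹ ^ 5 * (√‖x‖ * (√‖y‖)⁻¹)) := by
        rw [inv_norm_eq]; nth_rewrite 1 [hx2]; ring
      _ ≤ 170 * (√‖x‖ ^ 3 * (√‖y‖)⁻¹ ^ 5 * 1) := by
        gcongr
        rw [← div_eq_mul_inv]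
        exact div_le_one_of_le₀ (Real.sqrt_le_sqrt (by linarith)) (by positivity)
      _ ≤ _ := by rw [← kap_eq]; linarith
  · have hbd : ‖x - y‖ ≤ 4 * ‖x‖ := by
      have := norm_sub_le x y
      linarith
    have g1 : 1 ≤ 2 * √‖x‖ * (√‖y‖)⁻¹ := by
      rw [← div_eq_mul_inv, one_le_div (Real.sqrt_pos.2 ha), Real.sqrt_le_iff]
      refine ⟨by positivity, ?_⟩
      rw [mul_pow, Real.sq_sqrt (norm_nonneg _)]; linarith
    have g2 : 1 ≤ 2 * √‖x‖ * (√‖x - y‖)⁻¹ := by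
      rw [← div_eq_mul_inv, one_le_div (Real.sqrt_pos.2 hb), Real.sqrt_le_iff]
      refine ⟨by positivity, ?_⟩
      rw [mul_pow, Real.sq_sqrt (norm_nonneg _)]; linarith
    have h0 : ‖Kv (x - y) - Kv (-y) - DKv (-y) x‖
        ≤ (‖x - y‖ ^ 2)⁻¹ + (‖y‖ ^ 2)⁻¹ + 4 * ‖x‖ * (‖y‖ ^ 3)⁻¹ := by
      have h1 := norm_DKv_le (-y) x
      have h2 := norm_sub_le (Kv (x - y) - Kv (-y)) (DKv (-y) x)
      have h3 := norm_sub_le (Kv (x - y)) (Kv (-y))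
      rw [norm_Kv, norm_Kv] at h3
      rw [norm_neg] at h1 h3
      linarith
    have t1 : ‖y‖ * (‖x - y‖ ^ 2)⁻¹ ≤ 4 * (√‖x‖ ^ 3 * kap (x - y)) := by
      calc _ ≤ 2 * ‖x‖ * (‖x - y‖ ^ 2)⁻¹ := by gcongr; linarith
        _ = 2 * √‖x‖ ^ 2 * (√‖x - y‖)⁻¹ ^ 4 * 1 := by
          rw [← inv_pow, inv_norm_eq]; nth_rewrite 1 [hx2]; ring
        _ ≤ 2 * √‖x‖ ^ 2 * (√‖x - y‖)⁻¹ ^ 4 * (2 * √‖x‖ * (√‖x - y‖)⁻¹) := by gcongr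
        _ = _ := by rw [kap_eq]; ring
    have t2 : ‖y‖ * (‖y‖ ^ 2)⁻¹ ≤ 8 * (√‖x‖ ^ 3 * kap y) := by
      calc _ = (√‖y‖)⁻¹ ^ 2 * 1 := by rw [← inv_norm_eq]; field_simp
        _ ≤ (√‖y‖)⁻¹ ^ 2 * (2 * √‖x‖ * (√‖y‖)⁻¹) ^ 3 := by gcongr; exact one_le_pow₀ g1
        _ = _ := by rw [kap_eq]; ring
    have t3 : ‖y‖ * (4 * ‖x‖ * (‖y‖ ^ 3)⁻¹) ≤ 8 * (√‖x‖ ^ 3 * kap y) := by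
      calc _ = 4 * ‖x‖ * (‖y‖⁻¹) ^ 2 := by field_simp
        _ = 4 * √‖x‖ ^ 2 * (√‖y‖)⁻¹ ^ 4 * 1 := by
          rw [inv_norm_eq]; nth_rewrite 1 [hx2]; ring
        _ ≤ 4 * √‖x‖ ^ 2 * (√‖y‖)⁻¹ ^ 4 * (2 * √‖x‖ * (√‖y‖)⁻¹) := by gcongr
        _ = _ := by rw [kap_eq]; ring
    calc _ ≤ ‖y‖ * ((‖x - y‖ ^ 2)⁻¹ + (‖y‖ ^ 2)⁻¹ + 4 * ‖x‖ * (‖y‖ ^ 3)⁻¹) := by gcongr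
      _ ≤ _ := by linarith

theorem inv_norm_sq_le_kap {z : E3} (hz : z ≠ 0) {R : ℝ} (hR : 0 ≤ R) (h : ‖z‖ ≤ R ^ 2) :
    (‖z‖ ^ 2)⁻¹ ≤ R * kap z := by
  have ha : 0 < √‖z‖ := Real.sqrt_pos.2 (norm_pos_iff.2 hz)
  have h1 : √‖z‖ ≤ R := Real.sqrt_le_iff.2 ⟨hR, h⟩
  rw [← inv_pow, inv_norm_eq, kap_eq]
  calc _ = √‖z‖ * (√‖z‖)⁻¹ ^ 5 := by field_simp
    _ ≤ _ := by gcongr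

/-- The weight `|y|` cancels one inverse power and leaves inverse squares, which are integrable.
Hence the rate is the full `|x|` and not merely its square root. -/
theorem norm_mul_Kv_sub_le {x y : E3} (hy : y ≠ 0) (hxy : x - y ≠ 0) (hx5 : ‖x‖ ≤ 5)
    (hy3 : ‖y‖ ≤ 3) :
    ‖y‖ * ‖Kv (x - y) - Kv (-y)‖ ≤ 6 * ‖x‖ * (kap y + kap (x - y)) := by
  have ha : 0 < ‖y‖ := norm_pos_iff.2 hy
  have hb : 0 < ‖x - y‖ := norm_pos_iff.2 hxy
  have h1 := norm_Kv_sub_le hxy (neg_ne_zero.2 hy)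
  rw [sub_neg_eq_add, sub_add_cancel, norm_neg] at h1
  have h2 := inv_norm_sq_le_kap hxy (R := 3) (by norm_num) (by linarith [norm_sub_le x y])
  have h3 := inv_norm_sq_le_kap hy (R := 3) (by norm_num) (by linarith)
  calc _ ≤ ‖y‖ * (‖x‖ * ((‖x - y‖ ^ 2 * ‖y‖)⁻¹ + (‖x - y‖ * ‖y‖ ^ 2)⁻¹)) := by gcongr
    _ = ‖x‖ * (‖x - y‖⁻¹ ^ 2 + ‖x - y‖⁻¹ * ‖y‖⁻¹) := by field_simp
    _ ≤ ‖x‖ * (2 * (‖x - y‖ ^ 2)⁻¹ + 2 * (‖y‖ ^ 2)⁻¹) := by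
      refine mul_le_mul_of_nonneg_left ?_ (norm_nonneg x)
      rw [← inv_pow, ← inv_pow]
      nlinarith [sq_nonneg (‖x - y‖⁻¹ - ‖y‖⁻¹), sq_nonneg (‖y‖⁻¹), sq_nonneg (‖x - y‖⁻¹)]
    _ ≤ ‖x‖ * (2 * (3 * kap (x - y)) + 2 * (3 * kap y)) := by gcongr
    _ = _ := by ring

/-- For `|y| ≤ 2|x|` the weight supplies the factor `|x|` and the Hölder bound supplies `√η`. For
`|y| ≥ 2|x|` both points stay at distance at least `|y|/4` from `y`, and the Lipschitz bound gives
`η |x|`, which is even better. -/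
theorem norm_mul_Kv_sub_le_of_near {x x' y : E3} {η : ℝ} (hη : 0 ≤ η) (hη2 : η ≤ 1 / 2)
    (hd : ‖x' - x‖ ≤ η * ‖x‖) (hx5 : ‖x‖ ≤ 5) (hy3 : ‖y‖ ≤ 3) (hy : y ≠ 0)
    (hxy : x - y ≠ 0) (hxy' : x' - y ≠ 0) :
    ‖y‖ * ‖Kv (x' - y) - Kv (x - y)‖
      ≤ 256 * √η * ‖x‖ * (kap y + kap (x - y) + kap (x' - y)) := by
  have hk := kap_nonneg y
  have hk1 := kap_nonneg (x - y)
  have hk2 := kap_nonneg (x' - y)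
  rcases le_total ‖y‖ (2 * ‖x‖) with h | h
  · have h1 := norm_Kv_sub_le_holder hxy' hxy
    rw [sub_sub_sub_cancel_right] at h1
    have h2 : √‖x' - x‖ ≤ √η * 3 := by
      rw [Real.sqrt_le_iff]
      refine ⟨by positivity, ?_⟩
      rw [mul_pow, Real.sq_sqrt hη]
      nlinarith
    calc _ ≤ 2 * ‖x‖ * (2 * (√η * 3) * (kap (x' - y) + kap (x - y))) := by
          gcongr
          exact h1.trans (by gcongr)
      _ = 12 * √η * ‖x‖ * (0 + kap (x - y) + kap (x' - y)) := by ring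
      _ ≤ _ := by gcongr; norm_num
  · have hy0 : 0 < ‖y‖ := norm_pos_iff.2 hy
    have e1 : ‖y‖ ≤ ‖x‖ + ‖x - y‖ := by
      have := norm_sub_le x (x - y); rwa [sub_sub_cancel] at this
    have e2 : ‖x - y‖ ≤ ‖x' - x‖ + ‖x' - y‖ := by
      have := norm_sub_le (x' - y) (x' - x)
      rw [show x' - y - (x' - x) = x - y by abel] at this; linarith
    have hb : ‖y‖ / 4 ≤ ‖x - y‖ := by linarith
    have ha : ‖y‖ / 4 ≤ ‖x' - y‖ := by nlinarith [norm_nonneg x]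
    have h1 := norm_Kv_sub_le hxy' hxy
    rw [sub_sub_sub_cancel_right] at h1
    have h3 := inv_norm_sq_le_kap hy (R := 2) (by norm_num) (by linarith)
    have h4 : η ≤ √η := by
      rw [Real.le_sqrt hη hη]; nlinarith
    calc _ ≤ ‖y‖ * ((η * ‖x‖) * (((‖y‖ / 4) ^ 2 * (‖y‖ / 4))⁻¹
            + ((‖y‖ / 4) * (‖y‖ / 4) ^ 2)⁻¹)) := by
          gcongr
          exact h1.trans (by gcongr)
      _ = 128 * η * ‖x‖ * (‖y‖ ^ 2)⁻¹ := by field_simp; ring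
      _ ≤ 128 * √η * ‖x‖ * (2 * kap y) := by gcongr
      _ = 256 * √η * ‖x‖ * (kap y + 0 + 0) := by ring
      _ ≤ _ := by gcongr

/-! ### Newtonian potentials -/

/-- In polar coordinates the integrand is `s² s^(-5/2) = s^(-1/2)`. -/
theorem integrableOn_kap_ball : IntegrableOn kap (Metric.ball (0 : E3) 1) := by
  have h := integrableOn_fun_norm_addHaar (volume : Measure E3)
    (f := fun s : ℝ => (√s ^ 5)⁻¹) (r := 1)
  refine h.2 ?_
  have h1 : IntegrableOn (fun s : ℝ => s ^ (-(1 / 2) : ℝ)) (Ioo 0 1) := by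
    have := (intervalIntegral.intervalIntegrable_rpow' (a := 0) (b := 1)
      (by norm_num : (-1 : ℝ) < -(1 / 2)))
    rw [intervalIntegrable_iff_integrableOn_Ioo_of_le (by norm_num)] at this
    exact this
  refine h1.congr_fun (fun s hs => ?_) measurableSet_Ioo
  have hs0 : 0 < √s := Real.sqrt_pos.2 hs.1
  have e : s = √s ^ 2 := (Real.sq_sqrt hs.1.le).symm
  simp only [finrank_euclideanSpace, Fintype.card_fin, smul_eq_mul]
  rw [Real.rpow_neg hs.1.le, ← Real.sqrt_eq_rpow]
  have : s ^ (3 - 1) = √s ^ 4 := by nth_rewrite 1 [e]; ring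
  rw [this]
  field_simp

@[fun_prop]
theorem measurable_kap : Measurable kap := by unfold kap; fun_prop

@[fun_prop]
theorem measurable_Kv : Measurable Kv := by unfold Kv; fun_prop

/-- The sum of three shifted copies of the majorant, and `1`. -/
def maj (x x' y : E3) : ℝ := 1 + kap y + kap (x - y) + kap (x' - y)

/-- A bound for the integrals of `maj` over `B_3`. -/
def Ck : ℝ := 3 * (∫ y in Metric.ball (0 : E3) 1, kap y) + 4 * (volume (B 3)).toReal

theorem Ck_nonneg : 0 ≤ Ck := by
  have : 0 ≤ ∫ y in Metric.ball (0 : E3) 1, kap y := integral_nonneg fun y => kap_nonneg y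
  unfold Ck
  positivity

theorem kap_le_indicator (z : E3) : kap z ≤ (Metric.ball (0 : E3) 1).indicator kap z + 1 := by
  by_cases hz : z ∈ Metric.ball (0 : E3) 1
  · rw [indicator_of_mem hz]; linarith
  · rw [indicator_of_notMem hz, zero_add]
    have h1 : 1 ≤ ‖z‖ := by simpa using hz
    exact inv_le_one_of_one_le₀ (one_le_pow₀ (Real.one_le_sqrt.2 h1))

theorem integrableOn_kap_sub (x : E3) : IntegrableOn (fun y => kap (x - y)) (B 3) ∧
    ∫ y in B 3, kap (x - y) ≤ (∫ y in Metric.ball (0 : E3) 1, kap y) + (volume (B 3)).toReal := by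
  have h0 : Integrable ((Metric.ball (0 : E3) 1).indicator kap) :=
    (integrable_indicator_iff measurableSet_ball).2 integrableOn_kap_ball
  have h1 : Integrable (fun y => (Metric.ball (0 : E3) 1).indicator kap (x - y)) :=
    h0.comp_sub_left x
  have hfin : IsFiniteMeasure (volume.restrict (B 3 : Set E3)) :=
    ⟨by simpa using (isCompact_closedBall (0 : E3) 3).measure_lt_top (μ := volume)⟩
  have h2 : IntegrableOn
      (fun y => (Metric.ball (0 : E3) 1).indicator kap (x - y) + 1) (B 3) :=
    h1.integrableOn.add (integrable_const _)
  have h3 : IntegrableOn (fun y => kap (x - y)) (B 3) := by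
    refine h2.mono' (measurable_kap.comp
      (measurable_const.sub measurable_id)).aestronglyMeasurable (Eventually.of_forall fun y => ?_)
    rw [Real.norm_of_nonneg (kap_nonneg _)]
    exact kap_le_indicator _
  refine ⟨h3, (setIntegral_mono h3 h2 fun y => kap_le_indicator _).trans ?_⟩
  rw [integral_add h1.integrableOn (integrable_const _)]
  have h4 : ∫ y in B 3, (Metric.ball (0 : E3) 1).indicator kap (x - y)
      ≤ ∫ y, (Metric.ball (0 : E3) 1).indicator kap (x - y) :=
    setIntegral_le_integral h1 (Eventually.of_forall fun y =>
      indicator_nonneg (fun z _ => kap_nonneg z) _)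
  rw [integral_sub_left_eq_self ((Metric.ball (0 : E3) 1).indicator kap) volume x,
    integral_indicator measurableSet_ball] at h4
  simpa [Measure.real] using h4

/-- The gate through which pointwise kernel estimates become bounds for integrals. The three
singular points form a null set, and by translation invariance the constant `Ck` does not depend on
`x` and `x'`. -/
theorem integrable_of_le_maj {V : Type*} [NormedAddCommGroup V] [NormedSpace ℝ V] {F : E3 → V}
    {A : ℝ} (hA : 0 ≤ A) (x x' : E3) (hm : AEStronglyMeasurable F volume)
    (h0 : ∀ y, 3 < ‖y‖ → F y = 0)
    (hF : ∀ y, ‖y‖ ≤ 3 → y ≠ 0 → x - y ≠ 0 → x' - y ≠ 0 → ‖F y‖ ≤ A * maj x x' y) :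
    Integrable F ∧ ‖∫ y, F y‖ ≤ A * Ck := by
  have hfin : IsFiniteMeasure (volume.restrict (B 3 : Set E3)) :=
    ⟨by simpa using (isCompact_closedBall (0 : E3) 3).measure_lt_top (μ := volume)⟩
  have k0 := integrableOn_kap_sub 0
  simp only [zero_sub, kap_neg] at k0
  have k1 := integrableOn_kap_sub x
  have k2 := integrableOn_kap_sub x'
  have i0 : IntegrableOn (fun _ : E3 => (1 : ℝ)) (B 3) := integrable_const _
  have i1 : IntegrableOn (fun y => 1 + kap y) (B 3) := i0.add k0.1
  have i2 : IntegrableOn (fun y => 1 + kap y + kap (x - y)) (B 3) := i1.add k1.1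
  have i3 : IntegrableOn (maj x x') (B 3) := i2.add k2.1
  have hmaj : ∫ y in B 3, maj x x' y ≤ Ck := by
    unfold maj Ck
    rw [integral_add i2 k2.1, integral_add i1 k1.1, integral_add i0 k0.1]
    have : ∫ _ in (B 3 : Set E3), (1 : ℝ) = (volume (B 3 : Set E3)).toReal := by
      simp [Measure.real]
    linarith [k0.2, k1.2, k2.2]
  have hI : Integrable ((B 3).indicator fun y => A * maj x x' y) :=
    (integrable_indicator_iff measurableSet_closedBall).2 (i3.const_mul A)
  have hle : ∀ᵐ y : E3, ‖F y‖ ≤ (B 3).indicator (fun y => A * maj x x' y) y := by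
    have hne : ∀ a : E3, ∀ᵐ y : E3, y ≠ a := fun a => by simp [ae_iff]
    filter_upwards [hne 0, hne x, hne x'] with y hy hyx hyx'
    by_cases h : ‖y‖ ≤ 3
    · rw [indicator_of_mem (by simpa using h)]
      exact hF y h hy (sub_ne_zero.2 hyx.symm) (sub_ne_zero.2 hyx'.symm)
    · rw [indicator_of_notMem (by simpa using h), h0 y (not_le.1 h), norm_zero]
  refine ⟨hI.mono' hm hle, (norm_integral_le_of_norm_le hI hle).trans ?_⟩
  rw [integral_indicator measurableSet_closedBall, integral_const_mul]
  gcongr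

/-- Bounded measurable functions supported in `B_3`. -/
structure Src (f : E3 → ℝ) (M : ℝ) : Prop where
  meas : AEStronglyMeasurable f volume
  bound : ∀ y, |f y| ≤ M
  supp : ∀ y, 3 < ‖y‖ → f y = 0

/-- Measurable functions supported in `B_3` which vanish linearly at the origin. -/
structure SrcL (f : E3 → ℝ) (M : ℝ) : Prop where
  meas : AEStronglyMeasurable f volume
  bound : ∀ y, |f y| ≤ M * ‖y‖
  supp : ∀ y, 3 < ‖y‖ → f y = 0

theorem Src.nonneg {f : E3 → ℝ} {M : ℝ} (hf : Src f M) : 0 ≤ M :=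
  (abs_nonneg _).trans (hf.bound 0)

theorem SrcL.nonneg {f : E3 → ℝ} {M : ℝ} (hf : SrcL f M) : 0 ≤ M := by
  have h := (abs_nonneg _).trans (hf.bound (EuclideanSpace.single 0 1))
  simpa using h

theorem SrcL.src {f : E3 → ℝ} {M : ℝ} (hf : SrcL f M) : Src f (3 * M) where
  meas := hf.meas
  bound y := by
    rcases le_or_gt ‖y‖ 3 with h | h
    · have := hf.nonneg
      exact (hf.bound y).trans (by nlinarith)
    · rw [hf.supp y h, abs_zero]
      linarith [hf.nonneg]
  supp := hf.supp

theorem Src.sub {f g : E3 → ℝ} {M N : ℝ} (hf : Src f M) (hg : Src g N) :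
    Src (fun y => f y - g y) (M + N) where
  meas := hf.meas.sub hg.meas
  bound y := (abs_sub _ _).trans (add_le_add (hf.bound y) (hg.bound y))
  supp y hy := by rw [hf.supp y hy, hg.supp y hy, sub_zero]

theorem Src.comp {f : E3 → ℝ} {M : ℝ} (hf : Src f M) (A : E3 ≃ₗᵢ[ℝ] E3) :
    Src (fun y => f (A y)) M where
  meas := hf.meas.comp_measurePreserving A.measurePreserving
  bound y := hf.bound _
  supp y hy := hf.supp _ (by rwa [A.norm_map])

/-- The Newtonian potential, with the sign that makes it positive. -/
def pot (f : E3 → ℝ) (x : E3) : ℝ := ∫ y, f y / ‖x - y‖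

/-- The gradient of the Newtonian potential. -/
def gradPot (f : E3 → ℝ) (x : E3) : E3 := -∫ y, f y • Kv (x - y)

theorem Src.integrable_pot {f : E3 → ℝ} {M : ℝ} (hf : Src f M) (x : E3) :
    Integrable (fun y => f y / ‖x - y‖) ∧ |pot f x| ≤ M * Ck := by
  refine integrable_of_le_maj hf.nonneg x x ?_ ?_ ?_
  · simp only [div_eq_mul_inv]
    exact hf.meas.mul (by fun_prop)
  · intro y hy; rw [hf.supp y hy, zero_div]
  · intro y _ _ _ _
    rw [norm_div, norm_norm, div_eq_mul_inv, Real.norm_eq_abs]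
    have := inv_norm_le (x - y)
    have h1 := kap_nonneg y
    have h2 := kap_nonneg (x - y)
    exact mul_le_mul (hf.bound y) (by unfold maj; linarith) (by positivity) hf.nonneg

theorem Src.aesm_smul {f : E3 → ℝ} {M : ℝ} (hf : Src f M) (x : E3) :
    AEStronglyMeasurable (fun y => f y • Kv (x - y)) volume :=
  hf.meas.smul (measurable_Kv.comp (measurable_const.sub measurable_id)).aestronglyMeasurable

theorem Src.integrable_grad {f : E3 → ℝ} {M : ℝ} (hf : Src f M) (x : E3) :
    Integrable (fun y => f y • Kv (x - y)) ∧ ‖gradPot f x‖ ≤ M * Ck := by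
  unfold gradPot
  rw [norm_neg]
  refine integrable_of_le_maj hf.nonneg x x (hf.aesm_smul x) ?_ ?_
  · intro y hy; rw [hf.supp y hy, zero_smul]
  · intro y _ _ _ _
    rw [norm_smul, Real.norm_eq_abs]
    have := norm_Kv_le (x - y)
    have h1 := kap_nonneg y
    have h2 := kap_nonneg (x - y)
    exact mul_le_mul (hf.bound y) (by unfold maj; linarith) (norm_nonneg _) hf.nonneg

theorem Src.pot_sub {f g : E3 → ℝ} {M N : ℝ} (hf : Src f M) (hg : Src g N) (x : E3) :
    pot (fun y => f y - g y) x = pot f x - pot g x := by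
  unfold pot
  rw [← integral_sub (hf.integrable_pot x).1 (hg.integrable_pot x).1]
  simp only [sub_div]

theorem Src.gradPot_sub {f g : E3 → ℝ} {M N : ℝ} (hf : Src f M) (hg : Src g N) (x : E3) :
    gradPot (fun y => f y - g y) x = gradPot f x - gradPot g x := by
  unfold gradPot
  simp only [sub_smul]
  rw [integral_sub (hf.integrable_grad x).1 (hg.integrable_grad x).1]
  abel

theorem pot_smul (c : ℝ) (f : E3 → ℝ) (x : E3) : pot (fun y => c * f y) x = c * pot f x := by
  unfold pot
  rw [← integral_const_mul]
  simp only [mul_div_assoc]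

theorem pot_comp (f : E3 → ℝ) (A : E3 ≃ₗᵢ[ℝ] E3) (x : E3) :
    pot (fun y => f (A y)) x = pot f (A x) := by
  unfold pot
  rw [← A.measurePreserving.integral_comp A.toHomeomorph.measurableEmbedding
    (fun y => f y / ‖A x - y‖)]
  simp only [← map_sub, A.norm_map]

/-- A remainder of order `|v|^(3/2)` is `o(|v|)`; this is the form in which the interpolated kernel
bounds arrive. -/
theorem hasFDerivAt_of_le_sqrt {V : Type*} [NormedAddCommGroup V] [NormedSpace ℝ V]
    {F : E3 → V} {L : E3 →L[ℝ] V} {x : E3} {C : ℝ}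
    (h : ∀ v, ‖v‖ ≤ 1 → ‖F (x + v) - F x - L v‖ ≤ C * √‖v‖ ^ 3) : HasFDerivAt F L x := by
  rw [hasFDerivAt_iff_isLittleO_nhds_zero]
  have h1 : (fun v : E3 => F (x + v) - F x - L v) =O[𝓝 0] fun v => √‖v‖ ^ 3 := by
    refine Asymptotics.IsBigO.of_bound C ?_
    filter_upwards [Metric.closedBall_mem_nhds (0 : E3) one_pos] with v hv
    rw [Real.norm_of_nonneg (by positivity)]
    exact h v (by simpa using hv)
  refine h1.trans_isLittleO ?_
  rw [Asymptotics.isLittleO_iff]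
  intro c hc
  filter_upwards [Metric.closedBall_mem_nhds (0 : E3) (pow_pos hc 2)] with v hv
  have hv' : ‖v‖ ≤ c ^ 2 := by simpa using hv
  rw [Real.norm_of_nonneg (by positivity)]
  calc √‖v‖ ^ 3 = √‖v‖ * ‖v‖ := by rw [pow_succ', Real.sq_sqrt (norm_nonneg _)]
    _ ≤ c * ‖v‖ := by gcongr; exact Real.sqrt_le_iff.2 ⟨hc.le, hv'⟩

theorem Src.hasFDerivAt_pot {f : E3 → ℝ} {M : ℝ} (hf : Src f M) (x : E3) :
    HasFDerivAt (pot f) (innerSL ℝ (gradPot f x)) x := by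
  refine hasFDerivAt_of_le_sqrt (C := M * 3 * Ck) fun v _ => ?_
  have e : pot f (x + v) - pot f x - innerSL ℝ (gradPot f x) v
      = ∫ y, (f y / ‖x + v - y‖ - f y / ‖x - y‖ + inner ℝ (f y • Kv (x - y)) v) := by
    rw [integral_add, integral_sub (hf.integrable_pot _).1 (hf.integrable_pot _).1]
    · have : ∫ y, inner ℝ (f y • Kv (x - y)) v = inner ℝ (∫ y, f y • Kv (x - y)) v := by
        have := integral_inner (𝕜 := ℝ) (hf.integrable_grad x).1 v
        simp only [real_inner_comm _ v] at this
        exact this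
      rw [this]
      simp [gradPot, pot]
    · exact (hf.integrable_pot _).1.sub (hf.integrable_pot _).1
    · exact (hf.integrable_grad x).1.inner_const (𝕜 := ℝ) v
  rw [e]
  have hM := hf.nonneg
  have hA : 0 ≤ M * 3 * √‖v‖ ^ 3 := by positivity
  refine ((integrable_of_le_maj hA x (x + v) ?_ ?_ ?_).2).trans (le_of_eq (by ring))
  · exact (((hf.integrable_pot _).1.sub (hf.integrable_pot _).1).add
      ((hf.integrable_grad x).1.inner_const (𝕜 := ℝ) v)).aestronglyMeasurable
  · intro y hy
    simp [hf.supp y hy]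
  · intro y _ _ h1 h2
    have h3 := inv_norm_add_remainder_le (z := x - y) (h := v) h1
      (by rwa [show x - y + v = x + v - y by abel])
    rw [show x - y + v = x + v - y by abel] at h3
    have h4 : f y / ‖x + v - y‖ - f y / ‖x - y‖ + inner ℝ (f y • Kv (x - y)) v
        = f y * (‖x + v - y‖⁻¹ - ‖x - y‖⁻¹ + inner ℝ (Kv (x - y)) v) := by
      rw [real_inner_smul_left]; ring
    rw [h4, norm_mul, Real.norm_eq_abs, Real.norm_eq_abs]
    have h5 := kap_nonneg y
    have h6 := kap_nonneg (x - y)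
    have h7 := kap_nonneg (x + v - y)
    calc _ ≤ M * (3 * √‖v‖ ^ 3 * (kap (x - y) + kap (x + v - y))) :=
          mul_le_mul (hf.bound y) h3 (abs_nonneg _) hM
      _ = M * 3 * √‖v‖ ^ 3 * (kap (x - y) + kap (x + v - y)) := by ring
      _ ≤ _ := by
        refine mul_le_mul_of_nonneg_left ?_ hA
        unfold maj; linarith

theorem Src.gradPot_sub_eq {f : E3 → ℝ} {M : ℝ} (hf : Src f M) (x x' : E3) :
    gradPot f x' - gradPot f x = -∫ y, f y • (Kv (x' - y) - Kv (x - y)) := by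
  unfold gradPot
  simp only [smul_sub]
  rw [integral_sub (hf.integrable_grad x').1 (hf.integrable_grad x).1]
  abel

theorem Src.aesm_sub {f : E3 → ℝ} {M : ℝ} (hf : Src f M) (x x' : E3) :
    AEStronglyMeasurable (fun y => f y • (Kv (x' - y) - Kv (x - y))) volume := by
  simp only [smul_sub]
  exact (hf.aesm_smul x').sub (hf.aesm_smul x)

theorem Src.norm_gradPot_sub_le {f : E3 → ℝ} {M : ℝ} (hf : Src f M) (x x' : E3) :
    ‖gradPot f x' - gradPot f x‖ ≤ 2 * M * Ck * √‖x' - x‖ := by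
  rw [hf.gradPot_sub_eq, norm_neg]
  have hM := hf.nonneg
  have hA : 0 ≤ M * 2 * √‖x' - x‖ := by positivity
  refine ((integrable_of_le_maj hA x x' (hf.aesm_sub x x') ?_ ?_).2).trans (le_of_eq (by ring))
  · intro y hy; rw [hf.supp y hy, zero_smul]
  · intro y _ _ h1 h2
    have h3 := norm_Kv_sub_le_holder h2 h1
    rw [sub_sub_sub_cancel_right] at h3
    have h5 := kap_nonneg y
    rw [norm_smul, Real.norm_eq_abs]
    calc _ ≤ M * (2 * √‖x' - x‖ * (kap (x' - y) + kap (x - y))) :=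
          mul_le_mul (hf.bound y) h3 (norm_nonneg _) hM
      _ = M * 2 * √‖x' - x‖ * (kap (x' - y) + kap (x - y)) := by ring
      _ ≤ _ := by
        refine mul_le_mul_of_nonneg_left ?_ hA
        unfold maj; linarith

theorem Src.continuous_gradPot {f : E3 → ℝ} {M : ℝ} (hf : Src f M) :
    Continuous (gradPot f) := by
  rw [continuous_iff_continuousAt]
  intro x
  rw [ContinuousAt, tendsto_iff_norm_sub_tendsto_zero]
  refine squeeze_zero (fun _ => norm_nonneg _) (fun x' => hf.norm_gradPot_sub_le x x') ?_
  have : Continuous fun x' : E3 => 2 * M * Ck * √‖x' - x‖ := by fun_prop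
  simpa using this.tendsto x

theorem Src.abs_pot_sub_le {f : E3 → ℝ} {M : ℝ} (hf : Src f M) (x x' : E3) :
    |pot f x' - pot f x| ≤ M * Ck * ‖x' - x‖ := by
  refine Convex.norm_image_sub_le_of_norm_hasFDerivWithin_le (s := univ)
    (fun z _ => (hf.hasFDerivAt_pot z).hasFDerivWithinAt) (fun z _ => ?_) convex_univ
    (mem_univ _) (mem_univ _)
  rw [innerSL_apply_norm]
  exact (hf.integrable_grad z).2

theorem gradPot_zero_of_even {f : E3 → ℝ} (h : ∀ y, f (-y) = f y) : gradPot f 0 = 0 := by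
  unfold gradPot
  have h1 := integral_neg_eq_self (fun y : E3 => f y • Kv (0 - y)) volume
  have h2 : ∀ y : E3, f (-y) • Kv (0 - -y) = -(f y • Kv (0 - y)) := fun y => by
    rw [h, ← smul_neg, ← Kv_neg, neg_sub, sub_zero, zero_sub, neg_neg]
  simp only [h2, integral_neg] at h1
  have h3 : ∫ y : E3, f y • Kv (0 - y) = 0 := by
    have : (2 : ℝ) • ∫ y : E3, f y • Kv (0 - y) = 0 := by
      rw [two_smul]; nth_rewrite 1 [← h1]; exact neg_add_cancel _
    exact (smul_eq_zero.1 this).resolve_left two_ne_zero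
  rw [h3, neg_zero]

/-- For bounded densities the gradient is only controlled with rate `√|x|`. The linear rate obtained
here from linear vanishing at the origin is the one the norm of `Y` measures. -/
theorem SrcL.norm_gradPot_sub_zero_le {f : E3 → ℝ} {M : ℝ} (hf : SrcL f M) {x : E3}
    (hx : ‖x‖ ≤ 5) : ‖gradPot f x - gradPot f 0‖ ≤ 6 * M * Ck * ‖x‖ := by
  rw [hf.src.gradPot_sub_eq, norm_neg]
  have hM := hf.nonneg
  have hA : 0 ≤ M * 6 * ‖x‖ := by positivity
  refine ((integrable_of_le_maj hA x x (hf.src.aesm_sub 0 x) ?_ ?_).2).trans (le_of_eq (by ring))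
  · intro y hy; rw [hf.supp y hy, zero_smul]
  · intro y hy3 hy h1 h2
    have h3 := norm_mul_Kv_sub_le hy h1 hx hy3
    have h5 := kap_nonneg (x - y)
    rw [norm_smul, Real.norm_eq_abs, zero_sub]
    calc _ ≤ M * ‖y‖ * ‖Kv (x - y) - Kv (-y)‖ := by gcongr; exact hf.bound y
      _ = M * (‖y‖ * ‖Kv (x - y) - Kv (-y)‖) := by ring
      _ ≤ M * (6 * ‖x‖ * (kap y + kap (x - y))) := by gcongr
      _ = M * 6 * ‖x‖ * (kap y + kap (x - y)) := by ring
      _ ≤ _ := by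
        refine mul_le_mul_of_nonneg_left ?_ hA
        unfold maj; linarith

theorem SrcL.norm_gradPot_le {f : E3 → ℝ} {M : ℝ} (hf : SrcL f M) (he : ∀ y, f (-y) = f y)
    {x : E3} (hx : ‖x‖ ≤ 5) : ‖gradPot f x‖ ≤ 6 * M * Ck * ‖x‖ := by
  have := hf.norm_gradPot_sub_zero_le hx
  rwa [gradPot_zero_of_even he, sub_zero] at this

/-- Used with `x' = g_ζ(x)` and `η = ‖ζ‖`: moving the point of evaluation costs a small factor
`√‖ζ‖` and keeps the factor `|x|` needed in `Y`. -/
theorem SrcL.norm_gradPot_sub_le_of_near {f : E3 → ℝ} {M : ℝ} (hf : SrcL f M) {x x' : E3}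
    {η : ℝ} (hη : 0 ≤ η) (hη2 : η ≤ 1 / 2) (hd : ‖x' - x‖ ≤ η * ‖x‖) (hx : ‖x‖ ≤ 5) :
    ‖gradPot f x' - gradPot f x‖ ≤ 256 * M * Ck * √η * ‖x‖ := by
  rw [hf.src.gradPot_sub_eq, norm_neg]
  have hM := hf.nonneg
  have hA : 0 ≤ M * (256 * √η * ‖x‖) := by positivity
  refine ((integrable_of_le_maj hA x x' (hf.src.aesm_sub x x') ?_ ?_).2).trans
    (le_of_eq (by ring))
  · intro y hy; rw [hf.supp y hy, zero_smul]
  · intro y hy3 hy h1 h2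
    have h3 := norm_mul_Kv_sub_le_of_near hη hη2 hd hx hy3 hy h1 h2
    rw [norm_smul, Real.norm_eq_abs]
    calc _ ≤ M * ‖y‖ * ‖Kv (x' - y) - Kv (x - y)‖ := by gcongr; exact hf.bound y
      _ = M * (‖y‖ * ‖Kv (x' - y) - Kv (x - y)‖) := by ring
      _ ≤ M * (256 * √η * ‖x‖ * (kap y + kap (x - y) + kap (x' - y))) := by gcongr
      _ = M * (256 * √η * ‖x‖) * (kap y + kap (x - y) + kap (x' - y)) := by ring
      _ ≤ _ := by
        refine mul_le_mul_of_nonneg_left ?_ hA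
        unfold maj; linarith

theorem DKv_add (z h h' : E3) : DKv z (h + h') = DKv z h + DKv z h' := by
  simp only [DKv, inner_add_right]
  module

theorem DKv_smul (z : E3) (c : ℝ) (h : E3) : DKv z (c • h) = c • DKv z h := by
  simp only [DKv, inner_smul_right]
  module

theorem SrcL.integrable_DKv {f : E3 → ℝ} {M : ℝ} (hf : SrcL f M) (h : E3) :
    Integrable (fun y => f y • DKv (-y) h) := by
  have hM := hf.nonneg
  have hA : 0 ≤ 4 * M * ‖h‖ := by positivity
  refine (integrable_of_le_maj hA 0 0 ?_ ?_ ?_).1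
  · refine hf.meas.smul (Measurable.aestronglyMeasurable ?_)
    unfold DKv
    fun_prop
  · intro y hy; rw [hf.supp y hy, zero_smul]
  · intro y _ hy _ _
    have h1 := norm_DKv_le (-y) h
    rw [norm_neg] at h1
    have hy0 : 0 < ‖y‖ := norm_pos_iff.2 hy
    rw [norm_smul, Real.norm_eq_abs]
    calc _ ≤ M * ‖y‖ * (4 * ‖h‖ * (‖y‖ ^ 3)⁻¹) := by gcongr; exact hf.bound y
      _ = 4 * M * ‖h‖ * (‖y‖ ^ 2)⁻¹ := by field_simp
      _ ≤ _ := by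
        refine mul_le_mul_of_nonneg_left ?_ hA
        have := inv_norm_sq_le y
        have h5 := kap_nonneg (0 - y)
        unfold maj; linarith

/-- The gradient of the potential of a source vanishing linearly at the origin is
differentiable there. -/
theorem SrcL.exists_hasFDerivAt_gradPot {f : E3 → ℝ} {M : ℝ} (hf : SrcL f M) :
    ∃ L : E3 →L[ℝ] E3, HasFDerivAt (gradPot f) L 0 := by
  -- Formal differentiation under the integral at the origin. The kernel is of order `|y|⁻³`; the
  -- density contributes `|y|` and makes the integral converge absolutely.
  let L₀ : E3 →ₗ[ℝ] E3 :=
    { toFun := fun h => -∫ y, f y • DKv (-y) h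
      map_add' := fun h h' => by
        simp only [DKv_add, smul_add]
        rw [integral_add (hf.integrable_DKv h) (hf.integrable_DKv h'), neg_add]
      map_smul' := fun c h => by
        simp only [DKv_smul, smul_comm _ c]
        rw [integral_smul, smul_neg]; rfl }
  refine ⟨LinearMap.toContinuousLinearMap L₀, ?_⟩
  refine hasFDerivAt_of_le_sqrt (C := 170 * M * Ck) fun x _ => ?_
  have e : gradPot f (0 + x) - gradPot f 0 - LinearMap.toContinuousLinearMap L₀ x
      = -∫ y, f y • (Kv (x - y) - Kv (-y) - DKv (-y) x) := by
    simp only [smul_sub (f _) (_ - _)]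
    rw [zero_add, hf.src.gradPot_sub_eq]
    change _ - (-∫ y, f y • DKv (-y) x) = _
    rw [integral_sub _ (hf.integrable_DKv x)]
    · simp only [zero_sub]; abel
    · have := (hf.src.integrable_grad x).1.sub (hf.src.integrable_grad 0).1
      simpa [smul_sub, Pi.sub_def] using this
  rw [e, norm_neg]
  have hM := hf.nonneg
  have hA : 0 ≤ M * (170 * √‖x‖ ^ 3) := by positivity
  refine ((integrable_of_le_maj hA x x ?_ ?_ ?_).2).trans (le_of_eq (by ring))
  · have h1 := (hf.src.aesm_sub 0 x).sub (hf.integrable_DKv x).aestronglyMeasurable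
    simpa [smul_sub, Pi.sub_def] using h1
  · intro y hy; rw [hf.supp y hy, zero_smul]
  · intro y hy3 hy h1 h2
    have h3 := norm_mul_Kv_taylor_le hy h1
    have h5 := kap_nonneg (x - y)
    rw [norm_smul, Real.norm_eq_abs]
    calc _ ≤ M * ‖y‖ * ‖Kv (x - y) - Kv (-y) - DKv (-y) x‖ := by gcongr; exact hf.bound y
      _ = M * (‖y‖ * ‖Kv (x - y) - Kv (-y) - DKv (-y) x‖) := by ring
      _ ≤ M * (170 * √‖x‖ ^ 3 * (kap y + kap (x - y))) := by gcongr
      _ = M * (170 * √‖x‖ ^ 3) * (kap y + kap (x - y)) := by ring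
      _ ≤ _ := by
        refine mul_le_mul_of_nonneg_left ?_ hA
        unfold maj; linarith

theorem locallyIntegrable_inv_norm : LocallyIntegrable (fun y : E3 => ‖y‖⁻¹) := by
  intro x
  refine ⟨Metric.ball x 1, Metric.ball_mem_nhds x one_pos, ?_⟩
  have hfin : IsFiniteMeasure (volume.restrict (Metric.ball x 1 : Set E3)) :=
    ⟨by simp⟩
  have h0 : Integrable ((Metric.ball (0 : E3) 1).indicator kap) :=
    (integrable_indicator_iff measurableSet_ball).2 integrableOn_kap_ball
  have h2 : IntegrableOn
      (fun y => 1 + ((Metric.ball (0 : E3) 1).indicator kap y + 1)) (Metric.ball x 1) :=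
    (integrable_const _).add (h0.integrableOn.add (integrable_const _))
  refine h2.mono' (by fun_prop) (Eventually.of_forall fun y => ?_)
  rw [Real.norm_of_nonneg (by positivity)]
  linarith [inv_norm_le y, kap_le_indicator y]

theorem pot_eq_convolution (f : E3 → ℝ) :
    pot f = convolution (fun y : E3 => ‖y‖⁻¹) f (ContinuousLinearMap.lsmul ℝ ℝ) volume := by
  funext x
  unfold pot convolution
  rw [← integral_sub_left_eq_self (fun y => f y / ‖x - y‖) volume x]
  congr 1
  funext t
  rw [sub_sub_cancel, ContinuousLinearMap.lsmul_apply, smul_eq_mul, div_eq_mul_inv, mul_comm]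

/-- Differentiating a potential amounts to differentiating its density. -/
theorem fderiv_pot_apply {f : E3 → ℝ} (hf : ContDiff ℝ 1 f) (hc : HasCompactSupport f)
    (x v : E3) : fderiv ℝ (pot f) x v = pot (fun y => fderiv ℝ f y v) x := by
  have h := hc.hasFDerivAt_convolution_right (ContinuousLinearMap.lsmul ℝ ℝ)
    locallyIntegrable_inv_norm hf x
  rw [← pot_eq_convolution] at h
  rw [h.fderiv, pot_eq_convolution]
  have hex := (hc.fderiv ℝ).convolutionExists_right
    ((ContinuousLinearMap.lsmul ℝ ℝ : ℝ →L[ℝ] ℝ →L[ℝ] ℝ).precompR E3) locallyIntegrable_inv_norm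
    (hf.continuous_fderiv one_ne_zero) x
  exact ContinuousLinearMap.integral_apply hex.integrable v

/-! ### Newton's shell theorem -/

open scoped ENNReal

theorem lintegral_polar (H : ℝ × ℝ → ℝ≥0∞) (hH : Measurable H) :
    ∫⁻ p, H p = ∫⁻ s in Ioi (0 : ℝ), ∫⁻ φ in Ioo (-Real.pi) Real.pi,
      ENNReal.ofReal s * H (s * Real.cos φ, s * Real.sin φ) := by
  rw [← lintegral_comp_polarCoord_symm, polarCoord_target, Measure.volume_eq_prod,
    setLIntegral_prod]
  · simp only [polarCoord_symm_apply, smul_eq_mul]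
  · simp only [polarCoord_symm_apply, smul_eq_mul]
    fun_prop

theorem lintegral_radial_plane (G : ℝ → ℝ≥0∞) (hG : Measurable G) :
    ∫⁻ p : ℝ × ℝ, G (√(p.1 ^ 2 + p.2 ^ 2))
      = ∫⁻ r in Ioi (0 : ℝ), ENNReal.ofReal (2 * Real.pi * r) * G r := by
  rw [lintegral_polar _ (by fun_prop)]
  refine setLIntegral_congr_fun measurableSet_Ioi fun r hr => ?_
  have hr0 : 0 < r := hr
  have h1 : ∀ φ : ℝ, √((r * Real.cos φ) ^ 2 + (r * Real.sin φ) ^ 2) = r := fun φ => by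
    rw [mul_pow, mul_pow, ← mul_add, Real.cos_sq_add_sin_sq, mul_one, Real.sqrt_sq hr0.le]
  simp only [h1]
  rw [setLIntegral_const, Real.volume_Ioo, mul_comm _ (ENNReal.ofReal _), ← mul_assoc,
    ← ENNReal.ofReal_mul (by linarith [Real.pi_pos])]
  congr 2
  ring

/-- Spherical coordinates obtained in two stages: polar coordinates in the plane orthogonal to the
axis, then polar coordinates in the half-plane of axial and radial distance. Working with
nonnegative integrals avoids all integrability questions. -/
theorem lintegral_axisymm (F : ℝ → ℝ → ℝ≥0∞) (hF : Measurable (Function.uncurry F)) :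
    ∫⁻ y : E3, F (y 0) (√(y 1 ^ 2 + y 2 ^ 2))
      = ∫⁻ s in Ioi (0 : ℝ), ∫⁻ φ in Ioo 0 Real.pi,
        ENNReal.ofReal (2 * Real.pi * s ^ 2 * Real.sin φ) * F (s * Real.cos φ) (s * Real.sin φ) := by
  have e1 : ∫⁻ y : E3, F (y 0) (√(y 1 ^ 2 + y 2 ^ 2))
      = ∫⁻ w : Fin 3 → ℝ, F (w 0) (√(w 1 ^ 2 + w 2 ^ 2)) :=
    (EuclideanSpace.volume_preserving_symm_measurableEquiv_toLp (Fin 3)).lintegral_comp_emb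
      (MeasurableEquiv.measurableEmbedding _) (fun w => F (w 0) (√(w 1 ^ 2 + w 2 ^ 2)))
  have e2 : ∫⁻ w : Fin 3 → ℝ, F (w 0) (√(w 1 ^ 2 + w 2 ^ 2))
      = ∫⁻ w : ℝ × (Fin 2 → ℝ), F w.1 (√(w.2 0 ^ 2 + w.2 1 ^ 2)) :=
    (volume_preserving_piFinSuccAbove (fun _ : Fin 3 => ℝ) 0).lintegral_comp_emb
      (MeasurableEquiv.measurableEmbedding _)
      (fun w : ℝ × (Fin 2 → ℝ) => F w.1 (√(w.2 0 ^ 2 + w.2 1 ^ 2)))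
  have e3 : ∀ z : ℝ, ∫⁻ w : Fin 2 → ℝ, F z (√(w 0 ^ 2 + w 1 ^ 2))
      = ∫⁻ r in Ioi (0 : ℝ), ENNReal.ofReal (2 * Real.pi * r) * F z r := fun z => by
    rw [← lintegral_radial_plane (F z) (by fun_prop)]
    exact (volume_preserving_finTwoArrow ℝ).lintegral_comp_emb
      (MeasurableEquiv.measurableEmbedding _) (fun p : ℝ × ℝ => F z (√(p.1 ^ 2 + p.2 ^ 2)))
  rw [e1, e2, Measure.volume_eq_prod, lintegral_prod _ (by fun_prop)]
  simp only [e3]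
  have e4 : ∀ z : ℝ, ∫⁻ r in Ioi (0 : ℝ), ENNReal.ofReal (2 * Real.pi * r) * F z r
      = ∫⁻ r, (Ioi (0 : ℝ)).indicator (fun r => ENNReal.ofReal (2 * Real.pi * r) * F z r) r :=
    fun z => (lintegral_indicator measurableSet_Ioi _).symm
  have hm : Measurable fun p : ℝ × ℝ =>
      (Ioi (0 : ℝ)).indicator (fun r => ENNReal.ofReal (2 * Real.pi * r) * F p.1 r) p.2 := by
    have : (fun p : ℝ × ℝ =>
        (Ioi (0 : ℝ)).indicator (fun r => ENNReal.ofReal (2 * Real.pi * r) * F p.1 r) p.2)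
        = (Prod.snd ⁻¹' Ioi (0 : ℝ)).indicator
          (fun p : ℝ × ℝ => ENNReal.ofReal (2 * Real.pi * p.2) * F p.1 p.2) := by
      funext p
      by_cases hp : p.2 ∈ Ioi (0 : ℝ)
      · rw [indicator_of_mem hp, indicator_of_mem (by exact hp)]
      · rw [indicator_of_notMem hp, indicator_of_notMem (by exact hp)]
    rw [this]
    exact Measurable.indicator (by fun_prop) (measurable_snd measurableSet_Ioi)
  simp only [e4]
  rw [← lintegral_prod (fun p : ℝ × ℝ =>
      (Ioi (0 : ℝ)).indicator (fun r => ENNReal.ofReal (2 * Real.pi * r) * F p.1 r) p.2)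
      hm.aemeasurable, ← Measure.volume_eq_prod, lintegral_polar _ hm]
  refine setLIntegral_congr_fun measurableSet_Ioi fun s hs => ?_
  have hs0 : 0 < s := hs
  have h5 : ∀ φ ∈ Ioo (-Real.pi) Real.pi, ENNReal.ofReal s * (Ioi (0 : ℝ)).indicator
      (fun r => ENNReal.ofReal (2 * Real.pi * r) * F (s * Real.cos φ) r) (s * Real.sin φ)
      = (Ioo 0 Real.pi).indicator (fun φ => ENNReal.ofReal (2 * Real.pi * s ^ 2 * Real.sin φ)
        * F (s * Real.cos φ) (s * Real.sin φ)) φ := fun φ hφ => by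
    by_cases h : 0 < φ
    · have hsin : 0 < Real.sin φ := Real.sin_pos_of_pos_of_lt_pi h hφ.2
      rw [indicator_of_mem (show s * Real.sin φ ∈ Ioi (0 : ℝ) from mul_pos hs0 hsin),
        indicator_of_mem (show φ ∈ Ioo 0 Real.pi from ⟨h, hφ.2⟩), ← mul_assoc,
        ← ENNReal.ofReal_mul hs0.le]
      congr 2
      ring
    · have hsin : Real.sin φ ≤ 0 := Real.sin_nonpos_of_nonpos_of_neg_pi_le (not_lt.1 h) hφ.1.le
      rw [indicator_of_notMem, indicator_of_notMem, mul_zero]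
      · exact fun h' => h h'.1
      · exact fun h' => absurd (show 0 < s * Real.sin φ from h') (by nlinarith)
  rw [setLIntegral_congr_fun measurableSet_Ioo h5, lintegral_indicator measurableSet_Ioo,
    Measure.restrict_restrict measurableSet_Ioo, inter_eq_left.2]
  exact Ioo_subset_Ioo_left (by linarith [Real.pi_pos])

theorem lintegral_sin_eq {G g : ℝ → ℝ} (hc : ContinuousOn G (Icc 0 Real.pi))
    (hd : ∀ φ ∈ Ioo 0 Real.pi, HasDerivAt G (g φ) φ) (hg : ∀ φ ∈ Ioo 0 Real.pi, 0 ≤ g φ) :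
    ∫⁻ φ in Ioo 0 Real.pi, ENNReal.ofReal (g φ) = ENNReal.ofReal (G Real.pi - G 0) := by
  have hint := intervalIntegral.integrableOn_deriv_of_nonneg hc hd hg
  have h1 := intervalIntegral.integral_eq_sub_of_hasDerivAt_of_le Real.pi_pos.le hc hd
    ((intervalIntegrable_iff_integrableOn_Ioc_of_le Real.pi_pos.le).2 hint)
  rw [intervalIntegral.integral_of_le Real.pi_pos.le, integral_Ioc_eq_integral_Ioo] at h1
  rw [← h1, ofReal_integral_eq_lintegral_ofReal (hint.mono_set Ioo_subset_Ioc_self)]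
  exact (ae_restrict_iff' measurableSet_Ioo).2 (Eventually.of_forall hg)

/-- The distance from the point at height `a` to the point of the sphere at angle `φ`, divided by `a
s`, is a primitive. Its end values are `s + a` and `|s - a|` over `a s`, whence the maximum. The
centre `a = 0` needs a primitive of its own. -/
theorem lintegral_shell {a s : ℝ} (ha : 0 ≤ a) (hs : 0 < s) :
    ∫⁻ φ in Ioo 0 Real.pi, ENNReal.ofReal
      (Real.sin φ * (√((s * Real.cos φ - a) ^ 2 + (s * Real.sin φ) ^ 2))⁻¹)
    = ENNReal.ofReal (2 * (max s a)⁻¹) := by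
  rcases ha.eq_or_lt with rfl | ha
  · have h1 : ∀ φ : ℝ, √((s * Real.cos φ - 0) ^ 2 + (s * Real.sin φ) ^ 2) = s := fun φ => by
      rw [sub_zero, mul_pow, mul_pow, ← mul_add, Real.cos_sq_add_sin_sq, mul_one,
        Real.sqrt_sq hs.le]
    simp only [h1]
    rw [lintegral_sin_eq (G := fun φ => -Real.cos φ * s⁻¹) (by fun_prop)]
    · rw [max_eq_left hs.le, Real.cos_pi, Real.cos_zero]
      congr 1
      ring
    · intro φ _
      simpa using ((Real.hasDerivAt_cos φ).neg).mul_const s⁻¹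
    · intro φ hφ
      have := Real.sin_pos_of_pos_of_lt_pi hφ.1 hφ.2
      positivity
  · rw [lintegral_sin_eq
      (G := fun φ => √((s * Real.cos φ - a) ^ 2 + (s * Real.sin φ) ^ 2) * (a * s)⁻¹)
      (by fun_prop)]
    · simp only [Real.cos_pi, Real.sin_pi, Real.cos_zero, Real.sin_zero, mul_zero, mul_one,
        zero_pow two_ne_zero, add_zero, Real.sqrt_sq_eq_abs]
      congr 1
      rw [show s * -1 - a = -(s + a) by ring, abs_neg, abs_of_pos (by positivity)]
      rcases le_total s a with h | h
      · rw [max_eq_right h, abs_of_nonpos (by linarith)]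
        field_simp; ring
      · rw [max_eq_left h, abs_of_nonneg (by linarith)]
        field_simp; ring
    · intro φ hφ
      have hsin := Real.sin_pos_of_pos_of_lt_pi hφ.1 hφ.2
      have hpos : 0 < (s * Real.cos φ - a) ^ 2 + (s * Real.sin φ) ^ 2 := by positivity
      have h1 : HasDerivAt (fun φ => (s * Real.cos φ - a) ^ 2 + (s * Real.sin φ) ^ 2)
          (2 * a * s * Real.sin φ) φ := by
        have := ((((Real.hasDerivAt_cos φ).const_mul s).sub_const a).pow 2).add
          (((Real.hasDerivAt_sin φ).const_mul s).pow 2)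
        refine this.congr_deriv ?_
        push_cast
        ring
      refine ((h1.sqrt hpos.ne').mul_const (a * s)⁻¹).congr_deriv ?_
      field_simp
    · intro φ hφ
      have hsin := Real.sin_pos_of_pos_of_lt_pi hφ.1 hφ.2
      positivity

theorem norm_eq_sqrt (y : E3) : ‖y‖ = √(y 0 ^ 2 + √(y 1 ^ 2 + y 2 ^ 2) ^ 2) := by
  rw [EuclideanSpace.norm_eq, Fin.sum_univ_three, Real.sq_sqrt (by positivity)]
  simp [add_assoc]

theorem exists_isometry_of_norm_eq {x y : E3} (h : ‖x‖ = ‖y‖) :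
    ∃ A : E3 ≃ₗᵢ[ℝ] E3, A x = y :=
  ⟨(ℝ ∙ (x - y))ᗮ.reflection, Submodule.reflection_sub h⟩

/-- The unit vector along the first coordinate axis. -/
def e₀ : E3 := EuclideanSpace.single 0 1

theorem norm_e₀ : ‖e₀‖ = 1 := by simp [e₀]

theorem norm_smul_e₀ (s : ℝ) : ‖s • e₀‖ = |s| := by rw [norm_smul, norm_e₀, mul_one, Real.norm_eq_abs]

theorem exists_isometry_axis (x : E3) : ∃ A : E3 ≃ₗᵢ[ℝ] E3, A x = ‖x‖ • e₀ :=
  exists_isometry_of_norm_eq (by rw [norm_smul_e₀, abs_of_nonneg (norm_nonneg x)])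

/-- The shell theorem for nonnegative radial densities: rotate `x` onto the axis, pass to spherical
coordinates and compare the two angular integrals on each sphere. -/
theorem lintegral_newton (g : ℝ → ℝ≥0∞) (hg : Measurable g) (x : E3) :
    ∫⁻ y : E3, g ‖y‖ * ENNReal.ofReal ‖x - y‖⁻¹
      = ∫⁻ y : E3, g ‖y‖ * ENNReal.ofReal (max ‖y‖ ‖x‖)⁻¹ := by
  obtain ⟨A, hA⟩ := exists_isometry_axis x
  set a := ‖x‖ with ha
  have ha0 : 0 ≤ a := norm_nonneg x
  have e1 : ∫⁻ y : E3, g ‖y‖ * ENNReal.ofReal ‖x - y‖⁻¹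
      = ∫⁻ y : E3, g ‖y‖ * ENNReal.ofReal ‖a • e₀ - y‖⁻¹ := by
    rw [← A.measurePreserving.lintegral_comp_emb A.toHomeomorph.measurableEmbedding
      (fun y => g ‖y‖ * ENNReal.ofReal ‖a • e₀ - y‖⁻¹)]
    simp only [← hA, ← map_sub, A.norm_map]
  have n1 : ∀ y : E3, ‖a • e₀ - y‖ = √((y 0 - a) ^ 2 + √(y 1 ^ 2 + y 2 ^ 2) ^ 2) := fun y => by
    rw [norm_eq_sqrt]
    simp only [e₀, PiLp.sub_apply, PiLp.smul_apply, PiLp.single_apply, smul_eq_mul]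
    simp only [Fin.isValue, ↓reduceIte, mul_one, one_ne_zero, mul_zero, zero_sub, even_two,
      Even.neg_pow, Fin.reduceEq]
    rw [show (a - y 0) ^ 2 = (y 0 - a) ^ 2 by ring]
  have e2 := lintegral_axisymm (fun z r => g (√(z ^ 2 + r ^ 2))
    * ENNReal.ofReal (√((z - a) ^ 2 + r ^ 2))⁻¹) (by
      unfold Function.uncurry
      fun_prop)
  have e3 := lintegral_axisymm (fun z r => g (√(z ^ 2 + r ^ 2))
    * ENNReal.ofReal (max (√(z ^ 2 + r ^ 2)) a)⁻¹) (by
      unfold Function.uncurry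
      fun_prop)
  simp only [← norm_eq_sqrt, ← n1] at e2 e3
  rw [e1, e2, e3]
  refine setLIntegral_congr_fun measurableSet_Ioi fun s hs => ?_
  have hs0 : 0 < s := hs
  have h1 : ∀ φ : ℝ, √((s * Real.cos φ) ^ 2 + (s * Real.sin φ) ^ 2) = s := fun φ => by
    rw [mul_pow, mul_pow, ← mul_add, Real.cos_sq_add_sin_sq, mul_one, Real.sqrt_sq hs0.le]
  simp only [h1]
  have key : ∀ b : ℝ → ℝ, Measurable b → (∀ φ, 0 ≤ b φ) → ∫⁻ φ in Ioo 0 Real.pi,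
      ENNReal.ofReal (2 * Real.pi * s ^ 2 * Real.sin φ) * (g s * ENNReal.ofReal (b φ))
      = ENNReal.ofReal (2 * Real.pi * s ^ 2) * g s * ∫⁻ φ in Ioo 0 Real.pi,
        ENNReal.ofReal (Real.sin φ * b φ) := fun b hb hb0 => by
    rw [← lintegral_const_mul _ (by fun_prop)]
    refine setLIntegral_congr_fun measurableSet_Ioo fun φ hφ => ?_
    have hsin := Real.sin_pos_of_pos_of_lt_pi hφ.1 hφ.2
    rw [ENNReal.ofReal_mul (by positivity), ENNReal.ofReal_mul hsin.le]
    ring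
  rw [key _ (by fun_prop) (fun _ => by positivity), key _ (by fun_prop) (fun _ => by positivity),
    lintegral_shell ha0 hs0]
  congr 1
  rw [lintegral_sin_eq (G := fun φ => -Real.cos φ * (max s a)⁻¹) (by fun_prop)]
  · rw [Real.cos_pi, Real.cos_zero]
    congr 1
    ring
  · intro φ _
    simpa using ((Real.hasDerivAt_cos φ).neg).mul_const (max s a)⁻¹
  · intro φ hφ
    have := Real.sin_pos_of_pos_of_lt_pi hφ.1 hφ.2
    positivity

/-- The potential of a radial density. -/
theorem pot_radial (f : ℝ → ℝ) (hf : Measurable f) (x : E3) :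
    pot (fun y => f ‖y‖) x = ∫ y : E3, f ‖y‖ * (max ‖y‖ ‖x‖)⁻¹ := by
  have hm1 : Measurable fun y : E3 => ENNReal.ofReal ‖x - y‖⁻¹ := by fun_prop
  have hm2 : Measurable fun y : E3 => ENNReal.ofReal (max ‖y‖ ‖x‖)⁻¹ := by fun_prop
  -- The nonnegative case, applied to indicators, says that the two weighted measures have the same
  -- image under the norm. Signed profiles are then covered by a change of variables.
  have hμ : ((volume : Measure E3).withDensity fun y => ENNReal.ofReal ‖x - y‖⁻¹).map (‖·‖)
      = ((volume : Measure E3).withDensity fun y => ENNReal.ofReal (max ‖y‖ ‖x‖)⁻¹).map (‖·‖) := by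
    ext s hs
    have := lintegral_newton (s.indicator 1) (measurable_one.indicator hs) x
    have hpre : MeasurableSet ((fun y : E3 => ‖y‖) ⁻¹' s) := measurable_norm hs
    rw [Measure.map_apply measurable_norm hs, Measure.map_apply measurable_norm hs,
      withDensity_apply _ hpre, withDensity_apply _ hpre, ← lintegral_indicator hpre,
      ← lintegral_indicator hpre]
    have hind : ∀ b : E3 → ℝ≥0∞, ((fun y : E3 => ‖y‖) ⁻¹' s).indicator b
        = fun y => s.indicator 1 ‖y‖ * b y := fun b => by
      funext y
      by_cases hy : ‖y‖ ∈ s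
      · rw [indicator_of_mem (by exact hy), indicator_of_mem hy, Pi.one_apply, one_mul]
      · rw [indicator_of_notMem (by exact hy), indicator_of_notMem hy, zero_mul]
    rw [hind, hind]
    exact this
  have h := congrArg (fun μ => ∫ s, f s ∂μ) hμ
  simp only at h
  rw [integral_map measurable_norm.aemeasurable hf.aestronglyMeasurable,
    integral_map measurable_norm.aemeasurable hf.aestronglyMeasurable,
    integral_withDensity_eq_integral_toReal_smul hm1 (by simp),
    integral_withDensity_eq_integral_toReal_smul hm2 (by simp)] at h
  unfold pot
  refine Eq.trans (integral_congr_ae (Eventually.of_forall fun y => ?_))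
    (h.trans (integral_congr_ae (Eventually.of_forall fun y => ?_)))
  · simp only
    rw [ENNReal.toReal_ofReal (by positivity), smul_eq_mul, div_eq_inv_mul]
  · simp only
    rw [ENNReal.toReal_ofReal (by positivity), smul_eq_mul, mul_comm]

/-- Shells outside the sphere through `x` contribute equally at `x` and at the origin, so they drop
out of the difference and only radii up to `|x|` remain. -/
theorem pot_radial_sub {f : ℝ → ℝ} (hf : Measurable f) {M : ℝ}
    (hs : Src (fun y => f ‖y‖) M) (x : E3) :
    pot (fun y => f ‖y‖) x - pot (fun y => f ‖y‖) 0
      = ∫ s in (0 : ℝ)..‖x‖, 4 * Real.pi * f s * (s ^ 2 * ‖x‖⁻¹ - s) := by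
  have hint : ∀ z : E3, Integrable fun y : E3 => f ‖y‖ * (max ‖y‖ ‖z‖)⁻¹ := fun z => by
    refine ((hs.integrable_pot 0).1.norm).mono' ?_ ?_
    · exact hs.meas.mul (Measurable.aestronglyMeasurable (by fun_prop))
    · have hne : ∀ᵐ y : E3, y ≠ 0 := by simp [ae_iff]
      filter_upwards [hne] with y hy
      have : 0 < ‖y‖ := norm_pos_iff.2 hy
      rw [norm_mul, norm_div, norm_norm, zero_sub, norm_neg, div_eq_mul_inv,
        Real.norm_of_nonneg (r := (max _ _)⁻¹) (by positivity)]
      gcongr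
      exact le_max_left _ _
  rw [pot_radial f hf, pot_radial f hf, ← integral_sub (hint x) (hint 0)]
  have h1 := integral_fun_norm_addHaar (volume : Measure E3)
    (fun s => f s * (max s ‖x‖)⁻¹ - f s * (max s ‖(0 : E3)‖)⁻¹)
  rw [h1]
  have hvol : (volume : Measure E3).real (Metric.ball 0 1) = 4 / 3 * Real.pi := by
    rw [Measure.real, EuclideanSpace.volume_ball_fin_three]
    simp [ENNReal.toReal_ofReal (by positivity : 0 ≤ Real.pi * 4 / 3)]
    ring
  rw [hvol, intervalIntegral.integral_of_le (norm_nonneg x)]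
  simp only [finrank_euclideanSpace, Fintype.card_fin, smul_eq_mul, nsmul_eq_mul, norm_zero]
  rw [← integral_const_mul, ← integral_const_mul, ← integral_indicator measurableSet_Ioi,
    ← integral_indicator measurableSet_Ioc]
  congr 1
  funext s
  by_cases h0 : 0 < s
  · rw [indicator_of_mem (by exact h0), max_eq_left h0.le]
    by_cases hx : s ≤ ‖x‖
    · rw [indicator_of_mem (show s ∈ Ioc 0 ‖x‖ from ⟨h0, hx⟩), max_eq_right hx]
      have : 0 < ‖x‖ := h0.trans_le hx
      norm_num
      field_simp
    · rw [indicator_of_notMem (fun h : s ∈ Ioc 0 ‖x‖ => hx h.2), max_eq_left (not_le.1 hx).le]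
      ring
  · rw [indicator_of_notMem (by exact h0), indicator_of_notMem (fun h : s ∈ Ioc 0 ‖x‖ => h0 h.1)]

/-! ### The radial profile of the steady state -/

/-- The consequences of the assumptions on the steady state which enter the analysis of the
operator: `u` and `r` are the radial profiles of the potential `U` and of the density `ρ`. -/
structure RadialState (U ρ : E3 → ℝ) (u r : ℝ → ℝ) (c C : ℝ) : Prop where
  U_eq : ∀ x, U x = u ‖x‖
  ρ_eq : ∀ x, ρ x = r ‖x‖
  contDiff_U : ContDiff ℝ 2 U
  contDiff_ρ : ContDiff ℝ 1 ρ
  contDiff_u : ContDiff ℝ 2 u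
  contDiff_r : ContDiff ℝ 1 r
  deriv_zero : deriv u 0 = 0
  c_pos : 0 < c
  C_nonneg : 0 ≤ C
  le_deriv : ∀ s ∈ Icc (0 : ℝ) 5, c * s ≤ deriv u s
  deriv_pos : ∀ s, 0 < s → 0 < deriv u s
  r_eq_zero : ∀ s, 1 ≤ s → r s = 0
  deriv_r_nonpos : ∀ s, 0 < s → deriv r s ≤ 0
  le_deriv_r : ∀ s, 0 < s → -(C * deriv u s) ≤ deriv r s
  newton : ∀ x, U x - U 0 = -(pot ρ x - pot ρ 0)

/-- Second derivatives are read off along lines. The first-derivative formula is needed only near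
`0`, because along the axis `|s + t|` equals `s + t` only for small `t`. -/
theorem iteratedFDeriv_two_line {U : E3 → ℝ} (hU : ContDiff ℝ 2 U) (x v : E3) {g' : ℝ → ℝ}
    {g'' : ℝ} (h1 : ∀ᶠ t in 𝓝 (0 : ℝ), HasDerivAt (fun t : ℝ => U (x + t • v)) (g' t) t)
    (h2 : HasDerivAt g' g'' 0) : iteratedFDeriv ℝ 2 U x ![v, v] = g'' := by
  rw [iteratedFDeriv_two_apply]
  simp only [Matrix.cons_val_zero, Matrix.cons_val_one]
  have hline : ∀ t : ℝ, HasDerivAt (fun t : ℝ => x + t • v) v t := fun t => by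
    simpa using ((hasDerivAt_id t).smul_const v).const_add x
  have hd : ∀ t : ℝ, HasDerivAt (fun t : ℝ => U (x + t • v)) (fderiv ℝ U (x + t • v) v) t :=
    fun t => ((hU.differentiable two_ne_zero _).hasFDerivAt).comp_hasDerivAt t (hline t)
  have h3 : HasDerivAt (fun t : ℝ => fderiv ℝ U (x + t • v) v) (fderiv ℝ (fderiv ℝ U) x v v) 0 := by
    have hC : ContDiff ℝ 1 (fderiv ℝ U) := hU.fderiv_right (by norm_num)
    have h4 := ((hC.differentiable one_ne_zero (x + (0 : ℝ) • v)).hasFDerivAt).comp_hasDerivAt 0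
      (hline 0)
    simp only [zero_smul, add_zero] at h4
    exact ((ContinuousLinearMap.apply ℝ ℝ v).hasFDerivAt).comp_hasDerivAt 0 h4
  have h5 : (fun t : ℝ => fderiv ℝ U (x + t • v) v) =ᶠ[𝓝 0] g' := by
    filter_upwards [h1] with t ht
    exact (hd t).unique ht
  exact h3.unique (h2.congr_of_eventuallyEq h5)

/-- The Laplacian of a radial function. -/
theorem laplacian_radial {U : E3 → ℝ} (hU : ContDiff ℝ 2 U) {u : ℝ → ℝ}
    (hu : ContDiff ℝ 2 u) (hUu : ∀ x, U x = u ‖x‖) {s : ℝ} (hs : 0 < s) :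
    Δ U (s • e₀) = deriv (deriv u) s + 2 * (deriv u s / s) := by
  have hu1 : ∀ t, HasDerivAt u (deriv u t) t := fun t =>
    (hu.differentiable two_ne_zero t).hasDerivAt
  have hu' : ContDiff ℝ 1 (deriv u) := by
    have : ContDiff ℝ (1 + 1) u := hu
    exact this.deriv'
  have hu2 : ∀ t, HasDerivAt (deriv u) (deriv (deriv u) t) t := fun t =>
    (hu'.differentiable one_ne_zero t).hasDerivAt
  rw [InnerProductSpace.laplacian_eq_iteratedFDeriv_orthonormalBasis U
    (EuclideanSpace.basisFun (Fin 3) ℝ)]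
  simp only [EuclideanSpace.basisFun_apply, Fin.sum_univ_three]
  have hrad : iteratedFDeriv ℝ 2 U (s • e₀)
      ![EuclideanSpace.single 0 1, EuclideanSpace.single 0 1] = deriv (deriv u) s := by
    refine iteratedFDeriv_two_line hU _ _ (g' := fun t => deriv u (s + t)) ?_ ?_
    · filter_upwards [lt_mem_nhds (show -s < 0 by linarith)] with t ht
      have h1 : (fun t : ℝ => U (s • e₀ + t • EuclideanSpace.single 0 1))
          =ᶠ[𝓝 t] fun t => u (s + t) := by
        filter_upwards [lt_mem_nhds ht] with t' ht'
        rw [hUu]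
        congr 1
        change ‖s • e₀ + t' • e₀‖ = _
        rw [← add_smul, norm_smul_e₀, abs_of_pos (by linarith)]
      exact ((hu1 (s + t)).comp_const_add s t).congr_of_eventuallyEq h1
    · have := (hu2 (s + 0)).comp_const_add s 0
      simpa using this
  have htan : ∀ i : Fin 3, i ≠ 0 → iteratedFDeriv ℝ 2 U (s • e₀)
      ![EuclideanSpace.single i 1, EuclideanSpace.single i 1] = deriv u s / s := by
    intro i hi
    have hn : ∀ t : ℝ, ‖s • e₀ + t • EuclideanSpace.single i (1 : ℝ)‖ = √(s ^ 2 + t ^ 2) := by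
      intro t
      have horth : inner ℝ (s • e₀) (t • EuclideanSpace.single i (1 : ℝ)) = 0 := by
        rw [real_inner_smul_left, real_inner_smul_right, e₀, EuclideanSpace.inner_single_left]
        simp [hi.symm]
      have h1 := norm_add_sq_eq_norm_sq_add_norm_sq_of_inner_eq_zero _ _ horth
      have h2 : ‖t • EuclideanSpace.single i (1 : ℝ)‖ = |t| := by
        rw [norm_smul]; simp
      rw [h2, norm_smul_e₀, abs_mul_abs_self, abs_mul_abs_self] at h1
      rw [← Real.sqrt_mul_self (norm_nonneg _), h1]
      congr 1
      ring
    have hpos : ∀ t : ℝ, 0 < s ^ 2 + t ^ 2 := fun t => by positivity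
    have hsq : ∀ t : ℝ, HasDerivAt (fun t : ℝ => √(s ^ 2 + t ^ 2)) (t / √(s ^ 2 + t ^ 2)) t := by
      intro t
      have h1 : HasDerivAt (fun t : ℝ => s ^ 2 + t ^ 2) (2 * t) t := by
        simpa using (hasDerivAt_pow 2 t).const_add (s ^ 2)
      refine (h1.sqrt (hpos t).ne').congr_deriv ?_
      field_simp
    refine iteratedFDeriv_two_line hU _ _
      (g' := fun t => deriv u (√(s ^ 2 + t ^ 2)) * (t / √(s ^ 2 + t ^ 2))) ?_ ?_
    · refine Eventually.of_forall fun t => ?_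
      simp only [hUu, hn]
      exact (hu1 _).comp t (hsq t)
    · have h1 : HasDerivAt (fun t => deriv u (√(s ^ 2 + t ^ 2))) _ 0 := (hu2 _).comp 0 (hsq 0)
      have h2 := h1.mul ((hasDerivAt_id (0 : ℝ)).div (hsq 0) (Real.sqrt_pos.2 (hpos 0)).ne')
      refine h2.congr_deriv ?_
      simp [pow_two]
      field_simp
      rw [Real.sqrt_sq hs.le]
  rw [hrad, htan 1 (by decide), htan 2 (by decide)]
  ring

/-! ### Mass formulas, monotonicity and regularity of the steady state. -/

section Steady

variable {φ : ℝ → ℝ} {E₀ : ℝ} {f₀ : E3 → E3 → ℝ} {ρ₀ U₀ : E3 → ℝ}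

/-- The restriction of a function to the first coordinate axis. -/
def profile (F : E3 → ℝ) (s : ℝ) : ℝ := F (s • e₀)

theorem eq_profile {F : E3 → ℝ} (h : ∀ (A : E3 ≃ₗᵢ[ℝ] E3) (x : E3), F (A x) = F x) (x : E3) :
    F x = profile F ‖x‖ := by
  obtain ⟨A, hA⟩ := exists_isometry_axis x
  rw [profile, ← hA, h]

theorem contDiff_profile {F : E3 → ℝ} {n : WithTop ℕ∞} (h : ContDiff ℝ n F) :
    ContDiff ℝ n (profile F) :=
  h.comp (contDiff_id.smul contDiff_const)

theorem deriv_profile_zero {F : E3 → ℝ} (h : ∀ (A : E3 ≃ₗᵢ[ℝ] E3) (x : E3), F (A x) = F x) :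
    deriv (profile F) 0 = 0 := by
  have h1 : (fun s => profile F (-s)) = profile F := by
    funext s
    rw [profile, neg_smul]
    exact h (LinearIsometryEquiv.neg ℝ) _
  have h2 := deriv_comp_neg (profile F) 0
  rw [h1, neg_zero] at h2
  linarith

theorem IsAnsatz.nonneg (hφ : IsAnsatz φ E₀) (E : ℝ) : 0 ≤ φ E := by
  rcases le_or_gt E₀ E with h | h
  · rw [hφ.eq_zero E h]
  · exact (hφ.pos E h).le

theorem IsAnsatz.antitone (hφ : IsAnsatz φ E₀) : Antitone φ := by
  intro a b hab
  rcases le_or_gt E₀ b with h | h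
  · rw [hφ.eq_zero b h]; exact hφ.nonneg a
  · exact hφ.strictAnti.antitoneOn (mem_Iio.2 (hab.trans_lt h)) (mem_Iio.2 h) hab

/-- The derivative is bounded on the compact interval `[a, E₀]` and vanishes above `E₀`. -/
theorem IsAnsatz.lipschitz (hφ : IsAnsatz φ E₀) (a : ℝ) :
    ∃ K, 0 ≤ K ∧ ∀ E ∈ Ici a, ∀ E' ∈ Ici a, |φ E - φ E'| ≤ K * |E - E'| := by
  have hc : Continuous (deriv φ) := hφ.contDiff.continuous_deriv_one
  obtain ⟨K, hK⟩ := (isCompact_Icc (a := a) (b := E₀)).exists_bound_of_continuousOn hc.continuousOn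
  refine ⟨max K 0, le_max_right _ _, fun E hE E' hE' => ?_⟩
  rw [← Real.norm_eq_abs, ← Real.norm_eq_abs]
  refine Convex.norm_image_sub_le_of_norm_deriv_le (𝕜 := ℝ) (f := φ) (s := Ici a)
    (fun x _ => hφ.contDiff.differentiable one_ne_zero x) (fun x hx => ?_) (convex_Ici a) hE' hE
  rcases le_or_gt x E₀ with h | h
  · exact le_trans (hK x ⟨hx, h⟩) (le_max_left K 0)
  · have : deriv φ x = 0 := by
      have h1 : φ =ᶠ[𝓝 x] fun _ => 0 := by
        filter_upwards [lt_mem_nhds h] with y hy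
        exact hφ.eq_zero y hy.le
      rw [h1.deriv_eq]; simp
    rw [this, norm_zero]
    exact le_max_right _ _

theorem density_eq (hs : IsSphericalSteadyState φ f₀ ρ₀ U₀) (x : E3) :
    Integrable (fun v : E3 => φ (‖v‖ ^ 2 / 2 + U₀ x)) ∧
      ρ₀ x = ∫ v : E3, φ (‖v‖ ^ 2 / 2 + U₀ x) := by
  have := hs.solution.density x
  have h1 : f₀ x = fun v => φ (‖v‖ ^ 2 / 2 + U₀ x) := funext fun v => hs.ansatz x v
  rw [h1] at this
  exact this

theorem density_nonneg (hφ : IsAnsatz φ E₀) (hs : IsSphericalSteadyState φ f₀ ρ₀ U₀) (x : E3) :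
    0 ≤ ρ₀ x := by
  rw [(density_eq hs x).2]
  exact integral_nonneg fun v => hφ.nonneg _

theorem density_anti (hφ : IsAnsatz φ E₀) (hs : IsSphericalSteadyState φ f₀ ρ₀ U₀) {x y : E3}
    (h : U₀ x ≤ U₀ y) : ρ₀ y ≤ ρ₀ x := by
  rw [(density_eq hs x).2, (density_eq hs y).2]
  exact integral_mono (density_eq hs y).1 (density_eq hs x).1 fun v => hφ.antitone (by linarith)

theorem density_lipschitz (hφ : IsAnsatz φ E₀) (hs : IsSphericalSteadyState φ f₀ ρ₀ U₀)
    (a : ℝ) : ∃ C, 0 ≤ C ∧ ∀ x y : E3, a ≤ U₀ x → a ≤ U₀ y →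
      |ρ₀ x - ρ₀ y| ≤ C * |U₀ x - U₀ y| := by
  obtain ⟨K, hK0, hK⟩ := hφ.lipschitz a
  -- For speeds beyond `R` both energies exceed the cut-off, so only velocities in a fixed ball
  -- contribute to the difference of the densities.
  set R : ℝ := √(2 * |E₀ - a|) with hR
  refine ⟨K * (volume (B R)).toReal, by positivity, fun x y hx hy => ?_⟩
  rw [(density_eq hs x).2, (density_eq hs y).2,
    ← integral_sub (density_eq hs x).1 (density_eq hs y).1, ← Real.norm_eq_abs]
  have hfin : volume (B R : Set E3) ≠ ⊤ := (isCompact_closedBall (0 : E3) R).measure_lt_top.ne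
  have hI : Integrable ((B R : Set E3).indicator fun _ => K * |U₀ x - U₀ y|) :=
    (integrable_indicator_iff measurableSet_closedBall).2 (integrableOn_const hfin)
  refine le_trans (norm_integral_le_of_norm_le hI (Eventually.of_forall fun v => ?_))
    (le_of_eq ?_)
  · by_cases hv : v ∈ B R
    · rw [indicator_of_mem hv]
      have h2 : 0 ≤ ‖v‖ ^ 2 / 2 := by positivity
      refine (hK _ (mem_Ici.2 (by linarith)) _ (mem_Ici.2 (by linarith))).trans (le_of_eq ?_)
      congr 2
      ring
    · rw [indicator_of_notMem hv]
      have h1 : R < ‖v‖ := by simpa using hv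
      have h2 : 2 * |E₀ - a| < ‖v‖ ^ 2 := by
        rw [← Real.sq_sqrt (by positivity : 0 ≤ 2 * |E₀ - a|)]
        exact pow_lt_pow_left₀ h1 (Real.sqrt_nonneg _) two_ne_zero
      have h3 := le_abs_self (E₀ - a)
      rw [hφ.eq_zero _ (by linarith), hφ.eq_zero _ (by linarith), sub_zero, norm_zero]
  · rw [integral_indicator measurableSet_closedBall, setIntegral_const]
    simp only [Measure.real, smul_eq_mul]
    ring

theorem profile_zero (F : E3 → ℝ) : profile F 0 = F 0 := by rw [profile, zero_smul]

theorem deriv_deriv_profile (hs : IsSphericalSteadyState φ f₀ ρ₀ U₀) {s : ℝ} (h : 0 < s) :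
    s * deriv (deriv (profile U₀)) s + 2 * deriv (profile U₀) s
      = 4 * Real.pi * s * profile ρ₀ s := by
  have h1 := laplacian_radial hs.contDiff_U (contDiff_profile hs.contDiff_U)
    (eq_profile hs.symm_U) h
  rw [hs.solution.poisson] at h1
  rw [show profile ρ₀ s = ρ₀ (s • e₀) from rfl, show 4 * Real.pi * s * ρ₀ (s • e₀)
    = s * (4 * Real.pi * ρ₀ (s • e₀)) by ring, h1]
  field_simp

theorem hasDerivAt_profile (hs : IsSphericalSteadyState φ f₀ ρ₀ U₀) (s : ℝ) :
    HasDerivAt (profile U₀) (deriv (profile U₀) s) s ∧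
    HasDerivAt (deriv (profile U₀)) (deriv (deriv (profile U₀)) s) s ∧
    Continuous (deriv (profile U₀)) := by
  have hu := contDiff_profile hs.contDiff_U
  have hu' : ContDiff ℝ 1 (deriv (profile U₀)) := by
    have : ContDiff ℝ (1 + 1) (profile U₀) := hu
    exact this.deriv'
  exact ⟨(hu.differentiable two_ne_zero s).hasDerivAt,
    (hu'.differentiable one_ne_zero s).hasDerivAt, hu'.continuous⟩

/-- Gauss's law: the radial Poisson equation is `(t² u')' = 4π t² ρ`, and the boundary term at the
centre vanishes. -/
theorem sq_mul_deriv_profile (hs : IsSphericalSteadyState φ f₀ ρ₀ U₀) {R : ℝ} (hR : 0 ≤ R) :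
    R ^ 2 * deriv (profile U₀) R = ∫ t in (0 : ℝ)..R, 4 * Real.pi * t ^ 2 * profile ρ₀ t := by
  have hd := hasDerivAt_profile hs
  have hc : Continuous (profile ρ₀) := (contDiff_profile hs.contDiff_ρ).continuous
  have hcu := (hd 0).2.2
  rw [intervalIntegral.integral_eq_sub_of_hasDerivAt_of_le hR
    (f := fun t => t ^ 2 * deriv (profile U₀) t)]
  · ring
  · fun_prop
  · intro t ht
    refine ((hasDerivAt_pow 2 t).mul (hd t).2.1).congr_deriv ?_
    have := deriv_deriv_profile hs ht.1
    push_cast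
    linear_combination t * this
  · exact (by fun_prop : Continuous _).intervalIntegrable _ _

/-- The second integration of the radial Poisson equation. Up to sign and the factor `R`, the right
side is the one in `pot_radial_sub`, so `U₀` is identified with the potential of its density by
comparing formulas, without a uniqueness theorem for the Poisson equation. -/
theorem mul_profile_sub (hs : IsSphericalSteadyState φ f₀ ρ₀ U₀) {R : ℝ} (hR : 0 ≤ R) :
    R * (profile U₀ R - profile U₀ 0)
      = ∫ t in (0 : ℝ)..R, 4 * Real.pi * profile ρ₀ t * (t * (R - t)) := by
  have hd := hasDerivAt_profile hs
  have hc : Continuous (profile ρ₀) := (contDiff_profile hs.contDiff_ρ).continuous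
  have hcu := (hd 0).2.2
  have hcu0 : Continuous (profile U₀) := (contDiff_profile hs.contDiff_U).continuous
  rw [intervalIntegral.integral_eq_sub_of_hasDerivAt_of_le hR
    (f := fun t => (R - t) * (profile U₀ t - profile U₀ 0 + t * deriv (profile U₀) t)
      + t * (profile U₀ t - profile U₀ 0))]
  · ring
  · fun_prop
  · intro t ht
    have h1 : HasDerivAt (fun t => (R - t) * (profile U₀ t - profile U₀ 0
        + t * deriv (profile U₀) t) + t * (profile U₀ t - profile U₀ 0)) _ t :=
      ((((hasDerivAt_id t).const_sub R)).mul (((hd t).1.sub_const _).add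
        ((hasDerivAt_id t).mul (hd t).2.1))).add
        ((hasDerivAt_id t).mul ((hd t).1.sub_const (profile U₀ 0)))
    refine h1.congr_deriv ?_
    have := deriv_deriv_profile hs ht.1
    simp only [id, Pi.add_apply, Pi.mul_apply]
    linear_combination (R - t) * this
  · exact (by fun_prop : Continuous _).intervalIntegrable _ _

theorem density_eq_zero_of_one_le (hs : IsSphericalSteadyState φ f₀ ρ₀ U₀) {x : E3}
    (hx : 1 < ‖x‖) : ρ₀ x = 0 := by
  by_contra h
  have h1 : x ∈ tsupport ρ₀ := subset_tsupport _ h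
  rw [hs.tsupport_ρ, mem_closedBall_zero_iff] at h1
  linarith

theorem profile_density_eq_zero (hs : IsSphericalSteadyState φ f₀ ρ₀ U₀) {s : ℝ} (h : 1 ≤ s) :
    profile ρ₀ s = 0 := by
  have hc : Continuous (profile ρ₀) := (contDiff_profile hs.contDiff_ρ).continuous
  have hcl : IsClosed {t | profile ρ₀ t = 0} := isClosed_eq hc continuous_const
  have hsub : Ioi (1 : ℝ) ⊆ {t | profile ρ₀ t = 0} := fun t ht => by
    refine density_eq_zero_of_one_le hs ?_
    have h1 : (1 : ℝ) < t := ht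
    rwa [norm_smul_e₀, abs_of_pos (by linarith)]
  have := closure_minimal hsub hcl
  rw [closure_Ioi] at this
  exact this h

theorem deriv_profile_nonneg (hφ : IsAnsatz φ E₀) (hs : IsSphericalSteadyState φ f₀ ρ₀ U₀) {s : ℝ}
    (h : 0 ≤ s) : 0 ≤ deriv (profile U₀) s := by
  rcases h.eq_or_lt with rfl | h0
  · rw [deriv_profile_zero hs.symm_U]
  have h1 := sq_mul_deriv_profile hs h
  have h2 : 0 ≤ ∫ t in (0 : ℝ)..s, 4 * Real.pi * t ^ 2 * profile ρ₀ t :=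
    intervalIntegral.integral_nonneg h fun t _ => by
      have := density_nonneg hφ hs (t • e₀)
      have hpi := Real.pi_pos
      exact mul_nonneg (by positivity) this
  rw [← h1] at h2
  exact nonneg_of_mul_nonneg_right h2 (by positivity)

theorem monotoneOn_profile (hφ : IsAnsatz φ E₀) (hs : IsSphericalSteadyState φ f₀ ρ₀ U₀) :
    MonotoneOn (profile U₀) (Ici 0) := by
  refine monotoneOn_of_deriv_nonneg (convex_Ici 0)
    (contDiff_profile hs.contDiff_U).continuous.continuousOn
    ((contDiff_profile hs.contDiff_U).differentiable two_ne_zero).differentiableOn fun s h => ?_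
  rw [interior_Ici] at h
  exact deriv_profile_nonneg hφ hs (le_of_lt h)

/-- The potential is smallest at the centre. If the density vanished there, the central potential
would reach the cut-off energy, hence so would all energies, and the density would be zero
everywhere, against its support being a ball. -/
theorem density_zero_pos (hφ : IsAnsatz φ E₀) (hs : IsSphericalSteadyState φ f₀ ρ₀ U₀) :
    0 < ρ₀ 0 := by
  refine (density_nonneg hφ hs 0).lt_of_ne fun h0 => ?_
  have h1 := (density_eq hs 0).2
  rw [← h0, eq_comm, integral_eq_zero_iff_of_nonneg (fun v => hφ.nonneg _) (density_eq hs 0).1] at h1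
  have hcφ : Continuous φ := hφ.contDiff.continuous
  have h2 := (Continuous.ae_eq_iff_eq volume (by fun_prop)
    (continuous_const (y := (0 : ℝ)))).1 h1
  have h3 : E₀ ≤ U₀ 0 := by
    by_contra hlt
    have h4 := hφ.pos _ (not_le.1 hlt)
    have h5 := congrFun h2 0
    norm_num at h5
    linarith
  have h4 : ρ₀ = 0 := by
    funext x
    rw [(density_eq hs x).2]
    refine integral_eq_zero_of_ae (Eventually.of_forall fun v => hφ.eq_zero _ ?_)
    have h5 := monotoneOn_profile hφ hs (mem_Ici.2 le_rfl) (mem_Ici.2 (norm_nonneg x))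
      (norm_nonneg x)
    rw [profile_zero, ← eq_profile hs.symm_U x] at h5
    have : 0 ≤ ‖v‖ ^ 2 / 2 := by positivity
    linarith
  have h5 := hs.tsupport_ρ
  rw [h4] at h5
  have h6 : (0 : E3) ∈ B 1 := by simp
  rw [← h5] at h6
  simp [tsupport] at h6

theorem exists_le_deriv_profile (hφ : IsAnsatz φ E₀) (hs : IsSphericalSteadyState φ f₀ ρ₀ U₀)
    {T : ℝ} (hT : 0 < T) :
    ∃ c, 0 < c ∧ ∀ s ∈ Icc (0 : ℝ) T, c * s ≤ deriv (profile U₀) s := by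
  have hc : Continuous (profile ρ₀) := (contDiff_profile hs.contDiff_ρ).continuous
  set d := ρ₀ 0 with hd
  have hd0 : 0 < d := density_zero_pos hφ hs
  have hp0 : profile ρ₀ 0 = d := profile_zero _
  obtain ⟨δ, hδ, hδ'⟩ := Metric.eventually_nhds_iff_ball.1
    (hc.continuousAt.eventually (lt_mem_nhds (show d / 2 < profile ρ₀ 0 by rw [hp0]; linarith)))
  -- The ratio is chosen so that for every `s ≤ T` the ball of radius `k s` lies where the density
  -- exceeds half its central value; its mass alone gives a multiple of `s³` in Gauss's law.
  set k : ℝ := min 1 (δ / (2 * T)) with hk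
  have hk0 : 0 < k := lt_min one_pos (by positivity)
  have hpi := Real.pi_pos
  refine ⟨2 * Real.pi * d * k ^ 3 / 3, by positivity, fun s hsT => ?_⟩
  rcases hsT.1.eq_or_lt with rfl | h0
  · rw [mul_zero]; exact deriv_profile_nonneg hφ hs le_rfl
  have hks : k * s ≤ s := mul_le_of_le_one_left h0.le (min_le_left _ _)
  have hkδ : k * s < δ := by
    have h1 : k * s ≤ δ / (2 * T) * T :=
      mul_le_mul (min_le_right _ _) hsT.2 h0.le (by positivity)
    have h2 : δ / (2 * T) * T = δ / 2 := by field_simp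
    linarith
  have hint : ∀ a b : ℝ, IntervalIntegrable (fun t => 4 * Real.pi * t ^ 2 * profile ρ₀ t)
      volume a b := fun a b => (by fun_prop : Continuous _).intervalIntegrable _ _
  have h1 := sq_mul_deriv_profile hs h0.le
  have h2 : ∫ t in (0 : ℝ)..(k * s), 2 * Real.pi * d * t ^ 2
      ≤ ∫ t in (0 : ℝ)..(k * s), 4 * Real.pi * t ^ 2 * profile ρ₀ t := by
    refine intervalIntegral.integral_mono_on (by positivity)
      ((by fun_prop : Continuous _).intervalIntegrable _ _) (hint _ _) fun t ht => ?_
    have h3 := hδ' t (by rw [mem_ball_zero_iff, Real.norm_of_nonneg ht.1]; linarith [ht.2])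
    have : 0 ≤ 4 * Real.pi * t ^ 2 := by positivity
    nlinarith
  have h3 : 0 ≤ ∫ t in (k * s)..s, 4 * Real.pi * t ^ 2 * profile ρ₀ t :=
    intervalIntegral.integral_nonneg hks fun t _ =>
      mul_nonneg (by positivity) (density_nonneg hφ hs (t • e₀))
  rw [← intervalIntegral.integral_add_adjacent_intervals (hint 0 (k * s)) (hint _ _)] at h1
  rw [intervalIntegral.integral_const_mul, integral_pow] at h2
  have h4 : 2 * Real.pi * d * ((k * s) ^ (2 + 1) / 3) ≤ s ^ 2 * deriv (profile U₀) s := by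
    rw [h1]
    norm_num at h2 ⊢
    linarith
  have h5 : s ^ 2 * (2 * Real.pi * d * k ^ 3 / 3 * s) ≤ s ^ 2 * deriv (profile U₀) s := by
    refine le_trans (le_of_eq ?_) h4
    ring
  exact le_of_mul_le_mul_left h5 (by positivity)

theorem deriv_profile_pos (hφ : IsAnsatz φ E₀) (hs : IsSphericalSteadyState φ f₀ ρ₀ U₀)
    {s : ℝ} (h : 0 < s) : 0 < deriv (profile U₀) s := by
  obtain ⟨c, hc, hc'⟩ := exists_le_deriv_profile hφ hs h
  exact (mul_pos hc h).trans_le (hc' s ⟨h.le, le_rfl⟩)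

theorem exists_radialState (hφ : IsAnsatz φ E₀) (hs : IsSphericalSteadyState φ f₀ ρ₀ U₀) :
    ∃ c C, RadialState U₀ ρ₀ (profile U₀) (profile ρ₀) c C := by
  obtain ⟨c, hc, hc'⟩ := exists_le_deriv_profile hφ hs (T := 5) (by norm_num)
  obtain ⟨C, hC, hC'⟩ := density_lipschitz hφ hs (U₀ 0)
  have hmono := monotoneOn_profile hφ hs
  have hU0 : ∀ x, U₀ 0 ≤ U₀ x := fun x => by
    have h5 := hmono (mem_Ici.2 le_rfl) (mem_Ici.2 (norm_nonneg x)) (norm_nonneg x)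
    rwa [profile_zero, ← eq_profile hs.symm_U x] at h5
  have hanti : AntitoneOn (profile ρ₀) (Ici 0) := fun a ha b hb hab =>
    density_anti hφ hs (hmono ha hb hab)
  have hdr : ∀ s, HasDerivAt (profile ρ₀) (deriv (profile ρ₀) s) s := fun s =>
    ((contDiff_profile hs.contDiff_ρ).differentiable one_ne_zero s).hasDerivAt
  have hcr : Continuous (profile ρ₀) := (contDiff_profile hs.contDiff_ρ).continuous
  have hnonpos : ∀ s, 0 < s → deriv (profile ρ₀) s ≤ 0 := fun s h0 => by
    rw [← derivWithin_of_mem_nhds (Ici_mem_nhds h0)]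
    exact hanti.derivWithin_nonpos
  refine ⟨c, C, eq_profile hs.symm_U, eq_profile hs.symm_ρ, hs.contDiff_U, hs.contDiff_ρ,
    contDiff_profile hs.contDiff_U, contDiff_profile hs.contDiff_ρ, deriv_profile_zero hs.symm_U,
    hc, hC, hc', fun s => deriv_profile_pos hφ hs, fun s => profile_density_eq_zero hs, hnonpos,
    fun s h0 => ?_, fun x => ?_⟩
  · have h1 : ‖deriv (profile ρ₀) s‖ ≤ C * ‖deriv (profile U₀) s‖ := by
      have t1 := (hasDerivAt_iff_tendsto_slope.1 (hdr s)).norm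
      have t2 := ((hasDerivAt_iff_tendsto_slope.1 (hasDerivAt_profile hs s).1).norm).const_mul C
      refine le_of_tendsto_of_tendsto t1 t2 (Eventually.of_forall fun t => ?_)
      simp only [slope_def_field, norm_div, Real.norm_eq_abs, ← mul_div_assoc]
      exact div_le_div_of_nonneg_right (hC' _ _ (hU0 _) (hU0 _)) (abs_nonneg _)
    rw [Real.norm_eq_abs, Real.norm_eq_abs, abs_of_nonpos (hnonpos s h0),
      abs_of_pos (deriv_profile_pos hφ hs h0)] at h1
    linarith
  · have hsrc : ∃ M, Src (fun y : E3 => profile ρ₀ ‖y‖) M := by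
      obtain ⟨M, hM⟩ := (isCompact_closedBall (0 : E3) 1).exists_bound_of_continuousOn
        hs.contDiff_ρ.continuous.continuousOn
      have e : (fun y : E3 => profile ρ₀ ‖y‖) = ρ₀ := funext fun y => (eq_profile hs.symm_ρ y).symm
      rw [e]
      refine ⟨max M 0, hs.contDiff_ρ.continuous.aestronglyMeasurable, fun y => ?_, fun y hy =>
        density_eq_zero_of_one_le hs (by linarith)⟩
      rcases le_or_gt ‖y‖ 1 with h | h
      · exact (hM y (by simpa using h)).trans (le_max_left _ _)
      · rw [density_eq_zero_of_one_le hs h, abs_zero]; exact le_max_right _ _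
    obtain ⟨M, hM⟩ := hsrc
    have h1 := pot_radial_sub hcr.measurable hM x
    have e : (fun y : E3 => profile ρ₀ ‖y‖) = ρ₀ := funext fun y => (eq_profile hs.symm_ρ y).symm
    rw [e] at h1
    rw [h1]
    rcases eq_or_ne x 0 with rfl | hx
    · simp
    have hx0 : 0 < ‖x‖ := norm_pos_iff.2 hx
    have h2 := mul_profile_sub hs (norm_nonneg x)
    rw [← eq_profile hs.symm_U x, profile_zero] at h2
    have h3 : U₀ x - U₀ 0 = ‖x‖⁻¹ * (‖x‖ * (U₀ x - U₀ 0)) := by field_simp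
    rw [h3, h2, ← intervalIntegral.integral_const_mul, ← intervalIntegral.integral_neg]
    congr 1
    funext t
    field_simp
    ring

/-- At `ω = 0` the cut-off in `h̃` has no effect on the steady state. -/
theorem hTilde_zero_eq (hφ : IsAnsatz φ E₀) (hs : IsSphericalSteadyState φ f₀ ρ₀ U₀)
    (a : ℝ) (x : E3) : hTilde φ E₀ U₀ 0 a (U₀ x) = ρ₀ x := by
  have e : E₀ + E₁ E₀ U₀ = profile U₀ 2 := by
    rw [E₁, potentialAtTwo, profile, e₀]
    have : (2 : ℝ) • (EuclideanSpace.single 0 1 : E3) = EuclideanSpace.single 0 2 := by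
      ext i
      fin_cases i <;> simp
    rw [this]
    ring
  rw [hTilde, e]
  split_ifs with h
  · rw [(density_eq hs x).2]
    congr 1
    funext v
    congr 1
    ring
  · symm
    -- When the cut-off is active, the strictly increasing potential has reached its value at radius
    -- `2`, well outside the support of the density.
    refine density_eq_zero_of_one_le hs ?_
    by_contra hx
    rw [not_lt] at hx
    have hmono : StrictMonoOn (profile U₀) (Ici 0) := by
      refine strictMonoOn_of_deriv_pos (convex_Ici 0)
        (contDiff_profile hs.contDiff_U).continuous.continuousOn fun s h => ?_
      rw [interior_Ici] at h
      exact deriv_profile_pos hφ hs h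
    rw [eq_profile hs.symm_U x] at h
    exact h (hmono (mem_Ici.2 (norm_nonneg x)) (mem_Ici.2 (by norm_num)) (by linarith))

end Steady

/-! ### The weight `q` and coordinate isometries -/

/-- The radial weight `-ρ₀' / U₀'`. -/
def qr (u r : ℝ → ℝ) (s : ℝ) : ℝ := -(deriv r s / deriv u s)

theorem hasFDerivAt_norm {x : E3} (hx : x ≠ 0) :
    HasFDerivAt (fun y : E3 => ‖y‖) (innerSL ℝ (‖x‖⁻¹ • x)) x := by
  have h1 : HasFDerivAt (fun y : E3 => ‖y‖ ^ 2) (2 • innerSL ℝ x) x :=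
    (hasStrictFDerivAt_norm_sq x).hasFDerivAt
  have h2 := h1.sqrt (by positivity)
  simp only [Real.sqrt_sq (norm_nonneg _)] at h2
  refine h2.congr_fderiv ?_
  ext v
  have : ‖x‖ ≠ 0 := norm_ne_zero_iff.2 hx
  simp
  field_simp

section

variable {U ρ : E3 → ℝ} {u r : ℝ → ℝ} {c C : ℝ}

theorem RadialState.hasDerivAt_u (h : RadialState U ρ u r c C) (s : ℝ) :
    HasDerivAt u (deriv u s) s :=
  (h.contDiff_u.differentiable two_ne_zero s).hasDerivAt

theorem RadialState.contDiff_deriv_u (h : RadialState U ρ u r c C) : ContDiff ℝ 1 (deriv u) := by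
  have : ContDiff ℝ (1 + 1) u := h.contDiff_u
  exact this.deriv'

theorem RadialState.hasDerivAt_r (h : RadialState U ρ u r c C) (s : ℝ) :
    HasDerivAt r (deriv r s) s :=
  (h.contDiff_r.differentiable one_ne_zero s).hasDerivAt

theorem RadialState.qr_nonneg (h : RadialState U ρ u r c C) {s : ℝ} (hs : 0 ≤ s) :
    0 ≤ qr u r s := by
  rcases hs.eq_or_lt with rfl | h0
  -- At the centre `u'` vanishes, and division by zero assigns the weight the value `0`.
  · simp [qr, h.deriv_zero]
  · rw [qr, ← neg_div]
    exact div_nonneg (neg_nonneg.2 (h.deriv_r_nonpos s h0)) (h.deriv_pos s h0).le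

theorem RadialState.qr_le (h : RadialState U ρ u r c C) {s : ℝ} (hs : 0 ≤ s) :
    qr u r s ≤ C := by
  rcases hs.eq_or_lt with rfl | h0
  · simpa [qr, h.deriv_zero] using h.C_nonneg
  · rw [qr, ← neg_div, div_le_iff₀ (h.deriv_pos s h0)]
    linarith [h.le_deriv_r s h0]

theorem RadialState.deriv_r_eq_zero (h : RadialState U ρ u r c C) {s : ℝ} (hs : 1 < s) :
    deriv r s = 0 := by
  have h1 : r =ᶠ[𝓝 s] fun _ => 0 := by
    filter_upwards [lt_mem_nhds hs] with t ht
    exact h.r_eq_zero t ht.le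
  rw [h1.deriv_eq]; simp

theorem RadialState.qr_eq_zero (h : RadialState U ρ u r c C) {s : ℝ} (hs : 1 < s) :
    qr u r s = 0 := by
  rw [qr, h.deriv_r_eq_zero hs, zero_div, neg_zero]

theorem RadialState.qr_mul (h : RadialState U ρ u r c C) {s : ℝ} (hs : 0 < s) :
    qr u r s * deriv u s = -deriv r s := by
  have := (h.deriv_pos s hs).ne'
  rw [qr]; field_simp

theorem measurable_qr (u r : ℝ → ℝ) : Measurable (qr u r) :=
  ((measurable_deriv r).div (measurable_deriv u)).neg

theorem RadialState.src_mul (h : RadialState U ρ u r c C) {W : E3 → ℝ} {M : ℝ} (hM : 0 ≤ M)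
    (hW : AEStronglyMeasurable W volume) (hb : ∀ y, ‖y‖ ≤ 1 → |W y| ≤ M) :
    Src (fun y => qr u r ‖y‖ * W y) (C * M) where
  meas := ((measurable_qr u r).comp measurable_norm).aestronglyMeasurable.mul hW
  bound y := by
    rcases le_or_gt ‖y‖ 1 with h1 | h1
    · rw [abs_mul, abs_of_nonneg (h.qr_nonneg (norm_nonneg y))]
      exact mul_le_mul (h.qr_le (norm_nonneg y)) (hb y h1) (abs_nonneg _) h.C_nonneg
    · rw [h.qr_eq_zero h1, zero_mul, abs_zero]
      exact mul_nonneg h.C_nonneg hM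
  supp y hy := by rw [h.qr_eq_zero (by linarith), zero_mul]

theorem RadialState.srcL_mul (h : RadialState U ρ u r c C) {W : E3 → ℝ} {M : ℝ} (hM : 0 ≤ M)
    (hW : AEStronglyMeasurable W volume) (hb : ∀ y, ‖y‖ ≤ 1 → |W y| ≤ M * ‖y‖) :
    SrcL (fun y => qr u r ‖y‖ * W y) (C * M) where
  meas := ((measurable_qr u r).comp measurable_norm).aestronglyMeasurable.mul hW
  bound y := by
    rcases le_or_gt ‖y‖ 1 with h1 | h1
    · rw [abs_mul, abs_of_nonneg (h.qr_nonneg (norm_nonneg y)), mul_assoc]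
      exact mul_le_mul (h.qr_le (norm_nonneg y)) (hb y h1) (abs_nonneg _) h.C_nonneg
    · rw [h.qr_eq_zero h1, zero_mul, abs_zero]
      have := h.C_nonneg
      positivity
  supp y hy := by rw [h.qr_eq_zero (by linarith), zero_mul]

theorem RadialState.fderiv_U (h : RadialState U ρ u r c C) {x : E3} (hx : x ≠ 0) :
    HasFDerivAt U (deriv u ‖x‖ • innerSL ℝ (‖x‖⁻¹ • x)) x := by
  have := (h.hasDerivAt_u ‖x‖).comp_hasFDerivAt x (hasFDerivAt_norm hx)
  rwa [show (u ∘ fun y : E3 => ‖y‖) = U from funext fun y => (h.U_eq y).symm] at this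

theorem RadialState.fderiv_ρ (h : RadialState U ρ u r c C) {x : E3} (hx : x ≠ 0) :
    HasFDerivAt ρ (deriv r ‖x‖ • innerSL ℝ (‖x‖⁻¹ • x)) x := by
  have := (h.hasDerivAt_r ‖x‖).comp_hasFDerivAt x (hasFDerivAt_norm hx)
  rwa [show (r ∘ fun y : E3 => ‖y‖) = ρ from funext fun y => (h.ρ_eq y).symm] at this

theorem RadialState.hasCompactSupport_ρ (h : RadialState U ρ u r c C) : HasCompactSupport ρ :=
  HasCompactSupport.intro (isCompact_closedBall (0 : E3) 1) fun x hx => by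
    rw [h.ρ_eq]
    refine h.r_eq_zero _ (le_of_lt ?_)
    simpa using hx

/-- The derivatives of the potential solve the linearised equation. -/
theorem RadialState.fderiv_U_eq_pot (h : RadialState U ρ u r c C) (x v : E3) :
    fderiv ℝ U x v = pot (fun y => qr u r ‖y‖ * fderiv ℝ U y v) x := by
  -- Differentiate `U = -pot ρ + const`: the derivative falls on the density, and `∇ρ = -q ∇U` by
  -- the definition of `q`.
  have h1 : U = fun x => -(pot ρ x - pot ρ 0) + U 0 := funext fun x => by rw [← h.newton]; ring
  have h2 : fderiv ℝ U x v = -fderiv ℝ (pot ρ) x v := by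
    nth_rewrite 1 [h1]
    rw [fderiv_add_const, fderiv_fun_neg, fderiv_sub_const]; rfl
  rw [h2, fderiv_pot_apply h.contDiff_ρ h.hasCompactSupport_ρ]
  unfold pot
  rw [← integral_neg]
  refine integral_congr_ae ?_
  have hne : ∀ᵐ y : E3, y ≠ 0 := by simp [ae_iff]
  filter_upwards [hne] with y hy
  rw [(h.fderiv_U hy).fderiv, (h.fderiv_ρ hy).fderiv, ← neg_div]
  congr 1
  have := h.qr_mul (norm_pos_iff.2 hy)
  simp only [_root_.smul_apply, smul_eq_mul]
  rw [← mul_assoc, this]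
  ring

end

/-- The reflection `reflect i` as a linear isometry. -/
def reflIso (i : Fin 3) : E3 ≃ₗᵢ[ℝ] E3 :=
  LinearIsometryEquiv.piLpCongrRight 2 fun j =>
    if j = i then LinearIsometryEquiv.neg ℝ else LinearIsometryEquiv.refl ℝ ℝ

theorem reflect_apply (i j : Fin 3) (x : E3) : reflect i x j = if j = i then -x j else x j := by
  simp only [reflect, Function.update_apply]
  split_ifs with h
  · rw [h]
  · rfl

theorem reflIso_apply (i : Fin 3) (x : E3) : reflIso i x = reflect i x := by
  ext j
  rw [reflect_apply]
  simp only [reflIso, LinearIsometryEquiv.piLpCongrRight_apply]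
  split_ifs with h <;> simp

theorem norm_reflect (i : Fin 3) (x : E3) : ‖reflect i x‖ = ‖x‖ := by
  rw [← reflIso_apply, LinearIsometryEquiv.norm_map]

theorem reflect_reflect (i : Fin 3) (x : E3) : reflect i (reflect i x) = x := by
  ext j
  simp only [reflect_apply]
  split_ifs <;> simp

theorem reflect_comm (i j : Fin 3) (x : E3) : reflect i (reflect j x) = reflect j (reflect i x) := by
  ext k
  simp only [reflect_apply]
  split_ifs <;> simp

theorem neg_eq_reflect (x : E3) : -x = reflect 0 (reflect 1 (reflect 2 x)) := by
  ext j
  fin_cases j <;> simp [reflect_apply]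

/-- The rotation in the plane of the first two coordinates with cosine `a` and sine `b`. -/
def rot (a b : ℝ) (h : a ^ 2 + b ^ 2 = 1) : E3 ≃ₗᵢ[ℝ] E3 :=
  LinearIsometry.toLinearIsometryEquiv
    { toFun := fun x => WithLp.toLp 2 ![a * x 0 - b * x 1, b * x 0 + a * x 1, x 2]
      map_add' := fun x y => by
        ext j
        fin_cases j <;> simp <;> ring
      map_smul' := fun t x => by
        ext j
        fin_cases j <;> simp <;> ring
      norm_map' := fun x => by
        simp only [EuclideanSpace.norm_eq, Fin.sum_univ_three, Real.norm_eq_abs, sq_abs]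
        congr 1
        simp
        linear_combination (x 0 ^ 2 + x 1 ^ 2) * h } rfl

theorem rot_apply (a b : ℝ) (h : a ^ 2 + b ^ 2 = 1) (x : E3) :
    rot a b h x = WithLp.toLp 2 ![a * x 0 - b * x 1, b * x 0 + a * x 1, x 2] := rfl

/-- The exchange of the last two coordinates. -/
def swapIso : E3 ≃ₗᵢ[ℝ] E3 := LinearIsometryEquiv.piLpCongrLeft 2 ℝ ℝ (Equiv.swap 1 2)

theorem swapIso_apply (x : E3) : swapIso x = WithLp.toLp 2 ![x 0, x 2, x 1] := by
  ext j
  simp only [swapIso, LinearIsometryEquiv.piLpCongrLeft_apply]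
  fin_cases j <;> simp [Equiv.piCongrLeft', Equiv.swap_apply_of_ne_of_ne]

theorem ae_coord_ne_zero (i : Fin 3) : ∀ᵐ y : E3, y i ≠ 0 := by
  have h := Measure.addHaar_submodule (volume : Measure E3)
    (LinearMap.ker (EuclideanSpace.proj i : E3 →L[ℝ] ℝ).toLinearMap) (by
      rw [Ne, LinearMap.ker_eq_top]
      intro h0
      have := congrArg (fun L : E3 →ₗ[ℝ] ℝ => L (EuclideanSpace.single i 1)) h0
      simp at this)
  rw [ae_iff]
  convert h using 2
  ext y
  simp

/-! ### The symmetrised kernel -/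

/-- The difference of the kernels at `y` and at its reflection in the plane `x₀ = 0`. -/
def kdiff (x y : E3) : ℝ := ‖x - y‖⁻¹ - ‖x - reflect 0 y‖⁻¹

theorem dist_reflect_comm (i : Fin 3) (x y : E3) : ‖x - reflect i y‖ = ‖y - reflect i x‖ := by
  rw [← norm_reflect i, ← reflIso_apply, map_sub, reflIso_apply, reflIso_apply, reflect_reflect,
    norm_sub_rev]

theorem kdiff_comm (x y : E3) : kdiff x y = kdiff y x := by
  rw [kdiff, kdiff, norm_sub_rev, dist_reflect_comm]

theorem norm_sq_sub_reflect (x y : E3) :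
    ‖x - reflect 0 y‖ ^ 2 = ‖x - y‖ ^ 2 + 4 * (x 0 * y 0) := by
  simp only [EuclideanSpace.norm_sq_eq, Fin.sum_univ_three, Real.norm_eq_abs, sq_abs,
    PiLp.sub_apply, reflect_apply]
  simp
  ring

/-- Two points on the same side of the plane are closer to each other than either is to the mirror
image of the other. -/
theorem kdiff_pos {x y : E3} (h : 0 < x 0 * y 0) (hxy : x ≠ y) : 0 < kdiff x y := by
  have h1 : 0 < ‖x - y‖ := norm_pos_iff.2 (sub_ne_zero.2 hxy)
  have h2 : ‖x - y‖ < ‖x - reflect 0 y‖ := by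
    refine lt_of_pow_lt_pow_left₀ 2 (norm_nonneg _) ?_
    rw [norm_sq_sub_reflect]
    linarith
  exact sub_pos.2 (inv_strictAnti₀ h1 h2)

theorem kdiff_reflect (x y : E3) : kdiff x (reflect 0 y) = -kdiff x y := by
  rw [kdiff, kdiff, reflect_reflect]; ring

theorem kdiff_neg {x y : E3} (h : x 0 * y 0 < 0) (hxy : x ≠ reflect 0 y) : kdiff x y < 0 := by
  have := kdiff_pos (x := x) (y := reflect 0 y) (by simp [reflect_apply]; linarith) hxy
  rw [kdiff_reflect] at this
  linarith

theorem measurable_reflect (i : Fin 3) : Measurable (reflect i) := by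
  have : reflect i = reflIso i := funext fun x => (reflIso_apply i x).symm
  rw [this]
  exact (reflIso i).continuous.measurable

theorem Src.integral_comp_isometry {f : E3 → ℝ} {M : ℝ} (hf : Src f M) (A : E3 ≃ₗᵢ[ℝ] E3)
    {s : ℝ} (hs : s * s = 1) (hA : ∀ y, f (A y) = s * f y) (x : E3) :
    Integrable (fun y => f y * ‖x - A y‖⁻¹) ∧ ∫ y, f y * ‖x - A y‖⁻¹ = s * pot f x := by
  have e : ∀ y, f y * ‖x - A y‖⁻¹ = s * (f (A y) / ‖x - A y‖) := fun y => by
    rw [hA, div_eq_mul_inv, ← mul_assoc, ← mul_assoc, hs, one_mul]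
  simp only [e]
  constructor
  · exact ((A.measurePreserving.integrable_comp_emb A.toHomeomorph.measurableEmbedding).2
      (hf.integrable_pot x).1).const_mul s
  · rw [integral_const_mul]
    congr 1
    exact A.measurePreserving.integral_comp A.toHomeomorph.measurableEmbedding
      (fun y => f y / ‖x - y‖)

/-- Symmetrisation of the potential of a density which is odd in the first coordinate and has
parity `s` in the second one. -/
theorem Src.four_mul_pot {f : E3 → ℝ} {M : ℝ} (hf : Src f M) (h0 : ∀ y, f (reflect 0 y) = -f y)
    {s : ℝ} (hs : s * s = 1) (h1 : ∀ y, f (reflect 1 y) = s * f y) (x : E3) :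
    Integrable (fun y => f y * (kdiff x y + s * kdiff x (reflect 1 y))) ∧
    4 * pot f x = ∫ y, f y * (kdiff x y + s * kdiff x (reflect 1 y)) := by
  -- The potential is written in four ways, one for each element of the group generated by the two
  -- reflections. Added with the signs prescribed by the parities of `f`, they produce the
  -- symmetrised kernel.
  have a0 := hf.integral_comp_isometry (LinearIsometryEquiv.refl ℝ E3) (s := 1) (by norm_num)
    (fun y => by simp) x
  have a1 := hf.integral_comp_isometry (reflIso 0) (s := -1) (by norm_num)
    (fun y => by rw [reflIso_apply, h0]; ring) x
  have a2 := hf.integral_comp_isometry (reflIso 1) hs (fun y => by rw [reflIso_apply, h1]) x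
  have a3 := hf.integral_comp_isometry ((reflIso 1).trans (reflIso 0)) (s := -s) (by linarith)
    (fun y => by simp only [LinearIsometryEquiv.trans_apply, reflIso_apply, h0, h1]; ring) x
  simp only [LinearIsometryEquiv.trans_apply, reflIso_apply, LinearIsometryEquiv.coe_refl, id]
    at a0 a1 a2 a3
  have e : (fun y => f y * (kdiff x y + s * kdiff x (reflect 1 y)))
      = fun y => (f y * ‖x - y‖⁻¹ - f y * ‖x - reflect 0 y‖⁻¹)
        + s * (f y * ‖x - reflect 1 y‖⁻¹ - f y * ‖x - reflect 0 (reflect 1 y)‖⁻¹) := by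
    funext y
    rw [kdiff, kdiff]
    ring
  have i1 := a0.1.sub a1.1
  have i2 := (a2.1.sub a3.1).const_mul s
  refine ⟨by rw [e]; exact i1.add i2, ?_⟩
  rw [e]
  have := integral_add i1 i2
  simp only [Pi.sub_apply] at this
  rw [this, integral_const_mul, integral_sub a0.1 a1.1, integral_sub a2.1 a3.1, a0.2, a1.2, a2.2,
    a3.2]
  linear_combination (-2 * pot f x) * hs

/-! ### Uniqueness for the linearised equation -/

/-- The kernel symmetrised in the first two coordinates, odd in the first one and of parity `s` in
the second one. -/
def ksym (s : ℝ) (x y : E3) : ℝ := kdiff x y + s * kdiff x (reflect 1 y)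

theorem measurable_ksym (s : ℝ) : Measurable fun p : E3 × E3 => ksym s p.1 p.2 := by
  have h0 := measurable_reflect 0
  have h1 := measurable_reflect 1
  unfold ksym kdiff
  fun_prop

theorem ksym_comm (s : ℝ) (x y : E3) : ksym s x y = ksym s y x := by
  have h1 : kdiff x (reflect 1 y) = kdiff y (reflect 1 x) := by
    have e : ‖x - reflect 0 (reflect 1 y)‖ = ‖y - reflect 0 (reflect 1 x)‖ := by
      rw [dist_reflect_comm 0, norm_sub_rev, dist_reflect_comm 1 (reflect 0 x) y,
        reflect_comm 1 0]
    rw [kdiff, kdiff, dist_reflect_comm 1 x y, e]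
  rw [ksym, ksym, kdiff_comm, h1]

/-- The second reflection leaves the first coordinate alone, so both kernel differences have the
sign of `x 0 * y 0`. The modulus of the difference of two nonzero numbers of equal sign is smaller
than that of their sum. -/
theorem abs_ksym_lt {x y : E3} (hx : x 0 ≠ 0) (hy : y 0 ≠ 0) (h1 : x ≠ y) (h2 : x ≠ reflect 0 y)
    (h3 : x ≠ reflect 1 y) (h4 : x ≠ reflect 0 (reflect 1 y)) :
    |ksym (-1) x y| < |ksym 1 x y| ∧ 0 < x 0 * y 0 * ksym 1 x y := by
  have hτ : reflect 1 y 0 = y 0 := by simp [reflect_apply]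
  unfold ksym
  rcases lt_or_gt_of_ne (mul_ne_zero hx hy) with h | h
  · have a := kdiff_neg h h2
    have b := kdiff_neg (y := reflect 1 y) (by rwa [hτ]) h4
    refine ⟨?_, mul_pos_of_neg_of_neg h (by linarith)⟩
    rw [abs_of_neg (a := _ + 1 * _) (by linarith), abs_lt]
    constructor <;> linarith
  · have a := kdiff_pos h h1
    have b := kdiff_pos (y := reflect 1 y) (by rwa [hτ]) h3
    refine ⟨?_, mul_pos h (by linarith)⟩
    rw [abs_of_pos (a := _ + 1 * _) (by linarith), abs_lt]
    constructor <;> linarith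

theorem ae_abs_ksym_lt {y : E3} (hy : y 0 ≠ 0) :
    ∀ᵐ x : E3, x 0 ≠ 0 ∧ |ksym (-1) x y| < |ksym 1 x y| ∧ 0 < x 0 * y 0 * ksym 1 x y := by
  have hne : ∀ a : E3, ∀ᵐ y : E3, y ≠ a := fun a => by simp [ae_iff]
  filter_upwards [ae_coord_ne_zero 0, hne y, hne (reflect 0 y), hne (reflect 1 y),
    hne (reflect 0 (reflect 1 y))] with x h0 h1 h2 h3 h4
  exact ⟨h0, abs_ksym_lt h0 hy h1 h2 h3 h4⟩

theorem Src.integrable {f : E3 → ℝ} {M : ℝ} (hf : Src f M) : Integrable f := by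
  refine (integrable_of_le_maj hf.nonneg 0 0 hf.meas hf.supp fun y _ _ _ _ => ?_).1
  have h1 := kap_nonneg y
  have h2 := kap_nonneg (0 - y)
  exact (hf.bound y).trans (le_mul_of_one_le_right hf.nonneg (by unfold maj; linarith))

open scoped ENNReal in
/-- If a kernel is strictly dominated by another one, for which a positive solution of the adjoint
equation exists, then subsolutions vanish. -/
theorem ae_eq_zero_of_kernel_lt {X : Type*} [MeasurableSpace X] {μ : Measure X} [SFinite μ]
    {α β z p : X → ℝ≥0∞} {K₀ K₁ : X → X → ℝ≥0∞} (hα : Measurable α) (hβ : Measurable β)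
    (hK₀ : Measurable (Function.uncurry K₀)) (hK₁ : Measurable (Function.uncurry K₁))
    (hz : ∀ x, z x ≤ ∫⁻ y, β y * K₀ x y ∂μ) (hp : ∀ᵐ y ∂μ, ∫⁻ x, α x * K₁ x y ∂μ ≤ p y)
    (hzp : ∀ y, β y * p y = α y * z y) (hlt : ∀ᵐ y ∂μ, ∀ᵐ x ∂μ, K₀ x y < K₁ x y)
    (hαt : ∀ x, α x ≠ ∞) (hβt : ∀ x, β x ≠ ∞) (hpt : ∀ x, p x ≠ ∞)
    (hfin : ∫⁻ y, β y * p y ∂μ ≠ ∞) : α =ᵐ[μ] 0 ∨ β =ᵐ[μ] 0 := by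
  have m1 : Measurable fun p : X × X => α p.1 * K₁ p.1 p.2 := (hα.comp measurable_fst).mul hK₁
  have m3 : Measurable fun p : X × X => α p.1 * (β p.2 * K₀ p.1 p.2) :=
    (hα.comp measurable_fst).mul ((hβ.comp measurable_snd).mul hK₀)
  have hle : ∀ᵐ y ∂μ, (fun x => α x * K₀ x y) ≤ᵐ[μ] fun x => α x * K₁ x y := by
    filter_upwards [hlt] with y hy
    filter_upwards [hy] with x hx
    gcongr
  -- Pair each relation with the other weight and exchange the integrals. The outcome opposes the
  -- pointwise inequality of the kernels, so equality holds almost everywhere.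
  have hsum : ∫⁻ y, β y * ∫⁻ x, α x * K₁ x y ∂μ ∂μ ≤ ∫⁻ y, β y * ∫⁻ x, α x * K₀ x y ∂μ ∂μ := by
    calc ∫⁻ y, β y * ∫⁻ x, α x * K₁ x y ∂μ ∂μ ≤ ∫⁻ y, β y * p y ∂μ := by
          refine lintegral_mono_ae ?_
          filter_upwards [hp] with y hy
          gcongr
      _ = ∫⁻ y, α y * z y ∂μ := lintegral_congr hzp
      _ ≤ ∫⁻ x, α x * ∫⁻ y, β y * K₀ x y ∂μ ∂μ := lintegral_mono fun y => by
          gcongr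
          exact hz y
      _ = ∫⁻ x, ∫⁻ y, α x * (β y * K₀ x y) ∂μ ∂μ :=
          lintegral_congr fun x => (lintegral_const_mul _
            (hβ.mul (hK₀.comp measurable_prodMk_left))).symm
      _ = ∫⁻ y, ∫⁻ x, α x * (β y * K₀ x y) ∂μ ∂μ := lintegral_lintegral_swap m3.aemeasurable
      _ = ∫⁻ y, β y * ∫⁻ x, α x * K₀ x y ∂μ ∂μ := by
          refine lintegral_congr fun y => ?_
          have m : Measurable fun x => α x * K₀ x y := hα.mul (hK₀.comp measurable_prodMk_right)
          rw [← lintegral_const_mul _ m]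
          exact lintegral_congr fun x => mul_left_comm _ _ _
  have hJ : (fun y => β y * ∫⁻ x, α x * K₀ x y ∂μ) ≤ᵐ[μ]
      fun y => β y * ∫⁻ x, α x * K₁ x y ∂μ := by
    filter_upwards [hle] with y hy
    gcongr 1
    exact lintegral_mono_ae hy
  have hfin1 : ∫⁻ y, β y * ∫⁻ x, α x * K₁ x y ∂μ ∂μ ≠ ∞ := by
    refine ne_top_of_le_ne_top hfin (lintegral_mono_ae ?_)
    filter_upwards [hp] with y hy
    gcongr
  have heq := ae_eq_of_ae_le_of_lintegral_le hJ (ne_top_of_le_ne_top hfin1 (lintegral_mono_ae hJ))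
    (hβ.mul m1.lintegral_prod_left').aemeasurable hsum
  by_cases hα0 : α =ᵐ[μ] 0
  · exact Or.inl hα0
  · right
    filter_upwards [heq, hp, hle, hlt] with y h1 h2 h3 h4
    by_contra hne
    -- At a single point where `β` does not vanish the two inner integrals agree and are finite;
    -- strict domination of the kernels then leaves only `α = 0`.
    have h5 := (ENNReal.mul_right_inj hne (hβt y)).1 h1
    have h6 : ∫⁻ x, α x * K₀ x y ∂μ ≠ ∞ := h5 ▸ ne_top_of_le_ne_top (hpt y) h2
    have h7 := ae_eq_of_ae_le_of_lintegral_le h3 h6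
      (hα.mul (hK₁.comp measurable_prodMk_right)).aemeasurable h5.ge
    refine hα0 ?_
    filter_upwards [h7, h4] with x h8 h9
    by_contra hαx
    exact h9.ne ((ENNReal.mul_right_inj hαx (hαt x)).1 h8)

theorem Src.ofReal_four_mul_pot_le {q Z : E3 → ℝ} (hq : ∀ y, 0 ≤ q y) {M : ℝ}
    (hZ : Src (fun y => q y * Z y) M) (h0 : ∀ y, q (reflect 0 y) * Z (reflect 0 y) = -(q y * Z y))
    (h1 : ∀ y, q (reflect 1 y) * Z (reflect 1 y) = -(q y * Z y)) (x : E3) :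
    ENNReal.ofReal (4 * |pot (fun y => q y * Z y) x|)
      ≤ ∫⁻ y, ENNReal.ofReal (q y * |Z y|) * ENNReal.ofReal |ksym (-1) x y| := by
  have h := hZ.four_mul_pot h0 (s := -1) (by norm_num) (fun y => by rw [h1]; ring) x
  have h2 : 4 * |pot (fun y => q y * Z y) x| = ‖∫ y, q y * Z y * ksym (-1) x y‖ := by
    unfold ksym
    rw [← h.2, Real.norm_eq_abs, abs_mul, abs_of_pos (by norm_num : (0 : ℝ) < 4)]
  rw [h2, ofReal_norm]
  refine (enorm_integral_le_lintegral_enorm _).trans (le_of_eq (lintegral_congr fun y => ?_))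
  rw [← ofReal_norm, Real.norm_eq_abs, abs_mul, abs_mul, abs_of_nonneg (hq y),
    ENNReal.ofReal_mul (by have := hq y; positivity)]

/-- For fixed `y` the products of `ψ x` with the kernel have one sign in `x`, so taking absolute
values inside the integral loses nothing. For a general odd density only an inequality is available,
and this asymmetry drives the comparison. -/
theorem Src.lintegral_ksym_eq {q ψ : E3 → ℝ} (hq : ∀ y, 0 ≤ q y) {N : ℝ}
    (hψ : Src (fun y => q y * ψ y) N) (hψp : ∀ x, ψ x = pot (fun y => q y * ψ y) x)
    (h0 : ∀ y, q (reflect 0 y) * ψ (reflect 0 y) = -(q y * ψ y))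
    (h1 : ∀ y, q (reflect 1 y) * ψ (reflect 1 y) = q y * ψ y)
    (hpos : ∀ y, y 0 ≠ 0 → 0 < ψ y * y 0) {y : E3} (hy : y 0 ≠ 0) :
    ∫⁻ x, ENNReal.ofReal (q x * |ψ x|) * ENNReal.ofReal |ksym 1 x y|
      = ENNReal.ofReal (4 * |ψ y|) := by
  have h := hψ.four_mul_pot h0 (s := 1) (by norm_num) (fun y => by rw [h1]; ring) y
  rw [← hψp] at h
  have h3 : ∀ᵐ x : E3, q x * |ψ x| * |ksym 1 x y|
      = SignType.sign (y 0) * (q x * ψ x * (kdiff y x + 1 * kdiff y (reflect 1 x))) := by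
    filter_upwards [ae_abs_ksym_lt hy] with x hx
    change _ = _ * (_ * ksym 1 y x)
    rw [ksym_comm 1 y x]
    have hp := hpos x hx.1
    have hk := hx.2.2
    have h5 : 0 < (x 0) ^ 2 * (y 0 * (ψ x * ksym 1 x y)) := by
      have := mul_pos hp hk
      linarith
    have h6 : 0 < y 0 * (ψ x * ksym 1 x y) := pos_of_mul_pos_right h5 (sq_nonneg _)
    rw [mul_assoc, ← abs_mul]
    rcases lt_or_gt_of_ne hy with h | h
    · rw [sign_neg h, abs_of_neg (neg_of_mul_pos_right h6 h.le)]
      simp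
      ring
    · rw [sign_pos h, abs_of_pos (pos_of_mul_pos_right h6 h.le)]
      simp
      ring
  have h4 : ∫ x, q x * |ψ x| * |ksym 1 x y| = 4 * |ψ y| := by
    rw [integral_congr_ae h3, integral_const_mul, ← h.2]
    have hp := hpos y hy
    rcases lt_or_gt_of_ne hy with h | h
    · rw [sign_neg h, abs_of_neg (neg_of_mul_pos_left hp h.le)]
      simp
    · rw [sign_pos h, abs_of_pos (pos_of_mul_pos_left hp h.le)]
      simp
  have hint : Integrable fun x => q x * |ψ x| * |ksym 1 x y| :=
    (integrable_congr h3).2 (h.1.const_mul _)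
  rw [← h4, ofReal_integral_eq_lintegral_ofReal hint (Eventually.of_forall fun x => by
    have := hq x; positivity)]
  refine lintegral_congr fun x => ?_
  rw [ENNReal.ofReal_mul (p := q x * |ψ x|) (by have := hq x; positivity)]

/-- A solution of the linearised equation which is odd in two coordinates vanishes, by comparison
with a solution which is odd in one of them and has a sign. -/
theorem eq_zero_of_odd {q Z ψ : E3 → ℝ} (hq : ∀ y, 0 ≤ q y) (hqm : Measurable q)
    (hZm : Measurable Z) (hψm : Measurable ψ) {M N : ℝ}
    (hZ : Src (fun y => q y * Z y) M) (hψ : Src (fun y => q y * ψ y) N)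
    (hZp : ∀ x, Z x = pot (fun y => q y * Z y) x) (hψp : ∀ x, ψ x = pot (fun y => q y * ψ y) x)
    (hq0 : ∀ y, q (reflect 0 y) = q y) (hq1 : ∀ y, q (reflect 1 y) = q y)
    (hZ0 : ∀ y, Z (reflect 0 y) = -Z y) (hZ1 : ∀ y, Z (reflect 1 y) = -Z y)
    (hψ0 : ∀ y, ψ (reflect 0 y) = -ψ y) (hψ1 : ∀ y, ψ (reflect 1 y) = ψ y)
    (hpos : ∀ y, y 0 ≠ 0 → 0 < ψ y * y 0) (x : E3) : Z x = 0 := by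
  have hαm : Measurable fun x => ENNReal.ofReal (q x * |ψ x|) := by fun_prop
  have hβm : Measurable fun x => ENNReal.ofReal (q x * |Z x|) := by fun_prop
  have hKm : ∀ s, Measurable (Function.uncurry fun x y => ENNReal.ofReal |ksym s x y|) := fun s =>
    ENNReal.measurable_ofReal.comp (measurable_ksym s).abs
  have hψJ : ∀ᵐ y : E3, ∫⁻ x, ENNReal.ofReal (q x * |ψ x|) * ENNReal.ofReal |ksym 1 x y|
      ≤ ENNReal.ofReal (4 * |ψ y|) := by
    filter_upwards [ae_coord_ne_zero 0] with y hy
    exact (hψ.lintegral_ksym_eq hq hψp (fun y => by rw [hq0, hψ0]; ring)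
      (fun y => by rw [hq1, hψ1]) hpos hy).le
  have hZJ : ∀ x, ENNReal.ofReal (4 * |Z x|)
      ≤ ∫⁻ y, ENNReal.ofReal (q y * |Z y|) * ENNReal.ofReal |ksym (-1) x y| := fun x => by
    have := hZ.ofReal_four_mul_pot_le hq (fun y => by rw [hq0, hZ0]; ring)
      (fun y => by rw [hq1, hZ1]; ring) x
    rwa [← hZp] at this
  have hzp : ∀ y, ENNReal.ofReal (q y * |Z y|) * ENNReal.ofReal (4 * |ψ y|)
      = ENNReal.ofReal (q y * |ψ y|) * ENNReal.ofReal (4 * |Z y|) := fun y => by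
    have := hq y
    rw [← ENNReal.ofReal_mul (by positivity), ← ENNReal.ofReal_mul (by positivity)]
    congr 1
    ring
  have hlt : ∀ᵐ y : E3, ∀ᵐ x : E3,
      ENNReal.ofReal |ksym (-1) x y| < ENNReal.ofReal |ksym 1 x y| := by
    filter_upwards [ae_coord_ne_zero 0] with y hy
    filter_upwards [ae_abs_ksym_lt hy] with x hx
    exact (ENNReal.ofReal_lt_ofReal_iff ((abs_nonneg _).trans_lt hx.2.1)).2 hx.2.1
  have hfin : ∫⁻ y, ENNReal.ofReal (q y * |Z y|) * ENNReal.ofReal (4 * |ψ y|) ≠ ⊤ := by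
    have hb : ∀ y, |ψ y| ≤ N * Ck := fun y => by rw [hψp]; exact (hψ.integrable_pot y).2
    have h1 : ∫⁻ y, ENNReal.ofReal (q y * |Z y|) * ENNReal.ofReal (4 * |ψ y|)
        ≤ ∫⁻ y, ENNReal.ofReal (q y * |Z y|) * ENNReal.ofReal (4 * (N * Ck)) := by
      refine lintegral_mono fun y => ?_
      gcongr
      exact hb y
    refine ne_top_of_le_ne_top ?_ h1
    rw [lintegral_mul_const _ hβm]
    refine ENNReal.mul_ne_top ?_ ENNReal.ofReal_ne_top
    have h2 := hZ.integrable.2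
    rw [hasFiniteIntegral_iff_norm] at h2
    have e : ∀ y, ‖q y * Z y‖ = q y * |Z y| := fun y => by
      rw [norm_mul, Real.norm_of_nonneg (hq y), Real.norm_eq_abs]
    simp only [e] at h2
    exact h2.ne
  have key := ae_eq_zero_of_kernel_lt hαm hβm (hKm (-1)) (hKm 1) hZJ hψJ hzp hlt
    (fun _ => ENNReal.ofReal_ne_top) (fun _ => ENNReal.ofReal_ne_top)
    (fun _ => ENNReal.ofReal_ne_top) hfin
  -- Either `q |Z|` vanishes, or `q |ψ|` does; in the second case `q` itself vanishes almost
  -- everywhere, because `ψ ≠ 0` off a plane. Both give a zero density, and `Z` is its potential.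
  have hqZ : ∀ᵐ y : E3, q y * Z y = 0 := by
    rcases key with h | h
    · filter_upwards [h, ae_coord_ne_zero 0] with y h1 h2
      have h3 : q y * |ψ y| ≤ 0 := ENNReal.ofReal_eq_zero.1 h1
      have h4 : 0 < |ψ y| := abs_pos.2 fun h => by
        have := hpos y h2
        rw [h, zero_mul] at this
        exact lt_irrefl _ this
      have h5 : q y = 0 := le_antisymm (nonpos_of_mul_nonpos_left h3 h4) (hq y)
      rw [h5, zero_mul]
    · filter_upwards [h] with y h1
      have h4 : q y * |Z y| ≤ 0 := ENNReal.ofReal_eq_zero.1 h1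
      have h5 : |q y * Z y| ≤ 0 := by rwa [abs_mul, abs_of_nonneg (hq y)]
      exact abs_nonpos_iff.1 h5
  rw [hZp]
  refine integral_eq_zero_of_ae ?_
  filter_upwards [hqZ] with y hy
  rw [hy, zero_div]; rfl

/-! ### Symmetric solutions of the linearised equation are radial, hence zero. -/

section

variable {U ρ : E3 → ℝ} {u r : ℝ → ℝ} {c C : ℝ}

theorem fderiv_zero_of_even {F : E3 → ℝ} (h : ∀ x, F (-x) = F x) : fderiv ℝ F 0 = 0 := by
  have h1 : fderiv ℝ F 0 = -fderiv ℝ F 0 := by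
    have h3 := (ContinuousLinearEquiv.neg ℝ (M := E3)).comp_right_fderiv (f := F) (x := 0)
    have h4 : F ∘ (ContinuousLinearEquiv.neg ℝ (M := E3)) = F := funext h
    rw [h4, map_zero] at h3
    ext v
    nth_rewrite 1 [h3]
    simp
  have h2 : (2 : ℝ) • fderiv ℝ F 0 = 0 := by
    rw [two_smul]; nth_rewrite 1 [h1]; exact neg_add_cancel _
  exact (smul_eq_zero.1 h2).resolve_left two_ne_zero

theorem RadialState.fderiv_U_apply (h : RadialState U ρ u r c C) (x v : E3) :
    fderiv ℝ U x v = deriv u ‖x‖ * (‖x‖⁻¹ * inner ℝ x v) := by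
  rcases eq_or_ne x 0 with rfl | hx
  · rw [fderiv_zero_of_even fun x => by rw [h.U_eq, h.U_eq x, norm_neg]]
    simp
  · rw [(h.fderiv_U hx).fderiv]
    simp

theorem exists_bound_ball {W : E3 → ℝ} (hW : Continuous W) (R : ℝ) :
    ∃ M, 0 ≤ M ∧ ∀ y, ‖y‖ ≤ R → |W y| ≤ M := by
  obtain ⟨M, hM⟩ := (isCompact_closedBall (0 : E3) R).exists_bound_of_continuousOn hW.continuousOn
  exact ⟨max M 0, le_max_right _ _, fun y hy => (hM y (by simpa using hy)).trans (le_max_left _ _)⟩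

/-- Both the rotated solution and its mirror image solve the equation with the same additive
constant, since the weight is radial. Their difference solves the homogeneous equation and is odd in
two coordinates; it is compared with the derivative of `U` along the first axis. -/
theorem RadialState.rotation_invariance (h : RadialState U ρ u r c C) {W : E3 → ℝ}
    (hWc : Continuous W) (hsym : ∀ i x, W (reflect i x) = W x)
    (hW : ∀ x, W x = pot (fun y => qr u r ‖y‖ * W y) x - pot (fun y => qr u r ‖y‖ * W y) 0)
    {a b : ℝ} (hab : a ^ 2 + b ^ 2 = 1) (x : E3) :
    W (rot a b hab x) = W (rot a b hab (reflect 1 x)) := by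
  obtain ⟨M, hM0, hM⟩ := exists_bound_ball hWc 1
  have hsrc := h.src_mul hM0 hWc.aestronglyMeasurable hM
  set V : E3 → ℝ := fun x => W (rot a b hab x) with hV
  have hVc : Continuous V := hWc.comp (rot a b hab).continuous
  have hτc : Continuous (reflect 1) := by
    have : reflect 1 = reflIso 1 := funext fun x => (reflIso_apply 1 x).symm
    rw [this]; exact (reflIso 1).continuous
  have hcomp : ∀ A : E3 ≃ₗᵢ[ℝ] E3, ∀ x, W (A x) = pot (fun y => qr u r ‖y‖ * W (A y)) x
      - pot (fun y => qr u r ‖y‖ * W y) 0 ∧ Src (fun y => qr u r ‖y‖ * W (A y)) (C * M) :=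
    fun A x => by
      have e : (fun y => qr u r ‖y‖ * W (A y)) = fun y => (fun y => qr u r ‖y‖ * W y) (A y) := by
        funext y
        simp only [A.norm_map]
      exact ⟨by rw [e, pot_comp (fun y => qr u r ‖y‖ * W y) A x]; exact hW _, by rw [e]; exact hsrc.comp A⟩
  have hV1 := hcomp (rot a b hab)
  have hV2 : ∀ x, V (reflect 1 x) = pot (fun y => qr u r ‖y‖ * V (reflect 1 y)) x
      - pot (fun y => qr u r ‖y‖ * W y) 0 ∧ Src (fun y => qr u r ‖y‖ * V (reflect 1 y)) (C * M) := by
    intro x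
    have := hcomp ((reflIso 1).trans (rot a b hab)) x
    simpa only [LinearIsometryEquiv.trans_apply, reflIso_apply] using this
  -- The two reflections compose to the half-turn about the third axis, which commutes with every
  -- rotation about it. This is the source of the second oddness.
  have hVττ : ∀ x, V (reflect 1 (reflect 0 x)) = V x := fun x => by
    have e : rot a b hab (reflect 1 (reflect 0 x)) = reflect 1 (reflect 0 (rot a b hab x)) := by
      ext j
      fin_cases j <;> simp [rot_apply, reflect_apply] <;> ring
    simp only [hV, e, hsym]
  have hVσ : ∀ x, V (reflect 0 x) = V (reflect 1 x) := fun x => by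
    rw [← hVττ (reflect 1 x), reflect_comm 0 1, reflect_reflect]
  have hc : Continuous fun y => fderiv ℝ U y e₀ :=
    (h.contDiff_U.continuous_fderiv two_ne_zero).clm_apply continuous_const
  obtain ⟨N, hN0, hN⟩ := exists_bound_ball hc 1
  have key := eq_zero_of_odd (q := fun y => qr u r ‖y‖) (Z := fun x => V x - V (reflect 1 x))
    (ψ := fun y => fderiv ℝ U y e₀) (M := C * M + C * M)
    (fun y => h.qr_nonneg (norm_nonneg y)) ((measurable_qr u r).comp measurable_norm)
    (hVc.sub (hVc.comp hτc)).measurable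
    hc.measurable
    (by
      have := (hV1 0).2.sub (hV2 0).2
      simpa only [mul_sub] using this)
    (h.src_mul hN0 hc.aestronglyMeasurable hN)
    (fun x => by
      have h1 := (hV1 x).2.pot_sub (hV2 x).2 x
      simp only [mul_sub]
      rw [h1, (hV2 x).1]
      have h2 : V x = _ := (hV1 x).1
      rw [h2]
      ring)
    (fun x => h.fderiv_U_eq_pot x e₀)
    (fun y => by rw [norm_reflect]) (fun y => by rw [norm_reflect])
    (fun y => by rw [hVττ, hVσ]; ring) (fun y => by rw [reflect_reflect]; ring)
    (fun y => by
      simp only [h.fderiv_U_apply, norm_reflect, e₀, EuclideanSpace.inner_single_right,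
        reflect_apply]
      simp)
    (fun y => by
      simp only [h.fderiv_U_apply, norm_reflect, e₀, EuclideanSpace.inner_single_right,
        reflect_apply]
      simp)
    (fun y hy => by
      have hy0 : 0 < ‖y‖ := norm_pos_iff.2 fun h0 => hy (by rw [h0]; rfl)
      have h1 := h.deriv_pos _ hy0
      simp only [h.fderiv_U_apply, e₀, EuclideanSpace.inner_single_right]
      simp only [one_mul, conj_trivial]
      have : 0 < deriv u ‖y‖ * ‖y‖⁻¹ * (y 0 * y 0) :=
        mul_pos (mul_pos h1 (inv_pos.2 hy0)) (mul_self_pos.2 hy)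
      linarith) x
  exact sub_eq_zero.1 key

/-- Write a point at azimuth `2t` as the rotation by `t` of a point at azimuth `t`. The mirror image
of the latter has azimuth `-t` and is rotated to azimuth `0`. -/
theorem eq_of_rotation_invariance {W : E3 → ℝ}
    (hrot : ∀ a b (hab : a ^ 2 + b ^ 2 = 1) x, W (rot a b hab x) = W (rot a b hab (reflect 1 x)))
    (x : E3) : W x = W (WithLp.toLp 2 ![√(x 0 ^ 2 + x 1 ^ 2), 0, x 2]) := by
  set z : ℂ := ⟨x 0, x 1⟩ with hz
  have hp : ‖z‖ = √(x 0 ^ 2 + x 1 ^ 2) := by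
    rw [Complex.norm_def, Complex.normSq_mk]; congr 1; ring
  have hc : ‖z‖ * Real.cos z.arg = x 0 := Complex.norm_mul_cos_arg z
  have hs : ‖z‖ * Real.sin z.arg = x 1 := Complex.norm_mul_sin_arg z
  set t := z.arg / 2 with ht
  have hcs : Real.cos t ^ 2 + Real.sin t ^ 2 = 1 := Real.cos_sq_add_sin_sq t
  have h2 : z.arg = 2 * t := by rw [ht]; ring
  rw [h2, Real.cos_two_mul] at hc
  rw [h2, Real.sin_two_mul] at hs
  have h := hrot (Real.cos t) (Real.sin t) hcs
    (WithLp.toLp 2 ![‖z‖ * Real.cos t, ‖z‖ * Real.sin t, x 2])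
  rw [← hp]
  convert h using 2
  · ext j
    fin_cases j
    · simp [rot_apply]
      linear_combination -hc + ‖z‖ * hcs
    · simp [rot_apply]
      linear_combination -hs
    · simp [rot_apply]
  · ext j
    fin_cases j
    · simp [rot_apply, reflect_apply]
      linear_combination -‖z‖ * hcs
    · simp [rot_apply, reflect_apply]
      ring
    · simp [rot_apply, reflect_apply]

/-- Exchanging the last two coordinates preserves the assumptions, so `W` is invariant about two
different axes; together these rotations carry every point to the first axis. -/
theorem RadialState.eq_radial (h : RadialState U ρ u r c C) {W : E3 → ℝ}
    (hWc : Continuous W) (hsym : ∀ i x, W (reflect i x) = W x)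
    (hW : ∀ x, W x = pot (fun y => qr u r ‖y‖ * W y) x - pot (fun y => qr u r ‖y‖ * W y) 0)
    (x : E3) : W x = W (‖x‖ • e₀) := by
  have h1 := eq_of_rotation_invariance (W := W) (fun a b hab x =>
    h.rotation_invariance hWc hsym hW hab x) x
  have h2 := eq_of_rotation_invariance (W := fun x => W (swapIso x)) (fun a b hab x =>
    h.rotation_invariance (W := fun x => W (swapIso x)) (hWc.comp swapIso.continuous) (fun i x => by
      have : ∃ j, swapIso (reflect i x) = reflect j (swapIso x) := by
        fin_cases i
        · refine ⟨0, ?_⟩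
          ext k; fin_cases k <;> simp [swapIso_apply, reflect_apply]
        · refine ⟨2, ?_⟩
          ext k; fin_cases k <;> simp [swapIso_apply, reflect_apply]
        · refine ⟨1, ?_⟩
          ext k; fin_cases k <;> simp [swapIso_apply, reflect_apply]
      obtain ⟨j, hj⟩ := this
      rw [hj, hsym]) (fun x => by
      have e : (fun y => qr u r ‖y‖ * W (swapIso y))
          = fun y => (fun y => qr u r ‖y‖ * W y) (swapIso y) := by
        funext y
        simp only [swapIso.norm_map]
      rw [e, pot_comp (fun y => qr u r ‖y‖ * W y) swapIso x,
        pot_comp (fun y => qr u r ‖y‖ * W y) swapIso 0, map_zero]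
      exact hW _) hab x)
    (WithLp.toLp 2 ![√(x 0 ^ 2 + x 1 ^ 2), x 2, 0])
  have e1 : swapIso (WithLp.toLp 2 ![√(x 0 ^ 2 + x 1 ^ 2), x 2, 0])
      = WithLp.toLp 2 ![√(x 0 ^ 2 + x 1 ^ 2), 0, x 2] := by
    rw [swapIso_apply]; simp
  have e2 : √(√(x 0 ^ 2 + x 1 ^ 2) ^ 2 + x 2 ^ 2) = ‖x‖ := by
    rw [Real.sq_sqrt (by positivity), EuclideanSpace.norm_eq]
    simp [Fin.sum_univ_three]
  have e3 : swapIso (WithLp.toLp 2 ![‖x‖, 0, 0]) = ‖x‖ • e₀ := by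
    rw [swapIso_apply]
    ext j
    fin_cases j <;> simp [e₀]
  simp only [Matrix.cons_val_zero, Matrix.cons_val_one, Matrix.cons_val, e1, e2, e3] at h2
  rw [h1, h2]

theorem eq_zero_of_le_integral {w : ℝ → ℝ} (hw : Continuous w) {K T : ℝ}
    (h : ∀ s ∈ Icc 0 T, |w s| ≤ K * ∫ t in (0 : ℝ)..s, |w t|) {s : ℝ} (hs : s ∈ Icc 0 T) :
    w s = 0 := by
  have hd : ∀ s, HasDerivAt (fun s => ∫ t in (0 : ℝ)..s, |w t|) |w s| s := fun s =>
    intervalIntegral.integral_hasDerivAt_right (hw.abs.intervalIntegrable _ _)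
      (hw.abs.stronglyMeasurableAtFilter _ _) hw.abs.continuousAt
  have h1 := norm_le_gronwallBound_of_norm_deriv_right_le
    (f := fun s => ∫ t in (0 : ℝ)..s, |w t|) (f' := fun s => |w s|) (δ := 0) (K := K) (ε := 0)
    (a := 0) (b := T) (fun s _ => (hd s).continuousAt.continuousWithinAt)
    (fun s _ => (hd s).hasDerivWithinAt) (by simp) (fun s hs => by
      rw [Real.norm_eq_abs, abs_abs, add_zero,
        Real.norm_of_nonneg (intervalIntegral.integral_nonneg hs.1 fun t _ => abs_nonneg _)]
      exact h s ⟨hs.1, hs.2.le⟩) s hs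
  rw [gronwallBound_ε0_δ0] at h1
  have h2 : ∫ t in (0 : ℝ)..s, |w t| = 0 := norm_le_zero_iff.1 h1
  have h3 := h s hs
  rw [h2, mul_zero] at h3
  exact abs_nonpos_iff.1 h3

/-- The linearised equation has no nontrivial solution with the reflection symmetries. -/
theorem RadialState.eq_zero_of_linearized (h : RadialState U ρ u r c C) {W : E3 → ℝ}
    (hWc : Continuous W) (hsym : ∀ i x, W (reflect i x) = W x)
    (hW : ∀ x, W x = pot (fun y => qr u r ‖y‖ * W y) x - pot (fun y => qr u r ‖y‖ * W y) 0)
    (x : E3) : W x = 0 := by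
  have hrad := h.eq_radial hWc hsym hW
  set w : ℝ → ℝ := profile W with hw
  have hwc : Continuous w := hWc.comp (by fun_prop)
  have hWw : ∀ x, W x = w ‖x‖ := hrad
  obtain ⟨M, hM0, hM⟩ := exists_bound_ball hWc 1
  have hsrc := h.src_mul hM0 hWc.aestronglyMeasurable hM
  have e : (fun y => qr u r ‖y‖ * W y) = fun y : E3 => (fun s => qr u r s * w s) ‖y‖ :=
    funext fun y => by rw [hWw]
  rw [e] at hsrc hW
  have hN := pot_radial_sub (f := fun s => qr u r s * w s) ((measurable_qr u r).mul hwc.measurable) hsrc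
  have hpi := Real.pi_pos
  have hC := h.C_nonneg
  rw [hWw]
  refine eq_zero_of_le_integral hwc (K := 4 * Real.pi * C * ‖x‖) (T := ‖x‖) (fun s hs => ?_)
    ⟨norm_nonneg x, le_rfl⟩
  have h1 := hW (s • e₀)
  rw [hN, norm_smul_e₀, abs_of_nonneg hs.1] at h1
  change w s = _ at h1
  rw [h1, ← Real.norm_eq_abs, ← intervalIntegral.integral_const_mul]
  refine intervalIntegral.norm_integral_le_of_norm_le hs.1 (Eventually.of_forall fun t ht => ?_)
    ((continuous_const.mul hwc.abs).intervalIntegrable _ _)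
  have hs0 : 0 < s := ht.1.trans_le ht.2
  -- The kernel of the radial equation lives on `t ≤ s` and is bounded there: the equation is of
  -- Volterra type, and Gronwall's inequality applies.
  have h2 : |t ^ 2 * s⁻¹ - t| ≤ ‖x‖ := by
    have : t ^ 2 * s⁻¹ - t = -(t * ((s - t) * s⁻¹)) := by field_simp; ring
    rw [this, abs_neg, abs_of_nonneg (mul_nonneg ht.1.le
      (mul_nonneg (by linarith [ht.2]) (by positivity)))]
    have h3 : (s - t) * s⁻¹ ≤ 1 := by
      rw [← div_eq_mul_inv, div_le_one hs0]; linarith [ht.1]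
    calc t * ((s - t) * s⁻¹) ≤ t * 1 := by gcongr; exact ht.1.le
      _ ≤ ‖x‖ := by linarith [ht.2, hs.2]
  rw [Real.norm_eq_abs, abs_mul, abs_mul (4 * Real.pi), abs_mul (qr u r t),
    abs_of_nonneg (h.qr_nonneg ht.1.le), abs_of_nonneg (by positivity : 0 ≤ 4 * Real.pi)]
  calc 4 * Real.pi * (qr u r t * |w t|) * |t ^ 2 * s⁻¹ - t|
      ≤ 4 * Real.pi * (C * |w t|) * ‖x‖ := by
        gcongr
        exact h.qr_le ht.1.le
    _ = _ := by ring

end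

/-! ### Uniform radial limits -/

section RadLim

set_option linter.unusedSectionVars false

variable {V W Z : Type*} [NormedAddCommGroup V] [NormedSpace ℝ V] [NormedAddCommGroup W]
  [NormedSpace ℝ W] [NormedAddCommGroup Z] [NormedSpace ℝ Z]

/-- Near the origin `F` is asymptotic to a bounded function which is homogeneous of degree `0`. -/
def RadLim (F : E3 → V) : Prop :=
  ∃ G : E3 → V, (∀ t : ℝ, 0 < t → ∀ x, G (t • x) = G x) ∧ (∃ C, ∀ x, ‖G x‖ ≤ C) ∧
    Tendsto (fun x => F x - G x) (𝓝[≠] 0) (𝓝 0)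

theorem RadLim.congr {F F' : E3 → V} (h : RadLim F) (he : F =ᶠ[𝓝[≠] 0] F') : RadLim F' := by
  obtain ⟨G, h1, h2, h3⟩ := h
  refine ⟨G, h1, h2, h3.congr' ?_⟩
  filter_upwards [he] with x hx
  rw [hx]

theorem RadLim.of_tendsto {F : E3 → V} {a : V} (h : Tendsto F (𝓝[≠] 0) (𝓝 a)) : RadLim F :=
  ⟨fun _ => a, fun _ _ _ => rfl, ⟨‖a‖, fun _ => le_rfl⟩, by
    simpa using h.sub_const a⟩

theorem RadLim.add {F H : E3 → V} (hF : RadLim F) (hH : RadLim H) :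
    RadLim (fun x => F x + H x) := by
  obtain ⟨G, h1, ⟨C, h2⟩, h3⟩ := hF
  obtain ⟨K, k1, ⟨D, k2⟩, k3⟩ := hH
  refine ⟨fun x => G x + K x, fun t ht x => by simp only [h1 t ht, k1 t ht],
    ⟨C + D, fun x => (norm_add_le _ _).trans (add_le_add (h2 x) (k2 x))⟩, ?_⟩
  have := h3.add k3
  rw [add_zero] at this
  exact this.congr fun x => (add_sub_add_comm _ _ _ _).symm

theorem RadLim.bilin {F : E3 → V} {H : E3 → W} (B : V →L[ℝ] W →L[ℝ] Z) (hF : RadLim F)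
    (hH : RadLim H) : RadLim (fun x => B (F x) (H x)) := by
  obtain ⟨G, h1, ⟨C, h2⟩, h3⟩ := hF
  obtain ⟨K, k1, ⟨D, k2⟩, k3⟩ := hH
  have hC : 0 ≤ C := (norm_nonneg _).trans (h2 0)
  refine ⟨fun x => B (G x) (K x), fun t ht x => by simp only [h1 t ht, k1 t ht],
    ⟨‖B‖ * C * D, fun x => (B.le_opNorm₂ _ _).trans ?_⟩, ?_⟩
  · gcongr
    exacts [h2 x, k2 x]
  · have hlim : Tendsto (fun x => ‖B‖ * ‖F x - G x‖ * (‖H x - K x‖ + D)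
        + ‖B‖ * C * ‖H x - K x‖) (𝓝[≠] 0) (𝓝 0) := by
      have := ((h3.norm.const_mul ‖B‖).mul (k3.norm.add_const D)).add
        (k3.norm.const_mul (‖B‖ * C))
      simpa using this
    refine squeeze_zero_norm (fun x => ?_) hlim
    have e : B (F x) (H x) - B (G x) (K x) = B (F x - G x) ((H x - K x) + K x)
        + B (G x) (H x - K x) := by
      simp only [map_sub, map_add, _root_.sub_apply]
      abel
    rw [e]
    refine (norm_add_le _ _).trans (add_le_add ((B.le_opNorm₂ _ _).trans ?_)
      ((B.le_opNorm₂ _ _).trans ?_))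
    · gcongr
      exact (norm_add_le _ _).trans (add_le_add le_rfl (k2 x))
    · gcongr
      exact h2 x

theorem RadLim.smul {F : E3 → ℝ} {H : E3 → V} (hF : RadLim F) (hH : RadLim H) :
    RadLim (fun x => F x • H x) :=
  hF.bilin (ContinuousLinearMap.lsmul ℝ ℝ) hH

theorem RadLim.mul {F H : E3 → ℝ} (hF : RadLim F) (hH : RadLim H) : RadLim (fun x => F x * H x) :=
  hF.smul hH

theorem RadLim.clm {F : E3 → V} (A : V →L[ℝ] W) (hF : RadLim F) : RadLim (fun x => A (F x)) := by
  have h : RadLim (fun _ : E3 => A) := .of_tendsto tendsto_const_nhds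
  exact h.bilin (ContinuousLinearMap.id ℝ (V →L[ℝ] W)) hF

theorem RadLim.neg {F : E3 → V} (hF : RadLim F) : RadLim (fun x => -F x) :=
  hF.clm (-ContinuousLinearMap.id ℝ V)

theorem radLim_dir : RadLim (fun x : E3 => ‖x‖⁻¹ • x) := by
  refine ⟨fun x => ‖x‖⁻¹ • x, fun t ht x => ?_, ⟨1, fun x => ?_⟩, by simp⟩
  · beta_reduce
    rw [norm_smul, Real.norm_of_nonneg ht.le, mul_inv, smul_smul, mul_right_comm,
      inv_mul_cancel₀ ht.ne', one_mul]
  · rw [norm_smul, norm_inv, norm_norm]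
    exact inv_mul_le_one

/-- The limit on the unit sphere is extended by homogeneity of degree `0`. In this form the limits
are stable under sums and bilinear operations, so membership in `X` and `Y` can be checked term by
term. -/
theorem radLim_of_tendstoUniformlyOn {F G : E3 → V} {C : ℝ} (hb : ∀ x ∈ B4', ‖F x‖ ≤ C)
    (h : TendstoUniformlyOn (fun (t : ℝ) (x : E3) => F (t • x)) G (𝓝[>] 0)
      (Metric.sphere (0 : E3) 1)) : RadLim F := by
  have hdir : ∀ x : E3, x ≠ 0 → ‖x‖⁻¹ • x ∈ Metric.sphere (0 : E3) 1 := fun x hx => by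
    rw [mem_sphere_zero_iff_norm, norm_smul, norm_inv, norm_norm,
      inv_mul_cancel₀ (norm_ne_zero_iff.2 hx)]
  have hG : ∀ x ∈ Metric.sphere (0 : E3) 1, ‖G x‖ ≤ C := fun x hx => by
    refine le_of_tendsto (h.tendsto_at hx).norm ?_
    filter_upwards [eventually_Ioo] with t ht
    exact hb _ (ray_mem hx ht)
  classical
  refine ⟨fun x => if x = 0 then 0 else G (‖x‖⁻¹ • x), fun t ht x => ?_, ⟨max C 0, fun x => ?_⟩, ?_⟩
  · by_cases hx : x = 0
    · simp [hx]
    · simp only [smul_eq_zero, ht.ne', hx, or_self, if_false]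
      rw [norm_smul, Real.norm_of_nonneg ht.le, mul_inv, smul_smul, mul_right_comm,
        inv_mul_cancel₀ ht.ne', one_mul]
  · dsimp only
    split_ifs with hx
    · simp
    · exact (hG _ (hdir x hx)).trans (le_max_left _ _)
  · rw [Metric.tendsto_nhds]
    intro ε hε
    rw [Metric.tendstoUniformlyOn_iff] at h
    obtain ⟨δ, hδ, hd⟩ := mem_nhdsGT_iff_exists_Ioo_subset.1 (h ε hε)
    have hδ' : (0 : ℝ) < δ := hδ
    filter_upwards [self_mem_nhdsWithin, mem_nhdsWithin_of_mem_nhds (Metric.ball_mem_nhds 0 hδ')]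
      with x hx hxδ
    have hx0 : x ≠ 0 := hx
    have := hd ⟨norm_pos_iff.2 hx0, by simpa using hxδ⟩ _ (hdir x hx0)
    rw [smul_smul, mul_inv_cancel₀ (norm_ne_zero_iff.2 hx0), one_smul, dist_comm] at this
    simpa [hx0, dist_eq_norm] using this

theorem RadLim.exists_tendstoUniformlyOn {F : E3 → V} (h : RadLim F) :
    ∃ G : E3 → V, TendstoUniformlyOn (fun (t : ℝ) (x : E3) => F (t • x)) G (𝓝[>] 0)
      (Metric.sphere (0 : E3) 1) := by
  obtain ⟨G, h1, -, h3⟩ := h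
  refine ⟨G, ?_⟩
  rw [Metric.tendstoUniformlyOn_iff]
  intro ε hε
  rw [Metric.tendsto_nhds] at h3
  obtain ⟨δ, hδ, hd⟩ := Metric.mem_nhdsWithin_iff.1 (h3 ε hε)
  filter_upwards [Ioo_mem_nhdsGT hδ] with t ht x hx
  have hx1 : ‖x‖ = 1 := by simpa using hx
  have hx0 : x ≠ 0 := norm_ne_zero_iff.1 (by rw [hx1]; exact one_ne_zero)
  have := hd (show t • x ∈ _ from ⟨by
    rw [mem_ball_zero_iff, norm_smul, hx1, mul_one, Real.norm_of_nonneg ht.1.le]; exact ht.2,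
    smul_ne_zero ht.1.ne' hx0⟩)
  rw [mem_ofPred_eq, h1 t ht.1] at this
  rw [dist_comm]
  simpa [dist_eq_norm] using this

end RadLim

/-! ### Integration along rays and membership criteria. -/

theorem hasDerivAt_ray {F : E3 → ℝ} {D : E3 → (E3 →L[ℝ] ℝ)}
    (hd : ∀ x ∈ B4', HasFDerivWithinAt F (D x) (B 4) x) {x : E3} (hx : x ≠ 0) {t : ℝ} (ht : 0 < t)
    (htx : t * ‖x‖ < 4) : HasDerivAt (fun t : ℝ => F (t • x)) (D (t • x) x) t := by
  have hn : ‖t • x‖ < 4 := by rwa [norm_smul, Real.norm_of_nonneg ht.le]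
  have h1 := hd (t • x) ⟨mem_closedBall_zero_iff.2 hn.le, smul_ne_zero ht.ne' hx⟩
  have h2 := h1.hasFDerivAt (mem_of_superset (Metric.isOpen_ball.mem_nhds (mem_ball_zero_iff.2 hn))
    Metric.ball_subset_closedBall)
  have h3 : HasDerivAt (fun t : ℝ => t • x) x t := by simpa using (hasDerivAt_id t).smul_const x
  exact h2.comp_hasDerivAt t h3

theorem continuousOn_ray {F : E3 → ℝ} (hc : ContinuousOn F (B 4)) (x : E3) {T : ℝ}
    (hT : T * ‖x‖ ≤ 4) : ContinuousOn (fun t : ℝ => F (t • x)) (Icc 0 T) := by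
  refine hc.comp (by fun_prop) fun t ht => ?_
  rw [mem_closedBall_zero_iff, norm_smul, Real.norm_of_nonneg ht.1]
  exact (mul_le_mul_of_nonneg_right ht.2 (norm_nonneg x)).trans hT

theorem exists_eq_ray {F : E3 → ℝ} {D : E3 → (E3 →L[ℝ] ℝ)} (hc : ContinuousOn F (B 4))
    (h0 : F 0 = 0) (hd : ∀ x ∈ B4', HasFDerivWithinAt F (D x) (B 4) x) {x : E3} (hx : x ∈ B4') :
    ∃ t ∈ Ioo (0 : ℝ) 1, F x = D (t • x) x := by
  have hxn : ‖x‖ ≤ 4 := mem_closedBall_zero_iff.1 hx.1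
  have hx0 : 0 < ‖x‖ := norm_pos_iff.2 hx.2
  obtain ⟨t, ht, h⟩ := exists_hasDerivAt_eq_slope (fun t : ℝ => F (t • x)) (fun t => D (t • x) x)
    one_pos (continuousOn_ray hc x (by rwa [one_mul]))
    (fun t ht => hasDerivAt_ray hd hx.2 ht.1 (by nlinarith [ht.2]))
  refine ⟨t, ht, ?_⟩
  rw [h]
  simp [h0]

/-- If the gradient behaves like `|x|^k G`, then integration along the ray gives `|x|^(k+1)
G(n)/(k+1)`, with `n` the direction. The cases `k = 0` and `k = 1` serve `X` and `Y`. -/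
theorem RadLim.integral {F : E3 → ℝ} {D : E3 → (E3 →L[ℝ] ℝ)} (hc : ContinuousOn F (B 4))
    (h0 : F 0 = 0) (hd : ∀ x ∈ B4', HasFDerivWithinAt F (D x) (B 4) x) (k : ℕ)
    (h : RadLim (fun x => (‖x‖ ^ k)⁻¹ • D x)) : RadLim (fun x => (‖x‖ ^ (k + 1))⁻¹ * F x) := by
  obtain ⟨G, h1, ⟨C, h2⟩, h3⟩ := h
  have hC : 0 ≤ C := (norm_nonneg _).trans (h2 0)
  have hk : (0 : ℝ) < (k : ℝ) + 1 := by positivity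
  refine ⟨fun x => ((k : ℝ) + 1)⁻¹ * G x (‖x‖⁻¹ • x), fun t ht x => ?_,
    ⟨((k : ℝ) + 1)⁻¹ * C, fun x => ?_⟩, ?_⟩
  · beta_reduce
    rw [h1 t ht, norm_smul, Real.norm_of_nonneg ht.le, mul_inv, smul_smul, mul_right_comm,
      inv_mul_cancel₀ ht.ne', one_mul]
  · rw [norm_mul, Real.norm_of_nonneg (by positivity)]
    gcongr
    refine ((G x).le_opNorm _).trans ?_
    have : ‖‖x‖⁻¹ • x‖ ≤ 1 := by
      rw [norm_smul, norm_inv, norm_norm]; exact inv_mul_le_one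
    calc ‖G x‖ * ‖‖x‖⁻¹ • x‖ ≤ C * 1 := by gcongr; exact h2 x
      _ = C := mul_one C
  · rw [Metric.tendsto_nhds] at h3 ⊢
    intro ε hε
    obtain ⟨δ, hδ, hδd⟩ := Metric.mem_nhdsWithin_iff.1 (h3 (ε / 2) (half_pos hε))
    filter_upwards [self_mem_nhdsWithin, mem_nhdsWithin_of_mem_nhds
      (Metric.ball_mem_nhds (0 : E3) (lt_min hδ four_pos))] with x hx hxδ
    have hx0 : x ≠ 0 := hx
    have hxp : 0 < ‖x‖ := norm_pos_iff.2 hx0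
    have hxm : ‖x‖ < min δ 4 := by simpa using hxδ
    have hx4 : ‖x‖ < 4 := hxm.trans_le (min_le_right _ _)
    set n : E3 := ‖x‖⁻¹ • x with hn
    have hn1 : ‖n‖ = 1 := by rw [hn, norm_smul, norm_inv, norm_norm, inv_mul_cancel₀ hxp.ne']
    have hn0 : n ≠ 0 := norm_ne_zero_iff.1 (by rw [hn1]; exact one_ne_zero)
    have hxn : ‖x‖ • n = x := by rw [hn, smul_smul, mul_inv_cancel₀ hxp.ne', one_smul]
    -- The mean value theorem is applied after subtraction of the expected leading term, so that
    -- only the small error of the gradient is evaluated at the unknown intermediate point.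
    obtain ⟨s, hs, hsl⟩ := exists_hasDerivAt_eq_slope
      (fun t : ℝ => F (t • n) - t ^ (k + 1) * (((k : ℝ) + 1)⁻¹ * G x n))
      (fun t => D (t • n) n - t ^ k * G x n) hxp
      ((continuousOn_ray hc n (by rw [hn1, mul_one]; exact hx4.le)).sub (by fun_prop))
      (fun t ht => by
        refine ((hasDerivAt_ray hd hn0 ht.1 (by rw [hn1, mul_one]; linarith [ht.2])).sub
          ((hasDerivAt_pow (k + 1) t).mul_const _)).congr_deriv ?_
        push_cast
        field_simp)
    simp only [hxn, zero_smul, h0, sub_zero, ne_eq, Nat.add_eq_zero_iff, one_ne_zero, and_false,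
      not_false_eq_true, zero_pow, zero_mul] at hsl
    rw [eq_div_iff hxp.ne'] at hsl
    have hsδ : s < δ := hs.2.trans (hxm.trans_le (min_le_left _ _))
    have hb := hδd (show s • n ∈ _ from ⟨by
      rw [mem_ball_zero_iff, norm_smul, hn1, mul_one, Real.norm_of_nonneg hs.1.le]; exact hsδ,
      smul_ne_zero hs.1.ne' hn0⟩)
    have hGs : G (s • n) = G x := by
      rw [h1 s hs.1, hn, h1 _ (inv_pos.2 hxp)]
    rw [mem_ofPred_eq, dist_zero_right] at hb
    beta_reduce at hb
    rw [norm_smul s n, hn1, mul_one, Real.norm_of_nonneg hs.1.le,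
      hGs] at hb
    have hsk : 0 < s ^ k := pow_pos hs.1 k
    have e : D (s • n) n - s ^ k * G x n = s ^ k * (((s ^ k)⁻¹ • D (s • n) - G x) n) := by
      simp only [_root_.sub_apply, _root_.smul_apply, smul_eq_mul]
      field_simp
    have hle : |D (s • n) n - s ^ k * G x n| ≤ ‖x‖ ^ k * (ε / 2) := by
      rw [e, abs_mul, abs_of_pos hsk]
      have h4 := (((s ^ k)⁻¹ • D (s • n) - G x).le_opNorm n)
      rw [hn1, mul_one, Real.norm_eq_abs] at h4
      exact mul_le_mul (pow_le_pow_left₀ hs.1.le hs.2.le k) (h4.trans hb.le) (abs_nonneg _)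
        (by positivity)
    have hxk : (0 : ℝ) < ‖x‖ ^ (k + 1) := by positivity
    rw [dist_zero_right, Real.norm_eq_abs]
    have e2 : (‖x‖ ^ (k + 1))⁻¹ * F x - ((k : ℝ) + 1)⁻¹ * G x n
        = (‖x‖ ^ (k + 1))⁻¹ * ((D (s • n) n - s ^ k * G x n) * ‖x‖) := by
      rw [hsl]; field_simp
    rw [e2, abs_mul, abs_mul, abs_of_pos (inv_pos.2 hxk), abs_of_pos hxp]
    calc (‖x‖ ^ (k + 1))⁻¹ * (|D (s • n) n - s ^ k * G x n| * ‖x‖)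
        ≤ (‖x‖ ^ (k + 1))⁻¹ * (‖x‖ ^ k * (ε / 2) * ‖x‖) := by gcongr
      _ = ε / 2 := by rw [pow_succ]; field_simp
      _ < ε := half_lt_self hε

theorem mem_B {x : E3} {R : ℝ} : x ∈ B R ↔ ‖x‖ ≤ R := mem_closedBall_zero_iff

theorem reflect_mem_B {x : E3} {R : ℝ} {i : Fin 3} : reflect i x ∈ B R ↔ x ∈ B R := by
  rw [mem_B, mem_B, norm_reflect]

theorem zero_mem_B4 : (0 : E3) ∈ B 4 := by rw [mem_B, norm_zero]; norm_num

theorem B4'_mem_nhdsWithin {x : E3} (hx : x ∈ B4') : B4' ∈ 𝓝[B 4] x :=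
  inter_mem self_mem_nhdsWithin
    (mem_nhdsWithin_of_mem_nhds (isOpen_compl_singleton.mem_nhds hx.2))

theorem grad_eq {F : E3 → ℝ} {x : E3} {D : E3 →L[ℝ] ℝ} (hx : x ∈ B 4)
    (h : HasFDerivWithinAt F D (B 4) x) : grad F x = D :=
  h.fderivWithin (uniqueDiff_B4 x hx)

theorem uniqueDiff_B4' : UniqueDiffOn ℝ B4' := uniqueDiff_B4.inter isOpen_compl_singleton

theorem eventually_mem_B4' : ∀ᶠ x in 𝓝[≠] (0 : E3), x ∈ B4' := by
  filter_upwards [self_mem_nhdsWithin,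
    mem_nhdsWithin_of_mem_nhds (Metric.closedBall_mem_nhds (0 : E3) four_pos)] with x h1 h2
  exact ⟨h2, h1⟩

theorem hasFDerivWithinAt_zero_of_sq {F : E3 → ℝ} {C : ℝ} (h : ∀ x ∈ B 4, |F x| ≤ C * ‖x‖ ^ 2) :
    HasFDerivWithinAt F (0 : E3 →L[ℝ] ℝ) (B 4) 0 := by
  have hF0 : F 0 = 0 := by
    have := h 0 zero_mem_B4
    rw [norm_zero] at this
    exact abs_nonpos_iff.1 (by simpa using this)
  refine HasFDerivWithinAt.of_isLittleO ?_
  simp only [hF0, sub_zero, _root_.zero_apply]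
  refine Asymptotics.IsBigO.trans_isLittleO (g := fun x : E3 => ‖x‖ ^ 2)
    (Asymptotics.IsBigO.of_bound C ?_) ?_
  · filter_upwards [self_mem_nhdsWithin] with x hx
    rw [Real.norm_eq_abs, Real.norm_of_nonneg (by positivity)]
    exact h x hx
  · exact (Asymptotics.isLittleO_norm_pow_id one_lt_two).mono nhdsWithin_le_nhds

/-- A criterion for membership in `Y`. -/
theorem memY_of_hasFDerivWithinAt {F : E3 → ℝ} {D : E3 → (E3 →L[ℝ] ℝ)} {C : ℝ} (hF : MemCS F)
    (h0 : F 0 = 0) (hd : ∀ x ∈ B4', HasFDerivWithinAt F (D x) (B 4) x) (hDc : ContinuousOn D B4')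
    (hb : ∀ x ∈ B4', ‖D x‖ ≤ C * ‖x‖) (hr : RadLim (fun x => ‖x‖⁻¹ • D x)) : MemY F := by
  have hC : 0 ≤ C := by
    have he : e₀ ∈ B4' := ⟨by rw [mem_B, norm_e₀]; norm_num,
      norm_ne_zero_iff.1 (by rw [norm_e₀]; exact one_ne_zero)⟩
    have := hb e₀ he
    rw [norm_e₀, mul_one] at this
    exact (norm_nonneg _).trans this
  have hsq : ∀ x ∈ B 4, |F x| ≤ C * ‖x‖ ^ 2 := fun x hx => by
    rcases eq_or_ne x 0 with rfl | hx0
    · simp [h0]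
    · obtain ⟨t, ht, h⟩ := exists_eq_ray hF.continuousOn h0 hd ⟨hx, hx0⟩
      have htx : ‖t • x‖ ≤ ‖x‖ := by
        rw [norm_smul, Real.norm_of_nonneg ht.1.le]
        exact mul_le_of_le_one_left (norm_nonneg _) ht.2.le
      have hm : t • x ∈ B4' := ⟨mem_B.2 (htx.trans (mem_B.1 hx)), smul_ne_zero ht.1.ne' hx0⟩
      rw [h, ← Real.norm_eq_abs]
      calc ‖D (t • x) x‖ ≤ ‖D (t • x)‖ * ‖x‖ := (D (t • x)).le_opNorm x
        _ ≤ C * ‖x‖ * ‖x‖ := by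
          gcongr
          exact (hb _ hm).trans (by gcongr)
        _ = C * ‖x‖ ^ 2 := by ring
  have hd0 := hasFDerivWithinAt_zero_of_sq hsq
  classical
  set D' : E3 → (E3 →L[ℝ] ℝ) := fun x => if x = 0 then 0 else D x with hD'
  have hD'eq : ∀ x ∈ B4', D' x = D x := fun x hx => if_neg hx.2
  have hD'0 : D' 0 = 0 := if_pos rfl
  have hd' : ∀ x ∈ B 4, HasFDerivWithinAt F (D' x) (B 4) x := fun x hx => by
    rcases eq_or_ne x 0 with rfl | hx0
    · rw [hD'0]; exact hd0
    · rw [hD'eq x ⟨hx, hx0⟩]; exact hd x ⟨hx, hx0⟩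
  have hb' : ∀ x ∈ B 4, ‖D' x‖ ≤ C * ‖x‖ := fun x hx => by
    rcases eq_or_ne x 0 with rfl | hx0
    · simp [hD'0]
    · rw [hD'eq x ⟨hx, hx0⟩]; exact hb x ⟨hx, hx0⟩
  have hg : ∀ x ∈ B 4, grad F x = D' x := fun x hx => grad_eq hx (hd' x hx)
  have hD'c : ContinuousOn D' (B 4) := fun x hx => by
    rcases eq_or_ne x 0 with rfl | hx0
    · rw [ContinuousWithinAt, hD'0]
      refine squeeze_zero_norm' (a := fun x : E3 => C * ‖x‖)
        (by filter_upwards [self_mem_nhdsWithin] with y hy using hb' y hy) ?_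
      have : Tendsto (fun x : E3 => C * ‖x‖) (𝓝 0) (𝓝 (C * ‖(0 : E3)‖)) :=
        (continuous_const.mul continuous_norm).tendsto 0
      rw [norm_zero, mul_zero] at this
      exact this.mono_left nhdsWithin_le_nhds
    · have h1 : ContinuousWithinAt D' B4' x :=
        (hDc x ⟨hx, hx0⟩).congr hD'eq (hD'eq x ⟨hx, hx0⟩)
      exact h1.mono_of_mem_nhdsWithin (B4'_mem_nhdsWithin ⟨hx, hx0⟩)
  refine ⟨hF, h0, ?_, ⟨C, fun x hx => by rw [hg x hx]; exact hb' x hx⟩, ?_⟩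
  · have : ContDiffOn ℝ (0 + 1) F (B 4) := (contDiffOn_succ_iff_fderivWithin uniqueDiff_B4).2
      ⟨fun x hx => (hd' x hx).differentiableWithinAt, by simp,
        contDiffOn_zero.2 (hD'c.congr hg)⟩
    rwa [zero_add] at this
  · obtain ⟨G, hG⟩ := hr.exists_tendstoUniformlyOn
    refine ⟨G, hG.congr ?_⟩
    filter_upwards [eventually_Ioo] with t ht x hx
    have hm := ray_mem hx ht
    have hx1 : ‖x‖ = 1 := by simpa using hx
    beta_reduce
    rw [hg _ hm.1, hD'eq _ hm, norm_smul, hx1, mul_one, Real.norm_of_nonneg ht.1.le]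

/-! ### Calculus of the deformation. -/

section

variable (ζ : SpaceX)

theorem SpaceX.hasFDerivWithinAt {x : E3} (hx : x ∈ B4') :
    HasFDerivWithinAt ζ.fn (grad ζ.fn x) (B 4) x := (ζ.mem.diff hx).hasFDerivWithinAt

theorem SpaceX.continuousOn_grad : ContinuousOn (grad ζ.fn) B4' := by
  have h := ζ.mem.contDiffOn.continuousOn_fderivWithin uniqueDiff_B4' le_rfl
  refine h.congr fun x hx => ?_
  exact ((ζ.hasFDerivWithinAt hx).mono sdiff_subset).fderivWithin (uniqueDiff_B4' x hx) |>.symm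

theorem SpaceX.radLim : RadLim (grad ζ.fn) := by
  obtain ⟨G, hG⟩ := ζ.mem.radial_limit
  exact radLim_of_tendstoUniformlyOn (fun x hx => ζ.grad_le hx) hG

theorem SpaceX.abs_le {x : E3} (hx : x ∈ B 4) : |ζ.fn x| ≤ ‖ζ‖ * ‖x‖ := by
  rcases eq_or_ne x 0 with rfl | hx0
  · simp [ζ.mem.map_zero]
  · obtain ⟨t, ht, h⟩ := exists_eq_ray ζ.mem.continuousOn ζ.mem.map_zero
      (fun x hx => ζ.hasFDerivWithinAt hx) ⟨hx, hx0⟩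
    have hm : t • x ∈ B4' := ⟨by
      rw [mem_B, norm_smul, Real.norm_of_nonneg ht.1.le]
      exact (mul_le_of_le_one_left (norm_nonneg _) ht.2.le).trans (mem_B.1 hx),
      smul_ne_zero ht.1.ne' hx0⟩
    rw [h, ← Real.norm_eq_abs]
    exact ((grad ζ.fn (t • x)).le_opNorm x).trans (by gcongr; exact ζ.grad_le hm)

theorem SpaceX.radLim_div : RadLim (fun x => ζ.fn x * ‖x‖⁻¹) := by
  have h : RadLim (fun x => (‖x‖ ^ 0)⁻¹ • grad ζ.fn x) := by simpa using ζ.radLim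
  have := h.integral ζ.mem.continuousOn ζ.mem.map_zero (fun x hx => ζ.hasFDerivWithinAt hx) 0
  simpa [mul_comm] using this

/-- The derivative of `x ↦ ζ(x) x/|x|`. -/
def dispD (x : E3) : E3 →L[ℝ] E3 :=
  (ζ.fn x * ‖x‖⁻¹) • ContinuousLinearMap.id ℝ E3 +
    (grad ζ.fn x + (-(ζ.fn x * ‖x‖⁻¹)) • innerSL ℝ (‖x‖⁻¹ • x)).smulRight (‖x‖⁻¹ • x)

theorem hasFDerivWithinAt_disp {x : E3} (hx : x ∈ B4') :
    HasFDerivWithinAt (fun x => (ζ.fn x / ‖x‖) • x) (dispD ζ x) (B 4) x := by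
  have hx0 : x ≠ 0 := hx.2
  have hn : ‖x‖ ≠ 0 := norm_ne_zero_iff.2 hx0
  have h1 : HasFDerivWithinAt (fun x => ‖x‖⁻¹) (-(‖x‖ ^ 2)⁻¹ • innerSL ℝ (‖x‖⁻¹ • x)) (B 4) x :=
    ((hasDerivAt_inv hn).comp_hasFDerivAt x (hasFDerivAt_norm hx0)).hasFDerivWithinAt
  have h2 := ((ζ.hasFDerivWithinAt hx).mul h1).smul (hasFDerivWithinAt_id x (B 4))
  refine (h2.congr_fderiv ?_).congr (fun y _ => ?_) ?_
  · ext1 v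
    simp only [dispD, ContinuousLinearMap.smulRight_apply, _root_.add_apply, _root_.smul_apply,
      ContinuousLinearMap.id_apply, id, Pi.mul_apply, smul_eq_mul, smul_smul]
    congr 2
    field_simp
    ring
  · simp [div_eq_mul_inv]
  · simp [div_eq_mul_inv]

theorem norm_dispD_le {x : E3} (hx : x ∈ B4') : ‖dispD ζ x‖ ≤ 3 * ‖ζ‖ := by
  have hxp : 0 < ‖x‖ := norm_pos_iff.2 hx.2
  have h1 : ‖ζ.fn x * ‖x‖⁻¹‖ ≤ ‖ζ‖ := by
    rw [norm_mul, norm_inv, norm_norm, ← div_eq_mul_inv, div_le_iff₀ hxp]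
    exact ζ.abs_le hx.1
  have h2 : ‖‖x‖⁻¹ • x‖ = 1 := by rw [norm_smul, norm_inv, norm_norm, inv_mul_cancel₀ hxp.ne']
  have h3 := ζ.grad_le hx
  calc ‖dispD ζ x‖ ≤ ‖ζ.fn x * ‖x‖⁻¹‖ * 1 + (‖ζ‖ + ‖ζ.fn x * ‖x‖⁻¹‖ * 1) * 1 := by
        refine (norm_add_le _ _).trans (add_le_add ?_ ?_)
        · rw [norm_smul]
          gcongr
          exact ContinuousLinearMap.norm_id_le
        · rw [ContinuousLinearMap.norm_smulRight_apply, h2]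
          gcongr
          refine (norm_add_le _ _).trans (add_le_add h3 ?_)
          rw [norm_smul, norm_neg, innerSL_apply_norm, h2]
    _ ≤ 3 * ‖ζ‖ := by linarith

theorem radLim_dispD : RadLim (dispD ζ) := by
  have h1 : RadLim (fun x : E3 => (innerSL ℝ (‖x‖⁻¹ • x) : E3 →L[ℝ] ℝ)) :=
    radLim_dir.clm (innerSL ℝ)
  have h2 : RadLim (fun _ : E3 => ContinuousLinearMap.id ℝ E3) := .of_tendsto tendsto_const_nhds
  exact (ζ.radLim_div.smul h2).add ((ζ.radLim.add (ζ.radLim_div.neg.smul h1)).bilin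
    (ContinuousLinearMap.smulRightL ℝ E3 E3) radLim_dir)

theorem continuousOn_dispD : ContinuousOn (dispD ζ) B4' := by
  have h1 : ContinuousOn ζ.fn B4' := ζ.mem.continuousOn.mono sdiff_subset
  have h2 : ContinuousOn (fun x : E3 => ‖x‖⁻¹) B4' :=
    continuous_norm.continuousOn.inv₀ fun x hx => norm_ne_zero_iff.2 hx.2
  have h3 : ContinuousOn (fun x : E3 => ‖x‖⁻¹ • x) B4' := h2.smul continuousOn_id
  have h4 := ζ.continuousOn_grad
  have h5 : ContinuousOn (fun x : E3 => (innerSL ℝ (‖x‖⁻¹ • x) : E3 →L[ℝ] ℝ)) B4' :=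
    (innerSL ℝ).continuous.comp_continuousOn h3
  exact ((h1.mul h2).smul continuousOn_const).add
    ((ContinuousLinearMap.smulRightL ℝ E3 E3).continuous.comp_continuousOn
      (h4.add ((h1.mul h2).neg.smul h5)) |>.clm_apply h3)

/-- The derivative may fail to exist at the origin. A segment through the origin splits there, its
length is the sum of the two norms, and the linear bound on `F` suffices; every other segment avoids
the singularity. -/
theorem norm_sub_le_of_hasFDerivWithinAt {V : Type*} [NormedAddCommGroup V] [NormedSpace ℝ V]
    {F : E3 → V} {D : E3 → (E3 →L[ℝ] V)} {K : ℝ}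
    (hd : ∀ x ∈ B4', HasFDerivWithinAt F (D x) (B 4) x) (hD : ∀ x ∈ B4', ‖D x‖ ≤ K)
    (hF : ∀ x ∈ B 4, ‖F x‖ ≤ K * ‖x‖) {x y : E3} (hx : x ∈ B 4) (hy : y ∈ B 4) :
    ‖F y - F x‖ ≤ K * ‖y - x‖ := by
  have hseg : segment ℝ x y ⊆ B 4 := (convex_closedBall (0 : E3) 4).segment_subset hx hy
  by_cases h0 : (0 : E3) ∈ segment ℝ x y
  · have h1 := dist_add_dist_of_mem_segment h0
    rw [dist_zero_right, dist_zero_left, dist_comm, dist_eq_norm] at h1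
    rw [← h1]
    calc ‖F y - F x‖ ≤ ‖F y‖ + ‖F x‖ := norm_sub_le _ _
      _ ≤ K * (‖x‖ + ‖y‖) := by linarith [hF x hx, hF y hy]
  · have hseg' : segment ℝ x y ⊆ B4' := fun z hz => ⟨hseg hz, fun h => h0 (h ▸ hz)⟩
    exact (convex_segment x y).norm_image_sub_le_of_norm_hasFDerivWithin_le
      (fun z hz => (hd z (hseg' hz)).mono hseg) (fun z hz => hD z (hseg' hz))
      (left_mem_segment ℝ x y) (right_mem_segment ℝ x y)

theorem SpaceX.abs_sub_le {x y : E3} (hx : x ∈ B 4) (hy : y ∈ B 4) :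
    |ζ.fn y - ζ.fn x| ≤ ‖ζ‖ * ‖y - x‖ := by
  rw [← Real.norm_eq_abs]
  exact norm_sub_le_of_hasFDerivWithinAt (fun x hx => ζ.hasFDerivWithinAt hx)
    (fun x hx => ζ.grad_le hx) (fun x hx => by rw [Real.norm_eq_abs]; exact ζ.abs_le hx) hx hy

theorem norm_disp_eq {x : E3} : ‖(ζ.fn x / ‖x‖) • x‖ = |ζ.fn x| := by
  rcases eq_or_ne x 0 with rfl | hx0
  · simp [ζ.mem.map_zero]
  · rw [norm_smul, norm_div, norm_norm, div_mul_cancel₀ _ (norm_ne_zero_iff.2 hx0),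
      Real.norm_eq_abs]

theorem norm_disp_sub_le {x y : E3} (hx : x ∈ B 4) (hy : y ∈ B 4) :
    ‖(ζ.fn y / ‖y‖) • y - (ζ.fn x / ‖x‖) • x‖ ≤ 3 * ‖ζ‖ * ‖y - x‖ :=
  norm_sub_le_of_hasFDerivWithinAt (F := fun x => (ζ.fn x / ‖x‖) • x)
    (fun x hx => hasFDerivWithinAt_disp ζ hx)
    (fun x hx => norm_dispD_le ζ hx) (fun x hx' => by
      rw [norm_disp_eq]
      have := ζ.abs_le hx'
      have h2 : 0 ≤ ‖ζ‖ * ‖x‖ := by positivity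
      linarith) hx hy

theorem deform_zero : deform ζ.fn 0 = 0 := by simp [deform]

theorem norm_deform_sub_self {x : E3} : ‖deform ζ.fn x - x‖ = |ζ.fn x| := by
  rw [deform, add_sub_cancel_left, norm_disp_eq]

theorem hasFDerivWithinAt_deform {x : E3} (hx : x ∈ B4') :
    HasFDerivWithinAt (deform ζ.fn) (ContinuousLinearMap.id ℝ E3 + dispD ζ x) (B 4) x :=
  (hasFDerivWithinAt_id x _).add (hasFDerivWithinAt_disp ζ hx)

theorem le_norm_deform_sub {x y : E3} (hx : x ∈ B 4) (hy : y ∈ B 4) :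
    (1 - 3 * ‖ζ‖) * ‖y - x‖ ≤ ‖deform ζ.fn y - deform ζ.fn x‖ := by
  have h1 := norm_disp_sub_le ζ hx hy
  have h2 : y - x = (deform ζ.fn y - deform ζ.fn x)
      - ((ζ.fn y / ‖y‖) • y - (ζ.fn x / ‖x‖) • x) := by
    simp only [deform]; abel
  have h3 := norm_sub_le (deform ζ.fn y - deform ζ.fn x)
    ((ζ.fn y / ‖y‖) • y - (ζ.fn x / ‖x‖) • x)
  rw [← h2] at h3
  linarith

theorem continuousOn_deform : ContinuousOn (deform ζ.fn) (B 4) := by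
  have : LipschitzOnWith (Real.toNNReal (3 * ‖ζ‖)) (fun x => (ζ.fn x / ‖x‖) • x) (B 4) :=
    LipschitzOnWith.of_dist_le_mul fun x hx y hy => by
      rw [dist_eq_norm, dist_eq_norm, Real.coe_toNNReal _ (by positivity)]
      exact norm_disp_sub_le ζ hy hx
  exact continuousOn_id.add this.continuousOn

theorem deform_smul (x : E3) : deform ζ.fn x = (1 + ζ.fn x / ‖x‖) • x := by
  rw [deform, add_smul, one_smul]

theorem norm_deform {x : E3} (hx : x ∈ B 4) (hζ : ‖ζ‖ ≤ 1) :
    ‖deform ζ.fn x‖ = ‖x‖ + ζ.fn x := by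
  rcases eq_or_ne x 0 with rfl | hx0
  · simp [deform_zero, ζ.mem.map_zero]
  · have hxp : 0 < ‖x‖ := norm_pos_iff.2 hx0
    have h1 := abs_le.1 (ζ.abs_le hx)
    have h2 : 0 ≤ 1 + ζ.fn x / ‖x‖ := by
      rw [← sub_nonneg] at *
      have : -1 ≤ ζ.fn x / ‖x‖ := by
        rw [le_div_iff₀ hxp]; nlinarith [h1.1]
      linarith
    rw [deform_smul ζ, norm_smul, Real.norm_of_nonneg h2]
    field_simp

theorem deform_reflect (i : Fin 3) {x : E3} (hx : x ∈ B 4) :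
    deform ζ.fn (reflect i x) = reflect i (deform ζ.fn x) := by
  rw [deform, deform, ζ.mem.symm i x hx, norm_reflect, ← reflIso_apply, ← reflIso_apply, map_add,
    map_smul]

end

/-- The element of `X` with a given underlying function. -/
def mkX (F : E3 → ℝ) (h : MemX F) : SpaceX := (⟨F, h⟩ : ↥submoduleX)

/-- The element of `Y` with a given underlying function. -/
def mkY (F : E3 → ℝ) (h : MemY F) : SpaceY := (⟨F, h⟩ : ↥submoduleY)

theorem mkX_fn (F : E3 → ℝ) (h : MemX F) : (mkX F h).fn = F := rfl
theorem mkY_fn (F : E3 → ℝ) (h : MemY F) : (mkY F h).fn = F := rfl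

theorem SpaceX.norm_le {f : SpaceX} {K : ℝ} (hK : 0 ≤ K) (h : ∀ x ∈ B4', ‖grad f.fn x‖ ≤ K) :
    ‖f‖ ≤ K := by
  rw [SpaceX.norm_def]
  exact Real.iSup_le (fun x => h x x.2) hK

theorem SpaceY.norm_le {f : SpaceY} {K : ℝ} (hK : 0 ≤ K)
    (h : ∀ x ∈ B4', ‖grad f.fn x‖ ≤ K * ‖x‖) : ‖f‖ ≤ K := by
  rw [SpaceY.norm_def]
  exact Real.iSup_le (fun x => (div_le_iff₀ (norm_pos_iff.2 x.2.2)).2 (h x x.2)) hK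

section

variable (W : SpaceY)

theorem SpaceY.hasFDerivWithinAt {x : E3} (hx : x ∈ B 4) :
    HasFDerivWithinAt W.fn (grad W.fn x) (B 4) x := (W.mem.diff hx).hasFDerivWithinAt

theorem SpaceY.continuousOn_grad : ContinuousOn (grad W.fn) (B 4) :=
  W.mem.contDiffOn.continuousOn_fderivWithin uniqueDiff_B4 le_rfl

theorem SpaceY.norm_grad_le {x : E3} (hx : x ∈ B4') : ‖grad W.fn x‖ ≤ ‖W‖ * ‖x‖ :=
  (div_le_iff₀ (norm_pos_iff.2 hx.2)).1 (W.grad_le hx)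

theorem SpaceY.radLim : RadLim (fun x => ‖x‖⁻¹ • grad W.fn x) := by
  obtain ⟨G, hG⟩ := W.mem.radial_limit
  refine radLim_of_tendstoUniformlyOn (C := ‖W‖) (G := G) (fun x hx => ?_) (hG.congr ?_)
  · have := W.grad_le hx
    rwa [norm_smul, norm_inv, norm_norm, mul_comm, ← div_eq_mul_inv]
  · filter_upwards [eventually_Ioo] with t ht x hx
    have hx1 : ‖x‖ = 1 := by simpa using hx
    beta_reduce
    rw [norm_smul t x, hx1, mul_one, Real.norm_of_nonneg ht.1.le]

theorem SpaceY.radLim_div : RadLim (fun x => (‖x‖ ^ 2)⁻¹ * W.fn x) := by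
  have h : RadLim (fun x => (‖x‖ ^ 1)⁻¹ • grad W.fn x) := by simpa using W.radLim
  exact h.integral W.mem.continuousOn W.mem.map_zero (fun x hx => W.hasFDerivWithinAt hx.1) 1

theorem SpaceY.abs_le {x : E3} (hx : x ∈ B 4) : |W.fn x| ≤ ‖W‖ * ‖x‖ ^ 2 := by
  rcases eq_or_ne x 0 with rfl | hx0
  · simp [W.mem.map_zero]
  · obtain ⟨t, ht, h⟩ := exists_eq_ray W.mem.continuousOn W.mem.map_zero
      (fun x hx => W.hasFDerivWithinAt hx.1) ⟨hx, hx0⟩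
    have htx : ‖t • x‖ ≤ ‖x‖ := by
      rw [norm_smul, Real.norm_of_nonneg ht.1.le]
      exact mul_le_of_le_one_left (norm_nonneg _) ht.2.le
    have hm : t • x ∈ B4' := ⟨mem_B.2 (htx.trans (mem_B.1 hx)), smul_ne_zero ht.1.ne' hx0⟩
    rw [h, ← Real.norm_eq_abs, pow_two, ← mul_assoc]
    exact ((grad W.fn (t • x)).le_opNorm x).trans (by
      gcongr; exact (W.norm_grad_le hm).trans (by gcongr))

end

/-- A criterion for membership in `X`. -/
theorem memX_of_hasFDerivWithinAt {F : E3 → ℝ} {D : E3 → (E3 →L[ℝ] ℝ)} {C : ℝ} (hF : MemCS F)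
    (h0 : F 0 = 0) (hd : ∀ x ∈ B4', HasFDerivWithinAt F (D x) (B 4) x) (hDc : ContinuousOn D B4')
    (hb : ∀ x ∈ B4', ‖D x‖ ≤ C) (hr : RadLim D) : MemX F := by
  have hg : ∀ x ∈ B4', grad F x = D x := fun x hx => grad_eq hx.1 (hd x hx)
  refine ⟨hF, h0, ?_, ⟨C, fun x hx => by rw [hg x hx]; exact hb x hx⟩, ?_⟩
  · have hd' : ∀ x ∈ B4', HasFDerivWithinAt F (D x) B4' x := fun x hx =>
      (hd x hx).mono sdiff_subset
    have : ContDiffOn ℝ (0 + 1) F B4' := (contDiffOn_succ_iff_fderivWithin uniqueDiff_B4').2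
      ⟨fun x hx => (hd' x hx).differentiableWithinAt, by simp,
        contDiffOn_zero.2 (hDc.congr fun x hx => (hd' x hx).fderivWithin (uniqueDiff_B4' x hx))⟩
    rwa [zero_add] at this
  · obtain ⟨G, hG⟩ := hr.exists_tendstoUniformlyOn
    refine ⟨G, hG.congr ?_⟩
    filter_upwards [eventually_Ioo] with t ht x hx
    exact (hg _ (ray_mem hx ht)).symm

theorem hasFDerivAt_comp_norm {p : ℝ → ℝ} {x : E3} (hx : x ≠ 0) {p' : ℝ}
    (hp : HasDerivAt p p' ‖x‖) :
    HasFDerivAt (fun x : E3 => p ‖x‖) (p' • (innerSL ℝ (‖x‖⁻¹ • x) : E3 →L[ℝ] ℝ)) x :=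
  hp.comp_hasFDerivAt x (hasFDerivAt_norm hx)

theorem norm_innerSL_dir {x : E3} (hx : x ≠ 0) :
    ‖(innerSL ℝ (‖x‖⁻¹ • x) : E3 →L[ℝ] ℝ)‖ = 1 := by
  rw [innerSL_apply_norm, norm_smul, norm_inv, norm_norm, inv_mul_cancel₀ (norm_ne_zero_iff.2 hx)]

theorem radLim_innerSL_dir : RadLim (fun x : E3 => (innerSL ℝ (‖x‖⁻¹ • x) : E3 →L[ℝ] ℝ)) :=
  radLim_dir.clm (innerSL ℝ)

theorem continuousOn_innerSL_dir :
    ContinuousOn (fun x : E3 => (innerSL ℝ (‖x‖⁻¹ • x) : E3 →L[ℝ] ℝ)) B4' :=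
  (innerSL ℝ).continuous.comp_continuousOn
    ((continuous_norm.continuousOn.inv₀ fun _ hx => norm_ne_zero_iff.2 hx.2).smul continuousOn_id)

theorem tendsto_comp_norm {V : Type*} [TopologicalSpace V] {p : ℝ → V} {a : V}
    (h : Tendsto p (𝓝[>] 0) (𝓝 a)) : Tendsto (fun x : E3 => p ‖x‖) (𝓝[≠] 0) (𝓝 a) := by
  refine h.comp (tendsto_nhdsWithin_iff.2 ⟨?_, ?_⟩)
  · have := (continuous_norm (E := E3)).tendsto 0
    rw [norm_zero] at this
    exact this.mono_left nhdsWithin_le_nhds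
  · filter_upwards [self_mem_nhdsWithin] with x hx using norm_pos_iff.2 hx

/-! ### Multiplication by the derivative of the potential -/

section

variable {U ρ : E3 → ℝ} {u r : ℝ → ℝ} {c C : ℝ}

theorem exists_abs_deriv_le {p : ℝ → ℝ} (hp : ContDiff ℝ 1 p) :
    ∃ K, 0 ≤ K ∧ ∀ s ∈ Icc (0 : ℝ) 5, |deriv p s| ≤ K := by
  obtain ⟨K, hK⟩ := (isCompact_Icc (a := (0 : ℝ)) (b := 5)).exists_bound_of_continuousOn
    (hp.continuous_deriv le_rfl).continuousOn
  exact ⟨max K 0, le_max_right _ _, fun s hs => (hK s hs).trans (le_max_left _ _)⟩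

theorem abs_sub_le_of_deriv {p : ℝ → ℝ} (hp : ContDiff ℝ 1 p) {K : ℝ}
    (hK : ∀ s ∈ Icc (0 : ℝ) 5, |deriv p s| ≤ K) {a b : ℝ} (ha : a ∈ Icc (0 : ℝ) 5)
    (hb : b ∈ Icc (0 : ℝ) 5) : |p b - p a| ≤ K * |b - a| :=
  (convex_Icc (0 : ℝ) 5).norm_image_sub_le_of_norm_deriv_le
    (fun s _ => hp.differentiable one_ne_zero s) hK ha hb

theorem exists_taylor_modulus {p : ℝ → ℝ} (hp : ContDiff ℝ 1 p) {ε : ℝ} (hε : 0 < ε) :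
    ∃ δ > 0, ∀ a ∈ Icc (0 : ℝ) 5, ∀ b ∈ Icc (0 : ℝ) 5, |b - a| < δ →
      |p b - p a - deriv p a * (b - a)| ≤ ε * |b - a| := by
  have huc := (isCompact_Icc (a := (0 : ℝ)) (b := 5)).uniformContinuousOn_of_continuous
    (hp.continuous_deriv le_rfl).continuousOn
  obtain ⟨δ, hδ, h⟩ := Metric.uniformContinuousOn_iff.1 huc ε hε
  refine ⟨δ, hδ, fun a ha b hb hab => ?_⟩
  have hs : uIcc a b ⊆ Icc 0 5 := uIcc_subset_Icc ha hb
  have h1 := (convex_uIcc a b).norm_image_sub_le_of_norm_hasDerivWithin_le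
    (f := fun s => p s - deriv p a * s) (f' := fun s => deriv p s - deriv p a) (C := ε)
    (fun s _ => (((hp.differentiable one_ne_zero s).hasDerivAt).sub
      (by simpa using (hasDerivAt_id s).const_mul (deriv p a))).hasDerivWithinAt)
    (fun s hs' => by
      have h2 : |s - a| < δ := (abs_sub_left_of_mem_uIcc hs').trans_lt hab
      have := h s (hs hs') a ha (by rwa [Real.dist_eq])
      rw [Real.dist_eq] at this
      exact this.le) left_mem_uIcc right_mem_uIcc
  rw [Real.norm_eq_abs, Real.norm_eq_abs] at h1
  refine le_of_eq_of_le ?_ h1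
  congr 1
  ring

theorem RadialState.deriv_le (h : RadialState U ρ u r c C) {K : ℝ}
    (hK : ∀ s ∈ Icc (0 : ℝ) 5, |deriv (deriv u) s| ≤ K) {s : ℝ} (hs : s ∈ Icc (0 : ℝ) 5) :
    |deriv u s| ≤ K * s := by
  have := abs_sub_le_of_deriv h.contDiff_deriv_u hK (a := 0) (by simp) hs
  rwa [h.deriv_zero, sub_zero, sub_zero, abs_of_nonneg hs.1] at this

theorem norm_mem_Icc {x : E3} (hx : x ∈ B 4) : ‖x‖ ∈ Icc (0 : ℝ) 5 :=
  ⟨norm_nonneg x, (mem_B.1 hx).trans (by norm_num)⟩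

/-- The gradient of `u'(|x|) ζ(x)`. -/
def mulD (u : ℝ → ℝ) (ζ : SpaceX) (x : E3) : E3 →L[ℝ] ℝ :=
  deriv u ‖x‖ • grad ζ.fn x + (ζ.fn x * deriv (deriv u) ‖x‖) • innerSL ℝ (‖x‖⁻¹ • x)

theorem RadialState.tendsto_deriv_div (h : RadialState U ρ u r c C) :
    Tendsto (fun s => s⁻¹ * deriv u s) (𝓝[>] 0) (𝓝 (deriv (deriv u) 0)) := by
  have h1 : HasDerivAt (deriv u) (deriv (deriv u) 0) 0 :=
    (h.contDiff_deriv_u.differentiable one_ne_zero 0).hasDerivAt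
  have h2 := h1.hasDerivWithinAt (s := Ioi 0)
  rw [hasDerivWithinAt_iff_tendsto_slope' (by simp)] at h2
  refine h2.congr fun s => ?_
  rw [slope_def_field, h.deriv_zero, sub_zero, sub_zero, div_eq_inv_mul]

theorem RadialState.le_deriv_deriv (h : RadialState U ρ u r c C) : c ≤ deriv (deriv u) 0 := by
  refine ge_of_tendsto h.tendsto_deriv_div ?_
  filter_upwards [Ioo_mem_nhdsGT (show (0 : ℝ) < 5 by norm_num)] with s hs
  rw [← div_eq_inv_mul, le_div_iff₀ hs.1]
  exact h.le_deriv s ⟨hs.1.le, hs.2.le⟩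

theorem tendsto_deriv_deriv (h : RadialState U ρ u r c C) :
    Tendsto (deriv (deriv u)) (𝓝[>] 0) (𝓝 (deriv (deriv u) 0)) :=
  ((h.contDiff_deriv_u.continuous_deriv le_rfl).tendsto 0).mono_left nhdsWithin_le_nhds

theorem RadialState.hasFDerivAt_deriv_u (h : RadialState U ρ u r c C) {x : E3} (hx : x ≠ 0) :
    HasFDerivAt (fun x : E3 => deriv u ‖x‖)
      (deriv (deriv u) ‖x‖ • (innerSL ℝ (‖x‖⁻¹ • x) : E3 →L[ℝ] ℝ)) x :=
  hasFDerivAt_comp_norm hx (h.contDiff_deriv_u.differentiable one_ne_zero _).hasDerivAt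

theorem RadialState.hasFDerivWithinAt_mul (h : RadialState U ρ u r c C) (ζ : SpaceX) {x : E3}
    (hx : x ∈ B4') :
    HasFDerivWithinAt (fun x => deriv u ‖x‖ * ζ.fn x) (mulD u ζ x) (B 4) x := by
  refine ((h.hasFDerivAt_deriv_u hx.2).hasFDerivWithinAt.mul (ζ.hasFDerivWithinAt hx)).congr_fderiv
    ?_
  rw [mulD, smul_smul]

theorem norm_mulD_le {u : ℝ → ℝ} (ζ : SpaceX) {x : E3} (hx : x ∈ B4') {K : ℝ}
    (hK : |deriv (deriv u) ‖x‖| ≤ K) (hK' : |deriv u ‖x‖| ≤ K * ‖x‖) :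
    ‖mulD u ζ x‖ ≤ 2 * K * ‖ζ‖ * ‖x‖ := by
  have hK0 : 0 ≤ K := (abs_nonneg _).trans hK
  calc ‖mulD u ζ x‖ ≤ |deriv u ‖x‖| * ‖grad ζ.fn x‖ + |ζ.fn x| * |deriv (deriv u) ‖x‖| * 1 := by
        refine (norm_add_le _ _).trans (le_of_eq ?_)
        rw [norm_smul, norm_smul, norm_innerSL_dir hx.2, norm_mul]
        rfl
    _ ≤ (K * ‖x‖) * ‖ζ‖ + (‖ζ‖ * ‖x‖) * K * 1 := by
        gcongr
        · exact ζ.grad_le hx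
        · exact ζ.abs_le hx.1
    _ = _ := by ring

theorem RadialState.memY_mul (h : RadialState U ρ u r c C) (ζ : SpaceX) :
    MemY (fun x => deriv u ‖x‖ * ζ.fn x) := by
  obtain ⟨K, hK0, hK⟩ := exists_abs_deriv_le h.contDiff_deriv_u
  have hcu : Continuous (deriv u) := h.contDiff_deriv_u.continuous
  have hcu' : Continuous (deriv (deriv u)) := h.contDiff_deriv_u.continuous_deriv le_rfl
  refine memY_of_hasFDerivWithinAt (C := 2 * K * ‖ζ‖) ⟨fun x hx => ?_, ?_, fun i x hx => ?_⟩ ?_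
    (fun x hx => h.hasFDerivWithinAt_mul ζ hx) ?_
    (fun x hx => norm_mulD_le ζ hx (hK _ (norm_mem_Icc hx.1)) (h.deriv_le hK (norm_mem_Icc hx.1)))
    ?_
  · rw [ζ.mem.eq_zero_off x hx, mul_zero]
  · exact (hcu.comp continuous_norm).continuousOn.mul ζ.mem.continuousOn
  · rw [norm_reflect, ζ.mem.symm i x hx]
  · beta_reduce
    rw [ζ.mem.map_zero, mul_zero]
  · exact ((hcu.comp continuous_norm).continuousOn.smul ζ.continuousOn_grad).add
      (((ζ.mem.continuousOn.mono sdiff_subset).mul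
        (hcu'.comp continuous_norm).continuousOn).smul continuousOn_innerSL_dir)
  · have h1 : RadLim (fun x : E3 => ‖x‖⁻¹ * deriv u ‖x‖) :=
      .of_tendsto (tendsto_comp_norm (p := fun s => s⁻¹ * deriv u s) h.tendsto_deriv_div)
    have h2 : RadLim (fun x : E3 => deriv (deriv u) ‖x‖) :=
      .of_tendsto (tendsto_comp_norm (tendsto_deriv_deriv h))
    refine ((h1.smul ζ.radLim).add ((ζ.radLim_div.mul h2).smul radLim_innerSL_dir)).congr ?_
    refine Eventually.of_forall fun x => ?_
    simp only [mulD, smul_add, smul_smul]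
    congr 2
    ring

/-- The gradient of `W(x) / u'(|x|)`. -/
def divD (u : ℝ → ℝ) (W : SpaceY) (x : E3) : E3 →L[ℝ] ℝ :=
  (deriv u ‖x‖)⁻¹ • grad W.fn x +
    (-(W.fn x * (deriv (deriv u) ‖x‖ * ((deriv u ‖x‖) ^ 2)⁻¹))) • innerSL ℝ (‖x‖⁻¹ • x)

theorem RadialState.hasFDerivWithinAt_div (h : RadialState U ρ u r c C) (W : SpaceY) {x : E3}
    (hx : x ∈ B4') :
    HasFDerivWithinAt (fun x => (deriv u ‖x‖)⁻¹ * W.fn x) (divD u W x) (B 4) x := by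
  have hp : deriv u ‖x‖ ≠ 0 := (h.deriv_pos _ (norm_pos_iff.2 hx.2)).ne'
  have h1 := (hasDerivAt_inv hp).comp_hasFDerivAt x (h.hasFDerivAt_deriv_u hx.2)
  refine (h1.hasFDerivWithinAt.mul (W.hasFDerivWithinAt hx.1)).congr_fderiv ?_
  rw [divD, smul_smul, smul_smul]
  congr 2
  ring

theorem RadialState.norm_divD_le (h : RadialState U ρ u r c C) (W : SpaceY) {x : E3}
    (hx : x ∈ B4') {K : ℝ} (hK : |deriv (deriv u) ‖x‖| ≤ K) :
    ‖divD u W x‖ ≤ (c⁻¹ + K * (c ^ 2)⁻¹) * ‖W‖ := by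
  have hK0 : 0 ≤ K := (abs_nonneg _).trans hK
  have hx0 : 0 < ‖x‖ := norm_pos_iff.2 hx.2
  have hc := h.c_pos
  have h1 : c * ‖x‖ ≤ deriv u ‖x‖ := h.le_deriv _ (norm_mem_Icc hx.1)
  have hp := h.deriv_pos _ hx0
  calc ‖divD u W x‖ ≤ (deriv u ‖x‖)⁻¹ * ‖grad W.fn x‖
        + |W.fn x| * (|deriv (deriv u) ‖x‖| * ((deriv u ‖x‖) ^ 2)⁻¹) * 1 := by
        refine (norm_add_le _ _).trans (le_of_eq ?_)
        rw [norm_smul, norm_smul, norm_innerSL_dir hx.2, norm_neg, norm_mul, norm_mul, norm_inv,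
          norm_inv, norm_pow, Real.norm_of_nonneg hp.le]
        rfl
    _ ≤ (c * ‖x‖)⁻¹ * (‖W‖ * ‖x‖) + (‖W‖ * ‖x‖ ^ 2) * (K * ((c * ‖x‖) ^ 2)⁻¹) * 1 := by
        gcongr
        · exact W.norm_grad_le hx
        · exact W.abs_le hx.1
    _ = _ := by field_simp

/-- Since `u'(s)/s` tends to `u''(0) ≥ c > 0`, division by `u'` lowers the order at the origin by
exactly one, from quadratic in `Y` to linear in `X`. -/
theorem RadialState.memX_div (h : RadialState U ρ u r c C) (W : SpaceY) :
    MemX (fun x => (deriv u ‖x‖)⁻¹ * W.fn x) := by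
  obtain ⟨K, hK0, hK⟩ := exists_abs_deriv_le h.contDiff_deriv_u
  have hcu : Continuous (deriv u) := h.contDiff_deriv_u.continuous
  have hcu' : Continuous (deriv (deriv u)) := h.contDiff_deriv_u.continuous_deriv le_rfl
  have hc := h.c_pos
  have hne : ∀ x ∈ B4', deriv u ‖x‖ ≠ 0 := fun x hx => (h.deriv_pos _ (norm_pos_iff.2 hx.2)).ne'
  have hci : ContinuousOn (fun x : E3 => (deriv u ‖x‖)⁻¹) B4' :=
    (hcu.comp continuous_norm).continuousOn.inv₀ hne
  have hWc : ContinuousOn W.fn B4' := W.mem.continuousOn.mono sdiff_subset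
  refine memX_of_hasFDerivWithinAt (C := (c⁻¹ + K * (c ^ 2)⁻¹) * ‖W‖)
    ⟨fun x hx => ?_, fun x hx => ?_, fun i x hx => ?_⟩ ?_
    (fun x hx => h.hasFDerivWithinAt_div W hx) ?_
    (fun x hx => h.norm_divD_le W hx (hK _ (norm_mem_Icc hx.1))) ?_
  · rw [W.mem.eq_zero_off x hx, mul_zero]
  · rcases eq_or_ne x 0 with rfl | hx0
    · rw [ContinuousWithinAt, W.mem.map_zero, mul_zero]
      refine squeeze_zero_norm' (a := fun x : E3 => c⁻¹ * ‖W‖ * ‖x‖) ?_ ?_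
      · filter_upwards [self_mem_nhdsWithin] with y hy
        rcases eq_or_ne y 0 with rfl | hy0
        · simp [W.mem.map_zero]
        · have hyp : 0 < ‖y‖ := norm_pos_iff.2 hy0
          have h1 : c * ‖y‖ ≤ deriv u ‖y‖ := h.le_deriv _ (norm_mem_Icc hy)
          rw [norm_mul, norm_inv, Real.norm_of_nonneg (h.deriv_pos _ hyp).le, Real.norm_eq_abs]
          calc (deriv u ‖y‖)⁻¹ * |W.fn y| ≤ (c * ‖y‖)⁻¹ * (‖W‖ * ‖y‖ ^ 2) := by
                gcongr
                exact W.abs_le hy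
            _ = _ := by field_simp
      · have : Tendsto (fun x : E3 => c⁻¹ * ‖W‖ * ‖x‖) (𝓝 0) (𝓝 (c⁻¹ * ‖W‖ * ‖(0 : E3)‖)) :=
          (continuous_const.mul continuous_norm).tendsto 0
        rw [norm_zero, mul_zero] at this
        exact this.mono_left nhdsWithin_le_nhds
    · exact (h.hasFDerivWithinAt_div W ⟨hx, hx0⟩).continuousWithinAt
  · rw [norm_reflect, W.mem.symm i x hx]
  · beta_reduce
    rw [W.mem.map_zero, mul_zero]
  · exact (hci.smul (W.continuousOn_grad.mono sdiff_subset)).add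
      ((hWc.mul ((hcu'.comp continuous_norm).continuousOn.mul
        (((hcu.comp continuous_norm).continuousOn.pow 2).inv₀ fun x hx =>
          pow_ne_zero 2 (hne x hx)))).neg.smul continuousOn_innerSL_dir)
  · have h1 : RadLim (fun x : E3 => (‖x‖⁻¹ * deriv u ‖x‖)⁻¹) :=
      .of_tendsto (tendsto_comp_norm (p := fun s => (s⁻¹ * deriv u s)⁻¹)
        (h.tendsto_deriv_div.inv₀ (h.c_pos.trans_le h.le_deriv_deriv).ne'))
    have h2 : RadLim (fun x : E3 => deriv (deriv u) ‖x‖) :=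
      .of_tendsto (tendsto_comp_norm (tendsto_deriv_deriv h))
    refine ((h1.smul W.radLim).add
      ((W.radLim_div.mul (h2.mul (h1.mul h1))).neg.smul radLim_innerSL_dir)).congr ?_
    filter_upwards [self_mem_nhdsWithin] with x hx
    have hxp : 0 < ‖x‖ := norm_pos_iff.2 hx
    have hp := h.deriv_pos _ hxp
    simp only [divD, smul_smul]
    congr 2
    · field_simp
    · field_simp

/-- Multiplication by `u'(|x|)` as an isomorphism of `X` onto `Y`. -/
def RadialState.mulEquiv (h : RadialState U ρ u r c C) : SpaceX ≃ₗ[ℝ] SpaceY where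
  toFun ζ := mkY _ (h.memY_mul ζ)
  invFun W := mkX _ (h.memX_div W)
  map_add' ζ η := SpaceY.fn_injective (funext fun x => by
    simp only [mkY_fn, SpaceX.fn_add, SpaceY.fn_add, Pi.add_apply, mul_add])
  map_smul' a ζ := SpaceY.fn_injective (funext fun x => by
    simp only [mkY_fn, SpaceX.fn_smul, SpaceY.fn_smul, Pi.smul_apply, smul_eq_mul, RingHom.id_apply]
    ring)
  left_inv ζ := SpaceX.fn_injective (funext fun x => by
    simp only [mkY_fn, mkX_fn]
    rcases eq_or_ne x 0 with rfl | hx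
    · simp [ζ.mem.map_zero]
    · rw [inv_mul_cancel_left₀ (h.deriv_pos _ (norm_pos_iff.2 hx)).ne'])
  right_inv W := SpaceY.fn_injective (funext fun x => by
    simp only [mkY_fn, mkX_fn]
    rcases eq_or_ne x 0 with rfl | hx
    · simp [W.mem.map_zero]
    · rw [mul_inv_cancel_left₀ (h.deriv_pos _ (norm_pos_iff.2 hx)).ne'])

theorem RadialState.grad_mulEquiv (h : RadialState U ρ u r c C) (ζ : SpaceX) {x : E3}
    (hx : x ∈ B4') : grad (h.mulEquiv ζ).fn x = mulD u ζ x :=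
  grad_eq hx.1 (h.hasFDerivWithinAt_mul ζ hx)

theorem RadialState.exists_norm_mulEquiv_le (h : RadialState U ρ u r c C) :
    ∃ K, 0 ≤ K ∧ (∀ ζ, ‖h.mulEquiv ζ‖ ≤ K * ‖ζ‖) ∧ ∀ W, ‖h.mulEquiv.symm W‖ ≤ K * ‖W‖ := by
  obtain ⟨K, hK0, hK⟩ := exists_abs_deriv_le h.contDiff_deriv_u
  have hc := h.c_pos
  refine ⟨2 * K + (c⁻¹ + K * (c ^ 2)⁻¹), by positivity, fun ζ => ?_, fun W => ?_⟩
  · refine SpaceY.norm_le (by positivity) fun x hx => ?_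
    rw [h.grad_mulEquiv ζ hx]
    refine (norm_mulD_le ζ hx (hK _ (norm_mem_Icc hx.1)) (h.deriv_le hK (norm_mem_Icc hx.1))).trans
      ?_
    gcongr
    have : 0 ≤ c⁻¹ + K * (c ^ 2)⁻¹ := by positivity
    linarith
  · refine SpaceX.norm_le (by positivity) fun x hx => ?_
    have e : grad (h.mulEquiv.symm W).fn x = divD u W x :=
      grad_eq hx.1 (h.hasFDerivWithinAt_div W hx)
    rw [e]
    refine (h.norm_divD_le W hx (hK _ (norm_mem_Icc hx.1))).trans ?_
    refine mul_le_mul_of_nonneg_right ?_ (norm_nonneg _)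
    linarith

end

/-! ### Composition of a potential with the deformation. -/

/-- The differential data of a potential: a gradient field vanishing linearly at the origin. -/
structure IsPotential (V : E3 → ℝ) (D : E3 → (E3 →L[ℝ] ℝ)) : Prop where
  hasFDerivAt : ∀ x, HasFDerivAt V (D x) x
  continuous : Continuous D
  map_zero : D 0 = 0
  differentiable : ∃ A : E3 →L[ℝ] E3 →L[ℝ] ℝ, HasFDerivAt D A 0
  symm : ∀ i x, V (reflect i x) = V x

theorem IsPotential.exists_bound {V : E3 → ℝ} {D : E3 → (E3 →L[ℝ] ℝ)} (h : IsPotential V D) :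
    ∃ C, 0 ≤ C ∧ ∀ x ∈ B 5, ‖D x‖ ≤ C * ‖x‖ := by
  obtain ⟨A, hA⟩ := h.differentiable
  obtain ⟨M, hM⟩ := (isCompact_closedBall (0 : E3) 5).exists_bound_of_continuousOn
    h.continuous.continuousOn
  have h1 := hA.isBigO_sub
  simp only [h.map_zero, sub_zero] at h1
  obtain ⟨K, hK⟩ := h1.bound
  obtain ⟨δ, hδ, hd⟩ := Metric.mem_nhds_iff.1 hK
  have hM0 : 0 ≤ M := (norm_nonneg _).trans (hM 0 (by simp))
  refine ⟨max K (M / δ), le_max_of_le_right (by positivity), fun x hx => ?_⟩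
  rcases lt_or_ge ‖x‖ δ with hlt | hge
  · exact (hd (mem_ball_zero_iff.2 hlt)).trans (by gcongr; exact le_max_left _ _)
  · calc ‖D x‖ ≤ M := hM x hx
      _ = M / δ * δ := by field_simp
      _ ≤ M / δ * ‖x‖ := by gcongr
      _ ≤ _ := by gcongr; exact le_max_right _ _

theorem deform_mem {ζ : SpaceX} (hζ : ‖ζ‖ ≤ 1 / 4) {x : E3} (hx : x ∈ B 4) :
    ‖deform ζ.fn x‖ ≤ 5 / 4 * ‖x‖ := by
  rw [norm_deform ζ hx (hζ.trans (by norm_num))]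
  have h1 := (abs_le.1 (ζ.abs_le hx)).2
  nlinarith [norm_nonneg x]

theorem deform_mem_B5 {ζ : SpaceX} (hζ : ‖ζ‖ ≤ 1 / 4) {x : E3} (hx : x ∈ B 4) :
    deform ζ.fn x ∈ B 5 := by
  have := deform_mem hζ hx
  rw [mem_B] at *
  linarith

/-- The gradient of `V ∘ g_ζ`. -/
def compD (D : E3 → (E3 →L[ℝ] ℝ)) (ζ : SpaceX) (x : E3) : E3 →L[ℝ] ℝ :=
  (D (deform ζ.fn x)).comp (ContinuousLinearMap.id ℝ E3 + dispD ζ x)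

/-- The function `V ∘ g_ζ - V(0)` on `B_4`. -/
def cutComp (V : E3 → ℝ) (ζ : SpaceX) : E3 → ℝ :=
  (B 4).indicator fun x => V (deform ζ.fn x) - V 0

theorem cutComp_of_mem (V : E3 → ℝ) (ζ : SpaceX) {x : E3} (hx : x ∈ B 4) :
    cutComp V ζ x = V (deform ζ.fn x) - V 0 := indicator_of_mem hx _

section

variable {V : E3 → ℝ} {D : E3 → (E3 →L[ℝ] ℝ)}

theorem IsPotential.hasFDerivWithinAt_comp (h : IsPotential V D) (ζ : SpaceX) {x : E3} (hx : x ∈ B4') :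
    HasFDerivWithinAt (cutComp V ζ) (compD D ζ x) (B 4) x := by
  have h1 := ((h.hasFDerivAt (deform ζ.fn x)).comp_hasFDerivWithinAt x
    (hasFDerivWithinAt_deform ζ hx)).sub_const (V 0)
  exact h1.congr (fun y hy => cutComp_of_mem V ζ hy) (cutComp_of_mem V ζ hx.1)

theorem tendsto_deform (ζ : SpaceX) : Tendsto (deform ζ.fn) (𝓝[≠] 0) (𝓝 0) := by
  have h := continuousOn_deform ζ 0 zero_mem_B4
  rw [ContinuousWithinAt, deform_zero] at h
  exact (h.mono_left (by
    rw [nhdsWithin_eq_nhds.2 (Metric.closedBall_mem_nhds (0 : E3) four_pos)])).mono_left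
    nhdsWithin_le_nhds

/-- Replace the field by its derivative `A` at the origin: `A (g_ζ(x)/|x|)` has a radial limit
because `g_ζ(x)/|x| = (1 + ζ(x)/|x|) x/|x|` has one, and the error is `o(1)` since `|g_ζ(x)|` is
`O(|x|)`. -/
theorem IsPotential.radLim_comp (h : IsPotential V D) {ζ : SpaceX} (hζ : ‖ζ‖ ≤ 1 / 4) :
    RadLim (fun x => ‖x‖⁻¹ • D (deform ζ.fn x)) := by
  obtain ⟨A, hA⟩ := h.differentiable
  have h1 : RadLim (fun x => A ((1 + ζ.fn x * ‖x‖⁻¹) • (‖x‖⁻¹ • x))) :=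
    (((RadLim.of_tendsto (a := (1 : ℝ)) tendsto_const_nhds).add ζ.radLim_div).smul radLim_dir).clm A
  have h2 : RadLim (fun x => ‖x‖⁻¹ • (D (deform ζ.fn x) - A (deform ζ.fn x))) := by
    refine .of_tendsto (a := 0) ?_
    have h3 := hA.isLittleO
    simp only [h.map_zero, sub_zero] at h3
    have h4 := h3.comp_tendsto (tendsto_deform ζ)
    have h5 : (deform ζ.fn) =O[𝓝[≠] 0] fun x : E3 => ‖x‖ := by
      refine Asymptotics.IsBigO.of_bound (5 / 4) ?_
      filter_upwards [eventually_mem_B4'] with x hx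
      rw [norm_norm]
      exact deform_mem hζ hx.1
    exact (h4.trans_isBigO h5).tendsto_inv_smul_nhds_zero
  refine (h1.add h2).congr (Eventually.of_forall fun x => ?_)
  have e : (1 + ζ.fn x * ‖x‖⁻¹) • (‖x‖⁻¹ • x) = ‖x‖⁻¹ • deform ζ.fn x := by
    rw [deform_smul, smul_comm ‖x‖⁻¹, div_eq_mul_inv]
  beta_reduce
  rw [e, smul_sub, map_smul]
  abel

theorem IsPotential.memY_comp (h : IsPotential V D) {ζ : SpaceX} (hζ : ‖ζ‖ ≤ 1 / 4) : MemY (cutComp V ζ) := by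
  obtain ⟨C, hC0, hC⟩ := h.exists_bound
  have hVc : Continuous V := continuous_iff_continuousAt.2 fun x => (h.hasFDerivAt x).continuousAt
  refine memY_of_hasFDerivWithinAt (C := C * (5 / 4) * (1 + 3 * (1 / 4)))
    ⟨fun x hx => indicator_of_notMem hx _, ?_, fun i x hx => ?_⟩ ?_
    (fun x hx => h.hasFDerivWithinAt_comp ζ hx) ?_ (fun x hx => ?_) ?_
  · exact ((hVc.comp_continuousOn (continuousOn_deform ζ)).sub continuousOn_const).congr
      fun x hx => cutComp_of_mem V ζ hx
  · rw [cutComp_of_mem V ζ hx, cutComp_of_mem V ζ (reflect_mem_B.2 hx), deform_reflect ζ i hx,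
      h.symm]
  · rw [cutComp_of_mem V ζ zero_mem_B4, deform_zero, sub_self]
  · exact (h.continuous.comp_continuousOn ((continuousOn_deform ζ).mono sdiff_subset)).clm_comp
      (continuousOn_const.add (continuousOn_dispD ζ))
  · calc ‖compD D ζ x‖ ≤ ‖D (deform ζ.fn x)‖ * ‖ContinuousLinearMap.id ℝ E3 + dispD ζ x‖ :=
          ContinuousLinearMap.opNorm_comp_le _ _
      _ ≤ (C * (5 / 4 * ‖x‖)) * (1 + 3 * (1 / 4)) := by
          gcongr
          · exact (hC _ (deform_mem_B5 hζ hx.1)).trans (by gcongr; exact deform_mem hζ hx.1)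
          · refine (norm_add_le _ _).trans (add_le_add ContinuousLinearMap.norm_id_le ?_)
            exact (norm_dispD_le ζ hx).trans (by gcongr)
      _ = _ := by ring
  · have h1 : RadLim (fun x => ContinuousLinearMap.id ℝ E3 + dispD ζ x) :=
      (RadLim.of_tendsto tendsto_const_nhds).add (radLim_dispD ζ)
    exact ((h.radLim_comp hζ).bilin (ContinuousLinearMap.compL ℝ E3 E3 ℝ) h1).congr
      (Eventually.of_forall fun x => by simp [compD])

theorem IsPotential.grad_comp (h : IsPotential V D) (ζ : SpaceX) {x : E3} (hx : x ∈ B4') :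
    grad (cutComp V ζ) x = compD D ζ x := grad_eq hx.1 (h.hasFDerivWithinAt_comp ζ hx)

theorem deform_zero_fn (x : E3) : deform (0 : SpaceX).fn x = x := by
  simp [deform, SpaceX.fn_zero]

theorem dispD_zero {x : E3} (hx : x ∈ B4') : dispD 0 x = 0 := by
  have := norm_dispD_le 0 hx
  rw [norm_zero, mul_zero] at this
  exact norm_le_zero_iff.1 this

theorem compD_zero {x : E3} (hx : x ∈ B4') : compD D 0 x = D x := by
  rw [compD, deform_zero_fn, dispD_zero hx, add_zero, ContinuousLinearMap.comp_id]

end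

/-! ### The inverse deformation and the perturbed density. -/

section

variable {U ρ : E3 → ℝ} {u r : ℝ → ℝ} {c C : ℝ}

theorem RadialState.isPotential (h : RadialState U ρ u r c C) : IsPotential U (fderiv ℝ U) where
  hasFDerivAt x := (h.contDiff_U.differentiable two_ne_zero x).hasFDerivAt
  continuous := h.contDiff_U.continuous_fderiv two_ne_zero
  map_zero := fderiv_zero_of_even fun x => by rw [h.U_eq, h.U_eq x, norm_neg]
  differentiable := ⟨_, ((h.contDiff_U.fderiv_right (m := 1) (by norm_num)).differentiable
    one_ne_zero 0).hasFDerivAt⟩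
  symm i x := by rw [h.U_eq, h.U_eq x, norm_reflect]

theorem SrcL.isPotential {f : E3 → ℝ} {M : ℝ} (hf : SrcL f M) (hs : ∀ i y, f (reflect i y) = f y) :
    IsPotential (pot f) (fun x => innerSL ℝ (gradPot f x)) where
  hasFDerivAt x := hf.src.hasFDerivAt_pot x
  continuous := (innerSL ℝ).continuous.comp hf.src.continuous_gradPot
  map_zero := by
    rw [gradPot_zero_of_even fun y => by rw [neg_eq_reflect, hs, hs, hs], map_zero]
  differentiable := by
    obtain ⟨L, hL⟩ := hf.exists_hasFDerivAt_gradPot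
    exact ⟨_, (innerSL ℝ).hasFDerivAt.comp (0 : E3) hL⟩
  symm i x := by
    rw [← reflIso_apply, ← pot_comp]
    congr 1
    funext y
    rw [reflIso_apply, hs]

theorem injOn_deform {ζ : SpaceX} (hζ : ‖ζ‖ ≤ 1 / 4) : InjOn (deform ζ.fn) (B 4) := by
  intro x hx y hy hxy
  have h := le_norm_deform_sub ζ hx hy
  rw [hxy, sub_self, norm_zero] at h
  have h2 : ‖y - x‖ = 0 := le_antisymm (by nlinarith [norm_nonneg (y - x)]) (norm_nonneg _)
  exact (sub_eq_zero.1 (norm_eq_zero.1 h2)).symm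

/-- The deformation preserves rays, so the intermediate value theorem on each ray is enough: the
radius `s + ζ` starts at `0` and is at least `4 - 4/4 = 3` at the boundary. -/
theorem subset_image_deform {ζ : SpaceX} (hζ : ‖ζ‖ ≤ 1 / 4) : B 3 ⊆ deform ζ.fn '' B 4 := by
  intro y hy
  rcases eq_or_ne y 0 with rfl | hy0
  · exact ⟨0, zero_mem_B4, deform_zero ζ⟩
  have hyp : 0 < ‖y‖ := norm_pos_iff.2 hy0
  have hy3 : ‖y‖ ≤ 3 := mem_B.1 hy
  set n : E3 := ‖y‖⁻¹ • y with hn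
  have hn1 : ‖n‖ = 1 := by rw [hn, norm_smul, norm_inv, norm_norm, inv_mul_cancel₀ hyp.ne']
  have hyn : ‖y‖ • n = y := by rw [hn, smul_smul, mul_inv_cancel₀ hyp.ne', one_smul]
  have hmem : ∀ s ∈ Icc (0 : ℝ) 4, s • n ∈ B 4 ∧ ‖s • n‖ = s := fun s hs => by
    have : ‖s • n‖ = s := by rw [norm_smul, hn1, mul_one, Real.norm_of_nonneg hs.1]
    exact ⟨mem_B.2 (this.trans_le hs.2), this⟩
  have hcont : ContinuousOn (fun s : ℝ => s + ζ.fn (s • n)) (Icc 0 4) :=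
    continuousOn_id.add (continuousOn_ray ζ.mem.continuousOn n (by rw [hn1, mul_one]))
  have h4 : ‖y‖ ≤ 4 + ζ.fn ((4 : ℝ) • n) := by
    obtain ⟨h1, h2⟩ := hmem 4 (by norm_num)
    have := (abs_le.1 (ζ.abs_le h1)).1
    rw [h2] at this
    linarith
  obtain ⟨s, hs, hse⟩ := intermediate_value_Icc (by norm_num : (0 : ℝ) ≤ 4) hcont
    (show ‖y‖ ∈ _ from ⟨by simp [ζ.mem.map_zero], h4⟩)
  have hs0 : s ≠ 0 := by
    rintro rfl
    simp only [zero_smul, ζ.mem.map_zero, add_zero] at hse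
    exact hyp.ne hse
  refine ⟨s • n, (hmem s hs).1, ?_⟩
  rw [deform_smul, (hmem s hs).2, smul_smul, ← hyn, ← hse]
  congr 1
  field_simp

section Inverse

variable {ζ : SpaceX}

theorem deformInv_mem (hζ : ‖ζ‖ ≤ 1 / 4) {y : E3} (hy : y ∈ B 3) : deformInv ζ.fn y ∈ B 4 :=
  Function.invFunOn_mem (subset_image_deform hζ hy)

theorem deform_deformInv (hζ : ‖ζ‖ ≤ 1 / 4) {y : E3} (hy : y ∈ B 3) :
    deform ζ.fn (deformInv ζ.fn y) = y :=
  Function.invFunOn_eq (subset_image_deform hζ hy)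

theorem deformInv_reflect (hζ : ‖ζ‖ ≤ 1 / 4) (i : Fin 3) {y : E3} (hy : y ∈ B 3) :
    deformInv ζ.fn (reflect i y) = reflect i (deformInv ζ.fn y) := by
  have hm := deformInv_mem hζ hy
  refine injOn_deform hζ (deformInv_mem hζ (reflect_mem_B.2 hy)) (reflect_mem_B.2 hm) ?_
  rw [deform_deformInv hζ (reflect_mem_B.2 hy), deform_reflect ζ i hm, deform_deformInv hζ hy]

theorem norm_eq_deformInv (hζ : ‖ζ‖ ≤ 1 / 4) {y : E3} (hy : y ∈ B 3) :
    ‖y‖ = ‖deformInv ζ.fn y‖ + ζ.fn (deformInv ζ.fn y) := by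
  rw [← norm_deform ζ (deformInv_mem hζ hy) (hζ.trans (by norm_num)), deform_deformInv hζ hy]

theorem norm_deformInv_le (hζ : ‖ζ‖ ≤ 1 / 4) {y : E3} (hy : y ∈ B 3) :
    ‖deformInv ζ.fn y‖ ≤ 2 * ‖y‖ := by
  have h1 := norm_eq_deformInv hζ hy
  have h2 := (abs_le.1 (ζ.abs_le (deformInv_mem hζ hy))).1
  nlinarith [norm_nonneg (deformInv ζ.fn y)]

theorem abs_deformInv_le (hζ : ‖ζ‖ ≤ 1 / 4) {y : E3} (hy : y ∈ B 3) :
    |ζ.fn (deformInv ζ.fn y)| ≤ 2 * ‖ζ‖ * ‖y‖ := by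
  refine (ζ.abs_le (deformInv_mem hζ hy)).trans ?_
  rw [mul_comm 2, mul_assoc]
  gcongr
  exact norm_deformInv_le hζ hy

theorem norm_deformInv_sub (hζ : ‖ζ‖ ≤ 1 / 4) {y : E3} (hy : y ∈ B 3) :
    ‖y - deformInv ζ.fn y‖ = |ζ.fn (deformInv ζ.fn y)| := by
  rw [← norm_deform_sub_self, deform_deformInv hζ hy]

theorem continuousOn_deformInv (hζ : ‖ζ‖ ≤ 1 / 4) : ContinuousOn (deformInv ζ.fn) (B 3) := by
  have : LipschitzOnWith 4 (deformInv ζ.fn) (B 3) := LipschitzOnWith.of_dist_le_mul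
    fun x hx y hy => by
      have h := le_norm_deform_sub ζ (deformInv_mem hζ hy) (deformInv_mem hζ hx)
      rw [deform_deformInv hζ hx, deform_deformInv hζ hy] at h
      rw [dist_eq_norm, dist_eq_norm]
      push_cast
      nlinarith [norm_nonneg (deformInv ζ.fn x - deformInv ζ.fn y)]
  exact this.continuousOn

end Inverse

theorem measurable_indicator_closedBall {F : E3 → ℝ} {R : ℝ} (h : ContinuousOn F (B R)) :
    Measurable ((B R).indicator F) := by
  classical
  rw [← piecewise_eq_indicator]
  exact h.measurable_piecewise continuousOn_const Metric.isClosed_closedBall.measurableSet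

/-- The perturbation of the density caused by the deformation. -/
def srcOf (ρ : E3 → ℝ) (ζ : SpaceX) (y : E3) : ℝ :=
  (B 3).indicator (fun y => ρ (deformInv ζ.fn y)) y - ρ y

theorem srcOf_of_mem (ρ : E3 → ℝ) (ζ : SpaceX) {y : E3} (hy : y ∈ B 3) :
    srcOf ρ ζ y = ρ (deformInv ζ.fn y) - ρ y := by
  rw [srcOf, indicator_of_mem hy]

theorem RadialState.srcOf_of_notMem (h : RadialState U ρ u r c C) (ζ : SpaceX) {y : E3}
    (hy : y ∉ B 3) : srcOf ρ ζ y = 0 := by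
  have hy' : 3 < ‖y‖ := by rwa [mem_B, not_le] at hy
  rw [srcOf, indicator_of_notMem hy, h.ρ_eq, h.r_eq_zero _ (by linarith), sub_zero]

theorem RadialState.measurable_srcOf (h : RadialState U ρ u r c C) {ζ : SpaceX}
    (hζ : ‖ζ‖ ≤ 1 / 4) : Measurable (srcOf ρ ζ) := by
  have hc : ContinuousOn (fun y => ρ (deformInv ζ.fn y)) (B 3) :=
    h.contDiff_ρ.continuous.comp_continuousOn (continuousOn_deformInv hζ)
  exact (measurable_indicator_closedBall hc).sub
    h.contDiff_ρ.continuous.measurable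

theorem RadialState.srcOf_reflect (h : RadialState U ρ u r c C) {ζ : SpaceX}
    (hζ : ‖ζ‖ ≤ 1 / 4) (i : Fin 3) (y : E3) : srcOf ρ ζ (reflect i y) = srcOf ρ ζ y := by
  by_cases hy : y ∈ B 3
  · rw [srcOf_of_mem _ _ hy, srcOf_of_mem _ _ (reflect_mem_B.2 hy), deformInv_reflect hζ i hy,
      h.ρ_eq, h.ρ_eq (reflect i y), norm_reflect, norm_reflect, ← h.ρ_eq, ← h.ρ_eq]
  · rw [h.srcOf_of_notMem ζ hy, h.srcOf_of_notMem ζ fun h' => hy (reflect_mem_B.1 h')]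

theorem norm_deformInv_mem_Icc {ζ : SpaceX} (hζ : ‖ζ‖ ≤ 1 / 4) {y : E3} (hy : y ∈ B 3) :
    ‖deformInv ζ.fn y‖ ∈ Icc (0 : ℝ) 5 := norm_mem_Icc (deformInv_mem hζ hy)

theorem B3_subset_B4 {y : E3} (hy : y ∈ B 3) : y ∈ B 4 :=
  mem_B.2 ((mem_B.1 hy).trans (by norm_num))

/-- The radii of `y` and of its preimage differ by `ζ` at the preimage, which is at most `2 ‖ζ‖
|y|`. Hence the perturbation of the density vanishes linearly at the origin, with a constant linear
in `‖ζ‖`. -/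
theorem RadialState.srcL_srcOf (h : RadialState U ρ u r c C) {K : ℝ}
    (hK : ∀ s ∈ Icc (0 : ℝ) 5, |deriv r s| ≤ K) {ζ : SpaceX} (hζ : ‖ζ‖ ≤ 1 / 4) :
    SrcL (srcOf ρ ζ) (2 * K * ‖ζ‖) where
  meas := (h.measurable_srcOf hζ).aestronglyMeasurable
  supp y hy := h.srcOf_of_notMem ζ (by rwa [mem_B, not_le])
  bound y := by
    have hK0 : 0 ≤ K := (abs_nonneg _).trans (hK 0 (by simp))
    by_cases hy : y ∈ B 3
    · rw [srcOf_of_mem _ _ hy, h.ρ_eq, h.ρ_eq y]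
      refine (abs_sub_le_of_deriv h.contDiff_r hK (norm_mem_Icc (B3_subset_B4 hy))
        (norm_deformInv_mem_Icc hζ hy)).trans ?_
      have e : ‖deformInv ζ.fn y‖ - ‖y‖ = -ζ.fn (deformInv ζ.fn y) := by
        have := norm_eq_deformInv hζ hy
        linarith
      rw [e, abs_neg]
      calc K * |ζ.fn (deformInv ζ.fn y)| ≤ K * (2 * ‖ζ‖ * ‖y‖) := by
            gcongr; exact abs_deformInv_le hζ hy
        _ = _ := by ring
    · rw [h.srcOf_of_notMem ζ hy, abs_zero]
      positivity

/-- The density `q W` generated by `W = u' ζ`. -/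
def linSrc (u r : ℝ → ℝ) (ζ : SpaceX) (y : E3) : ℝ := qr u r ‖y‖ * (deriv u ‖y‖ * ζ.fn y)

theorem RadialState.linSrc_eq (h : RadialState U ρ u r c C) (ζ : SpaceX) (y : E3) :
    linSrc u r ζ y = -(deriv r ‖y‖ * ζ.fn y) := by
  rcases eq_or_ne y 0 with rfl | hy
  · simp [linSrc, ζ.mem.map_zero]
  · rw [linSrc, ← mul_assoc, h.qr_mul (norm_pos_iff.2 hy), neg_mul]

theorem RadialState.linSrc_of_notMem (h : RadialState U ρ u r c C) (ζ : SpaceX) {y : E3}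
    (hy : y ∉ B 3) : linSrc u r ζ y = 0 := by
  have hy' : 3 < ‖y‖ := by rwa [mem_B, not_le] at hy
  rw [linSrc, h.qr_eq_zero (by linarith), zero_mul]

theorem SpaceX.measurable (ζ : SpaceX) : Measurable ζ.fn := by
  have h1 := measurable_indicator_closedBall ζ.mem.continuousOn
  have h2 : (B 4).indicator ζ.fn = ζ.fn := by
    funext x
    by_cases hx : x ∈ B 4
    · rw [indicator_of_mem hx]
    · rw [indicator_of_notMem hx, ζ.mem.eq_zero_off x hx]
  rwa [h2] at h1

theorem SpaceX.fn_reflect (ζ : SpaceX) (i : Fin 3) (y : E3) : ζ.fn (reflect i y) = ζ.fn y := by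
  by_cases hy : y ∈ B 4
  · exact ζ.mem.symm i y hy
  · rw [ζ.mem.eq_zero_off y hy, ζ.mem.eq_zero_off _ fun h => hy (reflect_mem_B.1 h)]

theorem measurable_linSrc (u r : ℝ → ℝ) (hu : Continuous (deriv u)) (ζ : SpaceX) :
    Measurable (linSrc u r ζ) :=
  ((measurable_qr u r).comp measurable_norm).mul
    ((hu.comp continuous_norm).measurable.mul ζ.measurable)

theorem RadialState.srcL_linSrc (h : RadialState U ρ u r c C) {K : ℝ}
    (hK : ∀ s ∈ Icc (0 : ℝ) 5, |deriv r s| ≤ K) (ζ : SpaceX) :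
    SrcL (linSrc u r ζ) (K * ‖ζ‖) where
  meas := (measurable_linSrc u r h.contDiff_deriv_u.continuous ζ).aestronglyMeasurable
  supp y hy := h.linSrc_of_notMem ζ (by rwa [mem_B, not_le])
  bound y := by
    have hK0 : 0 ≤ K := (abs_nonneg _).trans (hK 0 (by simp))
    by_cases hy : y ∈ B 3
    · rw [h.linSrc_eq, abs_neg, abs_mul, mul_assoc]
      exact mul_le_mul (hK _ (norm_mem_Icc (B3_subset_B4 hy))) (ζ.abs_le (B3_subset_B4 hy))
        (abs_nonneg _) hK0
    · rw [h.linSrc_of_notMem ζ hy, abs_zero]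
      positivity

theorem linSrc_reflect (u r : ℝ → ℝ) (ζ : SpaceX) (i : Fin 3) (y : E3) :
    linSrc u r ζ (reflect i y) = linSrc u r ζ y := by
  rw [linSrc, linSrc, norm_reflect, ζ.fn_reflect]

/-- The linearisation of the perturbed density. -/
theorem RadialState.exists_srcL_sub (h : RadialState U ρ u r c C) {ε : ℝ} (hε : 0 < ε) :
    ∃ δ > 0, δ ≤ 1 / 4 ∧ ∀ ζ : SpaceX, ‖ζ‖ < δ →
      SrcL (fun y => srcOf ρ ζ y - linSrc u r ζ y) (ε * ‖ζ‖) := by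
  obtain ⟨K, hK0, hK⟩ := exists_abs_deriv_le h.contDiff_r
  obtain ⟨δ, hδ, hT⟩ := exists_taylor_modulus h.contDiff_r (show 0 < ε / 4 by positivity)
  refine ⟨min (min (1 / 4) (δ / 8)) (ε / (4 * (K + 1))), by positivity,
    (min_le_left _ _).trans (min_le_left _ _), fun ζ hζ => ?_⟩
  have hζ1 : ‖ζ‖ ≤ 1 / 4 := (hζ.le.trans (min_le_left _ _)).trans (min_le_left _ _)
  have hζ2 : ‖ζ‖ < δ / 8 := (hζ.trans_le (min_le_left _ _)).trans_le (min_le_right _ _)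
  have hζ3 : ‖ζ‖ * (4 * (K + 1)) < ε := by
    have := hζ.trans_le (min_le_right _ _)
    rwa [lt_div_iff₀ (by positivity)] at this
  refine ⟨((h.measurable_srcOf hζ1).sub
    (measurable_linSrc u r h.contDiff_deriv_u.continuous ζ)).aestronglyMeasurable,
    fun y => ?_, fun y hy => ?_⟩
  · by_cases hy : y ∈ B 3
    · have hy4 := B3_subset_B4 hy
      have hz := deformInv_mem hζ1 hy
      have hyn : ‖y‖ ≤ 3 := mem_B.1 hy
      rw [srcOf_of_mem _ _ hy, h.linSrc_eq, h.ρ_eq, h.ρ_eq y]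
      set z := deformInv ζ.fn y with hzdef
      have e : ‖z‖ - ‖y‖ = -ζ.fn z := by
        have := norm_eq_deformInv hζ1 hy
        linarith
      have hab := abs_deformInv_le hζ1 hy
      have hlt : |‖z‖ - ‖y‖| < δ := by
        rw [e, abs_neg]
        refine hab.trans_lt ?_
        nlinarith [norm_nonneg ζ, norm_nonneg y]
      have h1 := hT _ (norm_mem_Icc hy4) _ (norm_deformInv_mem_Icc hζ1 hy) hlt
      rw [e, abs_neg] at h1
      have h2 : |ζ.fn y - ζ.fn z| ≤ ‖ζ‖ * (2 * ‖ζ‖ * ‖y‖) := by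
        refine (ζ.abs_sub_le hz hy4).trans ?_
        rw [norm_deformInv_sub hζ1 hy]
        gcongr
      have h3 : |deriv r ‖y‖ * (ζ.fn y - ζ.fn z)| ≤ K * (‖ζ‖ * (2 * ‖ζ‖ * ‖y‖)) := by
        rw [abs_mul]
        exact mul_le_mul (hK _ (norm_mem_Icc hy4)) h2 (abs_nonneg _) hK0
      -- Two errors: Taylor's formula for the profile, and evaluation of `ζ` at `y` instead of its
      -- preimage `z`. The second is quadratic in `‖ζ‖`, as `ζ` is Lipschitz and `|y - z| = |ζ(z)|`.
      have e2 : r ‖z‖ - r ‖y‖ - -(deriv r ‖y‖ * ζ.fn y)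
          = (r ‖z‖ - r ‖y‖ - deriv r ‖y‖ * -ζ.fn z) + deriv r ‖y‖ * (ζ.fn y - ζ.fn z) := by ring
      rw [e2]
      refine (abs_add_le _ _).trans ?_
      have h4 : ε / 4 * |ζ.fn z| ≤ ε / 4 * (2 * ‖ζ‖ * ‖y‖) := by gcongr
      have h5 : 0 ≤ ‖ζ‖ * ‖y‖ := by positivity
      have h6 : K * (‖ζ‖ * (2 * ‖ζ‖ * ‖y‖)) ≤ ε / 2 * (‖ζ‖ * ‖y‖) := by
        have : K * ‖ζ‖ * 2 ≤ ε / 2 := by nlinarith [norm_nonneg ζ]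
        calc K * (‖ζ‖ * (2 * ‖ζ‖ * ‖y‖)) = (K * ‖ζ‖ * 2) * (‖ζ‖ * ‖y‖) := by ring
          _ ≤ _ := by gcongr
      calc _ ≤ ε / 4 * (2 * ‖ζ‖ * ‖y‖) + ε / 2 * (‖ζ‖ * ‖y‖) :=
            add_le_add (h1.trans h4) (h3.trans h6)
        _ = ε * ‖ζ‖ * ‖y‖ := by ring
    · rw [h.srcOf_of_notMem ζ hy, h.linSrc_of_notMem ζ hy, sub_zero, abs_zero]
      positivity
  · have hy' : y ∉ B 3 := by rwa [mem_B, not_le]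
    rw [h.srcOf_of_notMem ζ hy', h.linSrc_of_notMem ζ hy', sub_zero]

end

/-! ### The linearised equation -/

section

open BoundedContinuousFunction

/-- The Fredholm alternative on an invariant closed subspace. -/
theorem fredholm_on_submodule {X : Type*} [NormedAddCommGroup X] [NormedSpace ℝ X]
    [CompleteSpace X] (T : X →ₗ[ℝ] X) (hT : IsCompactOperator T) (V : Submodule ℝ X)
    (hVc : IsClosed (V : Set X)) (hTV : ∀ v ∈ V, T v ∈ V) (hinj : ∀ v ∈ V, T v = v → v = 0) :
    (∀ f ∈ V, ∃ v ∈ V, v - T v = f) ∧ ∃ K, 0 ≤ K ∧ ∀ v ∈ V, ‖v‖ ≤ K * ‖v - T v‖ := by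
  have : CompleteSpace V := hVc.completeSpace_coe
  have hcomp : IsCompactOperator (T.restrict hTV) := hT.restrict' hTV
  set S : V →L[ℝ] V := ContinuousLinearMap.mkOfIsCompactOperator hcomp with hS
  have hSc : IsCompactOperator S := hcomp
  have hSapp : ∀ v : V, ((S v : V) : X) = T v := fun v => rfl
  have hunit : IsUnit (1 - S) := by
    -- For a compact operator the nonzero number `1` is an eigenvalue or lies in the resolvent set;
    -- injectivity on the subspace excludes the former.
    rcases hSc.hasEigenvalue_or_mem_resolventSet one_ne_zero with hev | hr
    · obtain ⟨v, hv⟩ := hev.exists_hasEigenvector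
      have h1 : S v = v := by simpa using hv.apply_eq_smul
      exact absurd (Subtype.ext (hinj v v.2 (by rw [← hSapp, h1]))) hv.2
    · have h1 : IsUnit (algebraMap ℝ (V →L[ℝ] V) 1 - S) := hr
      rwa [map_one] at h1
  obtain ⟨R, hR⟩ := hunit
  set A : V →L[ℝ] V := ↑R⁻¹ with hA
  refine ⟨fun f hf => ⟨A ⟨f, hf⟩, (A ⟨f, hf⟩).2, ?_⟩, ‖A‖, A.opNorm_nonneg, fun v hv => ?_⟩
  · have h1 : (1 - S) (A ⟨f, hf⟩) = ⟨f, hf⟩ := by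
      have h2 : (1 - S) * A = 1 := by rw [← hR]; exact R.mul_inv
      exact DFunLike.congr_fun h2 ⟨f, hf⟩
    exact congrArg Subtype.val h1
  · have h1 : A ((1 - S) ⟨v, hv⟩) = ⟨v, hv⟩ := by
      have h2 : A * (1 - S) = 1 := by rw [← hR]; exact R.inv_mul
      exact DFunLike.congr_fun h2 ⟨v, hv⟩
    have h3 := A.le_opNorm ((1 - S) ⟨v, hv⟩)
    rw [h1] at h3
    exact h3

/-- The potential `S W` generated by the density `q W`, normalised to vanish at the origin. -/
def linPot (u r : ℝ → ℝ) (W : E3 → ℝ) (x : E3) : ℝ :=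
  pot (fun y => qr u r ‖y‖ * W y) x - pot (fun y => qr u r ‖y‖ * W y) 0

theorem Src.pot_add {f g : E3 → ℝ} {M N : ℝ} (hf : Src f M) (hg : Src g N) (x : E3) :
    pot (fun y => f y + g y) x = pot f x + pot g x := by
  unfold pot
  rw [← integral_add (hf.integrable_pot x).1 (hg.integrable_pot x).1]
  simp only [add_div]

instance : CompactSpace (B 4) := isCompact_iff_compactSpace.1 (isCompact_closedBall 0 4)

/-- Extension by zero of a function on the ball. -/
def extB (W : B 4 → ℝ) : E3 → ℝ := Function.extend Subtype.val W 0

theorem extB_of_mem (W : B 4 → ℝ) {x : E3} (hx : x ∈ B 4) : extB W x = W ⟨x, hx⟩ :=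
  Subtype.val_injective.extend_apply W 0 ⟨x, hx⟩

theorem extB_of_notMem (W : B 4 → ℝ) {x : E3} (hx : x ∉ B 4) : extB W x = 0 :=
  Function.extend_apply' _ _ _ fun ⟨a, ha⟩ => hx (ha ▸ a.2)

theorem measurable_extB {W : B 4 → ℝ} (hW : Continuous W) : Measurable (extB W) :=
  (MeasurableEmbedding.subtype_coe Metric.isClosed_closedBall.measurableSet).measurable_extend
    hW.measurable measurable_const

theorem extB_add (V W : B 4 → ℝ) (x : E3) : extB (V + W) x = extB V x + extB W x := by
  by_cases hx : x ∈ B 4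
  · simp only [extB_of_mem _ hx, Pi.add_apply]
  · simp only [extB_of_notMem _ hx, add_zero]

theorem extB_smul (a : ℝ) (W : B 4 → ℝ) (x : E3) : extB (a • W) x = a * extB W x := by
  by_cases hx : x ∈ B 4
  · simp only [extB_of_mem _ hx, Pi.smul_apply, smul_eq_mul]
  · simp only [extB_of_notMem _ hx, mul_zero]

theorem abs_extB_le (W : B 4 →ᵇ ℝ) (x : E3) : |extB W x| ≤ ‖W‖ := by
  by_cases hx : x ∈ B 4
  · rw [extB_of_mem _ hx]; exact W.norm_coe_le_norm _
  · rw [extB_of_notMem _ hx, abs_zero]; exact norm_nonneg _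

/-- The restriction to the ball as a bounded continuous function. -/
def resB (W : E3 → ℝ) (hW : ContinuousOn W (B 4)) : B 4 →ᵇ ℝ :=
  BoundedContinuousFunction.mkOfCompact ⟨(B 4).domRestrict W, hW.domRestrict⟩

theorem resB_apply (W : E3 → ℝ) (hW : ContinuousOn W (B 4)) (x : B 4) : resB W hW x = W x := rfl

theorem MemCS.extB_resB {W : E3 → ℝ} (hW : MemCS W) : extB (resB W hW.continuousOn) = W := by
  funext x
  by_cases hx : x ∈ B 4
  · rw [extB_of_mem _ hx, resB_apply]
  · rw [extB_of_notMem _ hx, hW.eq_zero_off x hx]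

theorem MemCS.reflect {W : E3 → ℝ} (hW : MemCS W) (i : Fin 3) (x : E3) :
    W (reflect i x) = W x := by
  by_cases hx : x ∈ B 4
  · exact hW.symm i x hx
  · rw [hW.eq_zero_off x hx, hW.eq_zero_off _ fun h => hx (reflect_mem_B.1 h)]

theorem MemCS.measurable {W : E3 → ℝ} (hW : MemCS W) : Measurable W := by
  rw [← hW.extB_resB]
  exact measurable_extB (resB W hW.continuousOn).continuous

variable {U ρ : E3 → ℝ} {u r : ℝ → ℝ} {c C : ℝ}

theorem abs_linPot_sub_le {W : E3 → ℝ} {M : ℝ} (h : Src (fun y => qr u r ‖y‖ * W y) M) (x y : E3) :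
    |linPot u r W x - linPot u r W y| ≤ M * Ck * ‖x - y‖ := by
  rw [linPot, linPot, sub_sub_sub_cancel_right]
  exact h.abs_pot_sub_le y x

theorem linPot_zero (W : E3 → ℝ) : linPot u r W 0 = 0 := sub_self _

theorem abs_linPot_le {W : E3 → ℝ} {M : ℝ} (h : Src (fun y => qr u r ‖y‖ * W y) M) (x : E3) :
    |linPot u r W x| ≤ M * Ck * ‖x‖ := by
  have := abs_linPot_sub_le h x 0
  rwa [linPot_zero, sub_zero, sub_zero] at this

theorem continuous_linPot {W : E3 → ℝ} {M : ℝ} (h : Src (fun y => qr u r ‖y‖ * W y) M) :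
    Continuous (linPot u r W) :=
  (continuous_iff_continuousAt.2 fun x => (h.hasFDerivAt_pot x).continuousAt).sub continuous_const

theorem linPot_reflect {W : E3 → ℝ} (hW : ∀ i x, W (reflect i x) = W x) (i : Fin 3) (x : E3) :
    linPot u r W (reflect i x) = linPot u r W x := by
  have e : (fun y => qr u r ‖y‖ * W y) = fun y => (fun y => qr u r ‖y‖ * W y) (reflIso i y) := by
    funext y
    simp only [reflIso_apply, norm_reflect, hW]
  rw [linPot, linPot, ← reflIso_apply, ← pot_comp, ← e]

theorem RadialState.src_extB (h : RadialState U ρ u r c C) (W : B 4 →ᵇ ℝ) :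
    Src (fun y => qr u r ‖y‖ * extB W y) (C * ‖W‖) :=
  h.src_mul (norm_nonneg W) (measurable_extB W.continuous).aestronglyMeasurable
    fun y _ => abs_extB_le W y

/-- The operator `W ↦ S W` on the continuous functions on the ball. -/
def RadialState.op (h : RadialState U ρ u r c C) : (B 4 →ᵇ ℝ) →ₗ[ℝ] (B 4 →ᵇ ℝ) where
  toFun W := resB (linPot u r (extB W)) (continuous_linPot (h.src_extB W)).continuousOn
  map_add' V W := by
    ext x
    simp only [resB_apply, BoundedContinuousFunction.coe_add, Pi.add_apply, linPot]
    have e : (fun y => qr u r ‖y‖ * extB (V + W) y)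
        = fun y => qr u r ‖y‖ * extB V y + qr u r ‖y‖ * extB W y := by
      funext y; rw [extB_add, mul_add]
    rw [e, (h.src_extB V).pot_add (h.src_extB W), (h.src_extB V).pot_add (h.src_extB W)]
    ring
  map_smul' a W := by
    ext x
    simp only [resB_apply, BoundedContinuousFunction.coe_smul, linPot, RingHom.id_apply,
      smul_eq_mul]
    have e : (fun y => qr u r ‖y‖ * extB (a • (W : B 4 → ℝ)) y)
        = fun y => a * (qr u r ‖y‖ * extB W y) := by
      funext y; rw [extB_smul]; ring
    change pot (fun y => qr u r ‖y‖ * extB (a • (W : B 4 → ℝ)) y) x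
      - pot (fun y => qr u r ‖y‖ * extB (a • (W : B 4 → ℝ)) y) 0 = _
    rw [e, pot_smul, pot_smul]
    ring

theorem RadialState.op_apply (h : RadialState U ρ u r c C) (W : B 4 →ᵇ ℝ) (x : B 4) :
    h.op W x = linPot u r (extB W) x := rfl

theorem RadialState.norm_op_le (h : RadialState U ρ u r c C) (W : B 4 →ᵇ ℝ) :
    ‖h.op W‖ ≤ C * Ck * 4 * ‖W‖ := by
  have hC := h.C_nonneg
  have hCk := Ck_nonneg
  refine (BoundedContinuousFunction.norm_le (by positivity)).2 fun x => ?_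
  rw [h.op_apply, Real.norm_eq_abs]
  refine (abs_linPot_le (h.src_extB W) x).trans ?_
  have hx : ‖(x : E3)‖ ≤ 4 := mem_B.1 x.2
  calc C * ‖W‖ * Ck * ‖(x : E3)‖ ≤ C * ‖W‖ * Ck * 4 := by gcongr
    _ = _ := by ring

/-- Arzelà–Ascoli: bounded densities have potentials with uniformly bounded gradients, so the image
of the unit ball is uniformly bounded and equi-Lipschitz. -/
theorem RadialState.isCompactOperator_op (h : RadialState U ρ u r c C) :
    IsCompactOperator h.op := by
  rw [isCompactOperator_iff_isCompact_closure_image_closedBall h.op one_pos]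
  have hC := h.C_nonneg
  have hCk := Ck_nonneg
  refine arzela_ascoli (Metric.closedBall 0 (C * Ck * 4)) (isCompact_closedBall _ _) _ ?_ ?_
  · rintro _ x ⟨W, hW, rfl⟩
    rw [mem_closedBall_zero_iff] at hW ⊢
    calc ‖h.op W x‖ ≤ ‖h.op W‖ := (h.op W).norm_coe_le_norm x
      _ ≤ C * Ck * 4 * ‖W‖ := h.norm_op_le W
      _ ≤ C * Ck * 4 * 1 := by gcongr
      _ = _ := mul_one _
  · refine (LipschitzWith.uniformEquicontinuous _ (Real.toNNReal (C * Ck)) ?_).equicontinuous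
    rintro ⟨_, W, hW, rfl⟩
    rw [mem_closedBall_zero_iff] at hW
    refine LipschitzWith.of_dist_le_mul fun x y => ?_
    rw [Real.coe_toNNReal _ (by positivity), Real.dist_eq, Subtype.dist_eq, dist_eq_norm]
    refine (abs_linPot_sub_le (h.src_extB W) x y).trans ?_
    calc C * ‖W‖ * Ck * ‖(x : E3) - y‖ ≤ C * 1 * Ck * ‖(x : E3) - y‖ := by gcongr
      _ = _ := by ring

/-- The reflection of the ball. -/
def reflB (i : Fin 3) (x : B 4) : B 4 := ⟨reflect i x, reflect_mem_B.2 x.2⟩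

/-- The functions with the reflection symmetries. -/
def symB : Submodule ℝ (B 4 →ᵇ ℝ) where
  carrier := {W | ∀ i x, W (reflB i x) = W x}
  zero_mem' _ _ := rfl
  add_mem' hV hW i x := by
    simp only [BoundedContinuousFunction.coe_add, Pi.add_apply, hV i x, hW i x]
  smul_mem' a W hW i x := by
    simp only [BoundedContinuousFunction.coe_smul, hW i x]

theorem isClosed_symB : IsClosed (symB : Set (B 4 →ᵇ ℝ)) := by
  have : (symB : Set (B 4 →ᵇ ℝ)) = ⋂ i, ⋂ x, {W : B 4 →ᵇ ℝ | W (reflB i x) = W x} := by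
    ext W
    simp only [mem_iInter]
    rfl
  rw [this]
  exact isClosed_iInter fun i => isClosed_iInter fun x =>
    isClosed_eq (continuous_eval_const _)
      (continuous_eval_const _)

theorem extB_reflect {W : B 4 →ᵇ ℝ} (hW : W ∈ symB) (i : Fin 3) (x : E3) :
    extB W (reflect i x) = extB W x := by
  by_cases hx : x ∈ B 4
  · rw [extB_of_mem _ hx, extB_of_mem _ (reflect_mem_B.2 hx)]
    exact hW i ⟨x, hx⟩
  · rw [extB_of_notMem _ hx, extB_of_notMem _ fun h => hx (reflect_mem_B.1 h)]

theorem MemCS.resB_mem {W : E3 → ℝ} (hW : MemCS W) : resB W hW.continuousOn ∈ symB :=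
  fun i x => hW.symm i x x.2

theorem RadialState.op_mem (h : RadialState U ρ u r c C) (W : B 4 →ᵇ ℝ) (hW : W ∈ symB) :
    h.op W ∈ symB := fun i x => by
  rw [h.op_apply, h.op_apply]
  exact linPot_reflect (extB_reflect hW) i x

/-- The uniqueness theorem concerns functions on the whole space. The potential itself furnishes the
continuous extension: it agrees with `W` on the ball, and outside it the weight is zero. -/
theorem RadialState.eq_zero_of_op_eq (h : RadialState U ρ u r c C) {W : B 4 →ᵇ ℝ} (hW : W ∈ symB)
    (he : h.op W = W) : W = 0 := by
  obtain ⟨V, hV⟩ : ∃ V, V = linPot u r (extB W) := ⟨_, rfl⟩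
  have hVW : ∀ x (hx : x ∈ B 4), V x = extB W x := fun x hx => by
    have h1 := h.op_apply W ⟨x, hx⟩
    rw [he] at h1
    rw [extB_of_mem W hx, h1, hV]
  have e : (fun y => qr u r ‖y‖ * V y) = fun y => qr u r ‖y‖ * extB W y := by
    funext y
    by_cases hy : y ∈ B 4
    · rw [hVW y hy]
    · have : 4 < ‖y‖ := by rwa [mem_B, not_le] at hy
      rw [h.qr_eq_zero (by linarith), zero_mul, zero_mul]
  have h0 := h.eq_zero_of_linearized (W := V) (by rw [hV]; exact continuous_linPot (h.src_extB W))
    (fun i x => by rw [hV]; exact linPot_reflect (extB_reflect hW) i x) (fun x => by rw [e, hV, linPot])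
  ext x
  have := hVW x x.2
  rw [h0, extB_of_mem _ x.2] at this
  exact this.symm

/-- Unique solvability of the linearised equation. -/
theorem RadialState.exists_solution (h : RadialState U ρ u r c C) :
    (∀ F, MemCS F → ∃ W, MemCS W ∧ ∀ x ∈ B 4, W x - linPot u r W x = F x) ∧
    ∃ K, 0 ≤ K ∧ ∀ W, MemCS W → ∀ M, 0 ≤ M → (∀ x ∈ B 4, |W x - linPot u r W x| ≤ M) →
      ∀ x ∈ B 4, |W x| ≤ K * M := by
  obtain ⟨h1, K, hK, h2⟩ := fredholm_on_submodule (X := B 4 →ᵇ ℝ) h.op h.isCompactOperator_op symB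
    isClosed_symB h.op_mem fun W hW he => h.eq_zero_of_op_eq hW he
  refine ⟨fun F hF => ?_, K, hK, fun W hW M hM hb x hx => ?_⟩
  · obtain ⟨V, hV, hVF⟩ := h1 _ hF.resB_mem
    refine ⟨extB V, ⟨fun x hx => extB_of_notMem V hx, ?_, fun i x _ => extB_reflect hV i x⟩,
      fun x hx => ?_⟩
    · rw [continuousOn_iff_continuous_domRestrict]
      refine V.continuous.congr fun x => ?_
      rw [domRestrict_apply, extB_of_mem V x.2]
    · have h3 := DFunLike.congr_fun hVF ⟨x, hx⟩
      rw [extB_of_mem V hx]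
      exact h3
  · have h3 : ‖resB W hW.continuousOn - h.op (resB W hW.continuousOn)‖ ≤ M := by
      refine (BoundedContinuousFunction.norm_le hM).2 fun x => ?_
      have h3 := hb x x.2
      rw [Real.norm_eq_abs]
      refine le_of_eq_of_le (congrArg _ ?_) h3
      change W x - linPot u r (extB (resB W hW.continuousOn)) x = _
      rw [hW.extB_resB]
    calc |W x| ≤ ‖resB W hW.continuousOn‖ := (resB W hW.continuousOn).norm_coe_le_norm ⟨x, hx⟩
      _ ≤ K * ‖resB W hW.continuousOn - h.op (resB W hW.continuousOn)‖ := h2 _ hW.resB_mem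
      _ ≤ K * M := by gcongr

end

/-! ### The linearised operator on `Y`. -/

theorem SpaceY.fn_sub (f g : SpaceY) : (f - g).fn = f.fn - g.fn := rfl

theorem SpaceY.fn_off (f : SpaceY) {x : E3} (hx : x ∉ B 4) : f.fn x = 0 := f.mem.eq_zero_off x hx

theorem SpaceY.ext_B4 {f g : SpaceY} (h : ∀ x ∈ B 4, f.fn x = g.fn x) : f = g :=
  SpaceY.fn_injective (funext fun x => by
    by_cases hx : x ∈ B 4
    · exact h x hx
    · rw [f.fn_off hx, g.fn_off hx])

theorem SpaceY.grad_add {f g : SpaceY} {x : E3} (hx : x ∈ B 4) :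
    grad (f + g).fn x = grad f.fn x + grad g.fn x :=
  RotatingVP.grad_add hx (f.mem.diff hx) (g.mem.diff hx)

theorem SpaceY.grad_sub {f g : SpaceY} {x : E3} (hx : x ∈ B 4) :
    grad (f - g).fn x = grad f.fn x - grad g.fn x := by
  rw [eq_sub_iff_add_eq, ← SpaceY.grad_add hx, sub_add_cancel]

theorem norm_zero_le_quarter : ‖(0 : SpaceX)‖ ≤ 1 / 4 := by rw [norm_zero]; norm_num

theorem SpaceY.abs_le_linear (W : SpaceY) {x : E3} (hx : x ∈ B 4) :
    |W.fn x| ≤ 4 * ‖W‖ * ‖x‖ := by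
  refine (W.abs_le hx).trans ?_
  have h1 : ‖x‖ ≤ 4 := mem_B.1 hx
  have h2 : 0 ≤ ‖W‖ * ‖x‖ := by positivity
  nlinarith

section

variable {U ρ : E3 → ℝ} {u r : ℝ → ℝ} {c C : ℝ}

theorem mem_B4_of_norm_le_one {y : E3} (hy : ‖y‖ ≤ 1) : y ∈ B 4 :=
  mem_B.2 (hy.trans (by norm_num))

theorem RadialState.srcL_of_memCS (h : RadialState U ρ u r c C) {W : E3 → ℝ} (hW : MemCS W) {M : ℝ}
    (hM : 0 ≤ M) (hb : ∀ x ∈ B 4, |W x| ≤ M * ‖x‖) : SrcL (fun y => qr u r ‖y‖ * W y) (C * M) :=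
  h.srcL_mul hM hW.measurable.aestronglyMeasurable fun y hy => hb y (mem_B4_of_norm_le_one hy)

theorem qr_mul_reflect {W : E3 → ℝ} (hW : MemCS W) (i : Fin 3) (y : E3) :
    qr u r ‖reflect i y‖ * W (reflect i y) = qr u r ‖y‖ * W y := by
  rw [norm_reflect, hW.reflect]

theorem RadialState.isPotential_mul (h : RadialState U ρ u r c C) {W : E3 → ℝ} (hW : MemCS W)
    {M : ℝ} (hM : 0 ≤ M) (hb : ∀ x ∈ B 4, |W x| ≤ M * ‖x‖) :
    IsPotential (pot fun y => qr u r ‖y‖ * W y)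
      (fun x => innerSL ℝ (gradPot (fun y => qr u r ‖y‖ * W y) x)) :=
  (h.srcL_of_memCS hW hM hb).isPotential (qr_mul_reflect hW)

theorem even_of_reflect {f : E3 → ℝ} (hf : ∀ i y, f (reflect i y) = f y) (y : E3) :
    f (-y) = f y := by rw [neg_eq_reflect, hf, hf, hf]

/-- The potential `S W` as an element of `Y`. -/
def RadialState.potY (h : RadialState U ρ u r c C) {W : E3 → ℝ} (hW : MemCS W) {M : ℝ}
    (hM : 0 ≤ M) (hb : ∀ x ∈ B 4, |W x| ≤ M * ‖x‖) : SpaceY :=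
  mkY (cutComp (pot fun y => qr u r ‖y‖ * W y) 0)
    ((h.isPotential_mul hW hM hb).memY_comp norm_zero_le_quarter)

theorem RadialState.potY_apply (h : RadialState U ρ u r c C) {W : E3 → ℝ} (hW : MemCS W) {M : ℝ}
    (hM : 0 ≤ M) (hb : ∀ x ∈ B 4, |W x| ≤ M * ‖x‖) {x : E3} (hx : x ∈ B 4) :
    (h.potY hW hM hb).fn x = linPot u r W x := by
  rw [potY, mkY_fn, cutComp_of_mem _ _ hx, deform_zero_fn, linPot]

theorem RadialState.grad_potY (h : RadialState U ρ u r c C) {W : E3 → ℝ} (hW : MemCS W) {M : ℝ}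
    (hM : 0 ≤ M) (hb : ∀ x ∈ B 4, |W x| ≤ M * ‖x‖) {x : E3} (hx : x ∈ B4') :
    grad (h.potY hW hM hb).fn x = innerSL ℝ (gradPot (fun y => qr u r ‖y‖ * W y) x) := by
  rw [potY, mkY_fn, (h.isPotential_mul hW hM hb).grad_comp 0 hx, compD_zero hx]

theorem norm_le_five {x : E3} (hx : x ∈ B 4) : ‖x‖ ≤ 5 := (mem_B.1 hx).trans (by norm_num)

theorem RadialState.norm_potY_le (h : RadialState U ρ u r c C) {W : E3 → ℝ} (hW : MemCS W) {M : ℝ}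
    (hM : 0 ≤ M) (hb : ∀ x ∈ B 4, |W x| ≤ M * ‖x‖) :
    ‖h.potY hW hM hb‖ ≤ 6 * (C * M) * Ck := by
  have hC := h.C_nonneg
  have hCk := Ck_nonneg
  refine SpaceY.norm_le (by positivity) fun x hx => ?_
  rw [h.grad_potY hW hM hb hx, innerSL_apply_norm]
  exact (h.srcL_of_memCS hW hM hb).norm_gradPot_le (even_of_reflect (f := fun y => qr u r ‖y‖ * W y)
    (qr_mul_reflect hW))
    (norm_le_five hx.1)

/-- The potential of an element of `Y`. -/
def RadialState.potOf (h : RadialState U ρ u r c C) (W : SpaceY) : SpaceY :=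
  h.potY W.mem.toMemCS (mul_nonneg four_pos.le (norm_nonneg W)) fun _ hx => W.abs_le_linear hx

theorem RadialState.potOf_apply (h : RadialState U ρ u r c C) (W : SpaceY) {x : E3}
    (hx : x ∈ B 4) : (h.potOf W).fn x = linPot u r W.fn x := h.potY_apply _ _ _ hx

theorem RadialState.src_of_memY (h : RadialState U ρ u r c C) (W : SpaceY) :
    Src (fun y => qr u r ‖y‖ * W.fn y) (3 * (C * (4 * ‖W‖))) :=
  (h.srcL_of_memCS W.mem.toMemCS (mul_nonneg four_pos.le (norm_nonneg W))
    fun _ hx => W.abs_le_linear hx).src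

/-- The operator `W ↦ S W - W` on `Y`. -/
def RadialState.linOp (h : RadialState U ρ u r c C) : SpaceY →ₗ[ℝ] SpaceY where
  toFun W := h.potOf W - W
  map_add' V W := SpaceY.ext_B4 fun x hx => by
    simp only [SpaceY.fn_sub, SpaceY.fn_add, Pi.sub_apply, Pi.add_apply, h.potOf_apply _ hx, linPot,
      mul_add, (h.src_of_memY V).pot_add (h.src_of_memY W)]
    ring
  map_smul' a W := SpaceY.ext_B4 fun x hx => by
    simp only [SpaceY.fn_sub, SpaceY.fn_smul, Pi.sub_apply, Pi.smul_apply, h.potOf_apply _ hx,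
      linPot, smul_eq_mul, RingHom.id_apply, mul_left_comm _ a, pot_smul]
    ring

theorem RadialState.linOp_apply (h : RadialState U ρ u r c C) (W : SpaceY) :
    h.linOp W = h.potOf W - W := rfl

theorem RadialState.linOp_fn (h : RadialState U ρ u r c C) (W : SpaceY) {x : E3} (hx : x ∈ B 4) :
    W.fn x - linPot u r W.fn x = -(h.linOp W).fn x := by
  rw [h.linOp_apply, SpaceY.fn_sub, Pi.sub_apply, h.potOf_apply W hx, neg_sub]

theorem RadialState.norm_linOp_le (h : RadialState U ρ u r c C) (W : SpaceY) :
    ‖h.linOp W‖ ≤ (6 * (C * 4) * Ck + 1) * ‖W‖ := by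
  refine (norm_sub_le _ _).trans ?_
  have := h.norm_potY_le W.mem.toMemCS (mul_nonneg four_pos.le (norm_nonneg W))
    fun _ hx => W.abs_le_linear hx
  calc ‖h.potOf W‖ + ‖W‖ ≤ 6 * (C * (4 * ‖W‖)) * Ck + ‖W‖ := by gcongr; exact this
    _ = _ := by ring

/-- Bootstrap: the supremum bound from the Fredholm alternative gives `|W| ≤ const |x|` through `W =
S W - F`; the density `q W` then vanishes linearly, which bounds `S W`, and so `W`, in the norm of
`Y`. -/
theorem RadialState.exists_norm_le_linOp (h : RadialState U ρ u r c C) :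
    ∃ K, 0 ≤ K ∧ ∀ W, ‖W‖ ≤ K * ‖h.linOp W‖ := by
  obtain ⟨-, K, hK, hb⟩ := h.exists_solution
  have hC := h.C_nonneg
  have hCk := Ck_nonneg
  refine ⟨6 * (C * (C * (K * 16) * Ck + 4)) * Ck + 1, by positivity, fun W => ?_⟩
  set F := h.linOp W with hF
  have hF0 : 0 ≤ ‖F‖ := norm_nonneg F
  have h1 : ∀ x ∈ B 4, |W.fn x| ≤ K * (16 * ‖F‖) :=
    hb W.fn W.mem.toMemCS _ (by positivity) fun x hx => by
      rw [h.linOp_fn W hx, abs_neg, ← hF]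
      have hx4 : ‖x‖ ≤ 4 := mem_B.1 hx
      calc |F.fn x| ≤ 4 * ‖F‖ * ‖x‖ := F.abs_le_linear hx
        _ ≤ 4 * ‖F‖ * 4 := by gcongr
        _ = _ := by ring
  have hsrc : Src (fun y => qr u r ‖y‖ * W.fn y) (C * (K * (16 * ‖F‖))) :=
    h.src_mul (by positivity) W.mem.toMemCS.measurable.aestronglyMeasurable
      fun y hy => h1 y (mem_B4_of_norm_le_one hy)
  have h2 : ∀ x ∈ B 4, |W.fn x| ≤ (C * (K * 16) * Ck + 4) * ‖F‖ * ‖x‖ := fun x hx => by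
    have e : W.fn x = linPot u r W.fn x - F.fn x := by
      have := h.linOp_fn W hx
      rw [← hF] at this
      linarith
    rw [e]
    calc |linPot u r W.fn x - F.fn x| ≤ |linPot u r W.fn x| + |F.fn x| := abs_sub _ _
      _ ≤ C * (K * (16 * ‖F‖)) * Ck * ‖x‖ + 4 * ‖F‖ * ‖x‖ :=
        add_le_add (abs_linPot_le hsrc x) (F.abs_le_linear hx)
      _ = _ := by ring
  have hM : 0 ≤ (C * (K * 16) * Ck + 4) * ‖F‖ := by positivity
  have h3 := h.norm_potY_le W.mem.toMemCS hM h2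
  have e : W = h.potY W.mem.toMemCS hM h2 - F := by
    have h4 : h.potY W.mem.toMemCS hM h2 = h.potOf W := SpaceY.ext_B4 fun x hx => by
      rw [h.potY_apply _ _ _ hx, h.potOf_apply _ hx]
    have h5 : F = h.potOf W - W := h.linOp_apply W
    rw [h4, h5, sub_sub_cancel]
  calc ‖W‖ = ‖h.potY W.mem.toMemCS hM h2 - F‖ := by rw [← e]
    _ ≤ ‖h.potY W.mem.toMemCS hM h2‖ + ‖F‖ := norm_sub_le _ _
    _ ≤ 6 * (C * ((C * (K * 16) * Ck + 4) * ‖F‖)) * Ck + ‖F‖ := by gcongr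
    _ = _ := by ring

/-- The same bootstrap as regularity: a merely continuous solution satisfies `W = S W + O(|x|)`, so
it is itself `O(|x|)`, and both terms on the right of the equation belong to `Y`. -/
theorem RadialState.surjective_linOp (h : RadialState U ρ u r c C) :
    Function.Surjective h.linOp := by
  intro F
  obtain ⟨W, hW, hWF⟩ := h.exists_solution.1 _ (-F).mem.toMemCS
  have hC := h.C_nonneg
  have hCk := Ck_nonneg
  obtain ⟨M, hM⟩ := (isCompact_closedBall (0 : E3) 4).exists_bound_of_continuousOn hW.continuousOn
  have hM0 : 0 ≤ M := (norm_nonneg _).trans (hM 0 zero_mem_B4)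
  have hsrc : Src (fun y => qr u r ‖y‖ * W y) (C * M) :=
    h.src_mul hM0 hW.measurable.aestronglyMeasurable
      fun y hy => hM y (mem_B4_of_norm_le_one hy)
  have hb : ∀ x ∈ B 4, |W x| ≤ (C * M * Ck + 4 * ‖-F‖) * ‖x‖ := fun x hx => by
    have e : W x = linPot u r W x + (-F).fn x := by linarith [hWF x hx]
    rw [e, add_mul]
    exact (abs_add_le _ _).trans (add_le_add (abs_linPot_le hsrc x) ((-F).abs_le_linear hx))
  have hM1 : 0 ≤ C * M * Ck + 4 * ‖-F‖ := by positivity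
  have e : (h.potY hW hM1 hb + -F).fn = W := by
    funext x
    by_cases hx : x ∈ B 4
    · rw [SpaceY.fn_add, Pi.add_apply, h.potY_apply _ _ _ hx, ← hWF x hx]
      ring
    · rw [SpaceY.fn_off _ hx, hW.eq_zero_off x hx]
  refine ⟨h.potY hW hM1 hb + -F, SpaceY.ext_B4 fun x hx => ?_⟩
  rw [h.linOp_apply, SpaceY.fn_sub, Pi.sub_apply, h.potOf_apply _ hx, e]
  have h1 := hWF x hx
  have h2 : (-F).fn x = -F.fn x := rfl
  rw [h2] at h1
  linarith

/-- The derivative of the operator at `ζ = 0`. -/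
theorem RadialState.exists_derivative (h : RadialState U ρ u r c C) :
    ∃ L : SpaceX ≃L[ℝ] SpaceY, ∀ ζ, L ζ = h.linOp (h.mulEquiv ζ) := by
  obtain ⟨K₁, hK₁, h1, h2⟩ := h.exists_norm_mulEquiv_le
  obtain ⟨K₂, hK₂, h3⟩ := h.exists_norm_le_linOp
  have hC := h.C_nonneg
  have hCk := Ck_nonneg
  have hinj : Function.Injective h.linOp := by
    rw [injective_iff_map_eq_zero]
    intro W hW
    have := h3 W
    rw [hW, norm_zero, mul_zero] at this
    exact norm_le_zero_iff.1 this
  set e := h.mulEquiv.trans (LinearEquiv.ofBijective h.linOp ⟨hinj, h.surjective_linOp⟩) with he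
  refine ⟨e.toContinuousLinearEquivOfBounds ((6 * (C * 4) * Ck + 1) * K₁) (K₁ * K₂)
    (fun ζ => ?_) (fun W => ?_), fun ζ => rfl⟩
  · refine (h.norm_linOp_le (h.mulEquiv ζ)).trans ?_
    calc (6 * (C * 4) * Ck + 1) * ‖h.mulEquiv ζ‖
        ≤ (6 * (C * 4) * Ck + 1) * (K₁ * ‖ζ‖) := by gcongr; exact h1 ζ
      _ = _ := by ring
  · have h4 : h.linOp (h.mulEquiv (e.symm W)) = W := e.apply_symm_apply W
    have h5 := h3 (h.mulEquiv (e.symm W))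
    rw [h4] at h5
    have h6 := h2 (h.mulEquiv (e.symm W))
    rw [h.mulEquiv.symm_apply_apply] at h6
    calc ‖e.symm W‖ ≤ K₁ * ‖h.mulEquiv (e.symm W)‖ := h6
      _ ≤ K₁ * (K₂ * ‖W‖) := by gcongr
      _ = _ := by ring

end

section

variable {U ρ : E3 → ℝ} {u r : ℝ → ℝ} {c C : ℝ}

/-! ### The remainder of the operator -/

theorem RadialState.isPotential_srcOf (h : RadialState U ρ u r c C) {ζ : SpaceX}
    (hζ : ‖ζ‖ ≤ 1 / 4) :
    IsPotential (pot (srcOf ρ ζ)) (fun x => innerSL ℝ (gradPot (srcOf ρ ζ) x)) := by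
  obtain ⟨K, -, hK⟩ := exists_abs_deriv_le h.contDiff_r
  exact (h.srcL_srcOf hK hζ).isPotential (h.srcOf_reflect hζ)

/-- The value of the operator as an element of `Y`. -/
def RadialState.val (h : RadialState U ρ u r c C) (ζ : SpaceX) (hζ : ‖ζ‖ ≤ 1 / 4) : SpaceY :=
  mkY _ (h.isPotential.memY_comp norm_zero_le_quarter) - mkY _ (h.isPotential.memY_comp hζ)
    + mkY _ ((h.isPotential_srcOf hζ).memY_comp hζ)

theorem RadialState.val_apply (h : RadialState U ρ u r c C) {ζ : SpaceX} (hζ : ‖ζ‖ ≤ 1 / 4)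
    {x : E3} (hx : x ∈ B 4) :
    (h.val ζ hζ).fn x = (U x - U 0) - (U (deform ζ.fn x) - U 0)
      + (pot (srcOf ρ ζ) (deform ζ.fn x) - pot (srcOf ρ ζ) 0) := by
  rw [val, SpaceY.fn_add, Pi.add_apply, SpaceY.fn_sub, Pi.sub_apply, mkY_fn, mkY_fn, mkY_fn,
    cutComp_of_mem _ _ hx, cutComp_of_mem _ _ hx, cutComp_of_mem _ _ hx, deform_zero_fn]

theorem RadialState.val_zero (h : RadialState U ρ u r c C) : h.val 0 norm_zero_le_quarter = 0 := by
  obtain ⟨K, -, hK⟩ := exists_abs_deriv_le h.contDiff_r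
  have h1 : srcOf ρ 0 = fun _ => 0 := funext fun y => by
    have := (h.srcL_srcOf hK norm_zero_le_quarter).bound y
    rw [norm_zero, mul_zero, zero_mul] at this
    exact abs_nonpos_iff.1 this
  refine SpaceY.ext_B4 fun x hx => ?_
  rw [h.val_apply norm_zero_le_quarter hx, h1, deform_zero_fn, SpaceY.fn_zero]
  simp [pot]

theorem add_mem_Icc {ζ : SpaceX} (hζ : ‖ζ‖ ≤ 1 / 4) {x : E3} (hx : x ∈ B 4) :
    ‖x‖ + ζ.fn x ∈ Icc (0 : ℝ) 5 := by
  have h1 := abs_le.1 (ζ.abs_le hx)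
  have h2 : ‖x‖ ≤ 4 := mem_B.1 hx
  have h3 := norm_nonneg x
  constructor <;> nlinarith [h1.1, h1.2]

theorem RadialState.grad_cutComp_U (h : RadialState U ρ u r c C) {ζ : SpaceX} (hζ : ‖ζ‖ ≤ 1 / 4)
    {x : E3} (hx : x ∈ B4') : grad (cutComp U ζ) x
      = deriv u (‖x‖ + ζ.fn x) • (innerSL ℝ (‖x‖⁻¹ • x) + grad ζ.fn x) := by
  have h1 := (hasFDerivAt_norm hx.2).hasFDerivWithinAt.add (ζ.hasFDerivWithinAt hx)
  have h2 := ((h.hasDerivAt_u (‖x‖ + ζ.fn x)).comp_hasFDerivWithinAt x h1).sub_const (U 0)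
  have h3 : ∀ y ∈ B 4, cutComp U ζ y = u (‖y‖ + ζ.fn y) - U 0 := fun y hy => by
    rw [cutComp_of_mem _ _ hy, h.U_eq, norm_deform ζ hy (hζ.trans (by norm_num))]
  exact grad_eq hx.1 (h2.congr h3 (h3 x hx.1))

theorem RadialState.grad_cutComp_U_zero (h : RadialState U ρ u r c C) {x : E3} (hx : x ∈ B4') :
    grad (cutComp U 0) x = deriv u ‖x‖ • (innerSL ℝ (‖x‖⁻¹ • x) : E3 →L[ℝ] ℝ) := by
  have hg : grad (0 : SpaceX).fn x = 0 := grad_zero x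
  rw [h.grad_cutComp_U norm_zero_le_quarter hx, hg, add_zero]
  simp [SpaceX.fn_zero]

/-- The remainder of the composition `U ∘ g_ζ`. -/
theorem RadialState.norm_grad_comp_remainder (h : RadialState U ρ u r c C) {ζ : SpaceX}
    (hζ : ‖ζ‖ ≤ 1 / 4) {K ε δ : ℝ} (hK : ∀ s ∈ Icc (0 : ℝ) 5, |deriv (deriv u) s| ≤ K)
    (hε : 0 ≤ ε) (hT : ∀ a ∈ Icc (0 : ℝ) 5, ∀ b ∈ Icc (0 : ℝ) 5, |b - a| < δ →
      |deriv u b - deriv u a - deriv (deriv u) a * (b - a)| ≤ ε * |b - a|)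
    (hδ : 4 * ‖ζ‖ < δ) {x : E3} (hx : x ∈ B4') :
    ‖grad (cutComp U 0) x - grad (cutComp U ζ) x + grad (h.mulEquiv ζ).fn x‖
      ≤ (ε + K * ‖ζ‖) * ‖ζ‖ * ‖x‖ := by
  have hK0 : 0 ≤ K := (abs_nonneg _).trans (hK 0 (by simp))
  rw [h.grad_cutComp_U hζ hx, h.grad_cutComp_U_zero hx, h.grad_mulEquiv ζ hx, mulD]
  have hz := ζ.abs_le hx.1
  have hx4 : ‖x‖ ≤ 4 := mem_B.1 hx.1
  have hlt : |‖x‖ + ζ.fn x - ‖x‖| < δ := by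
    rw [add_sub_cancel_left]
    nlinarith [norm_nonneg ζ]
  have h1 := hT _ (norm_mem_Icc hx.1) _ (add_mem_Icc hζ hx.1) hlt
  have h2 := abs_sub_le_of_deriv h.contDiff_deriv_u hK (norm_mem_Icc hx.1) (add_mem_Icc hζ hx.1)
  rw [add_sub_cancel_left] at h1 h2
  have e : deriv u ‖x‖ • (innerSL ℝ (‖x‖⁻¹ • x) : E3 →L[ℝ] ℝ)
      - deriv u (‖x‖ + ζ.fn x) • (innerSL ℝ (‖x‖⁻¹ • x) + grad ζ.fn x)
      + (deriv u ‖x‖ • grad ζ.fn x + (ζ.fn x * deriv (deriv u) ‖x‖) • innerSL ℝ (‖x‖⁻¹ • x))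
      = (-(deriv u (‖x‖ + ζ.fn x) - deriv u ‖x‖ - deriv (deriv u) ‖x‖ * ζ.fn x)) •
          (innerSL ℝ (‖x‖⁻¹ • x) : E3 →L[ℝ] ℝ)
        + (-(deriv u (‖x‖ + ζ.fn x) - deriv u ‖x‖)) • grad ζ.fn x := by
    module
  rw [e]
  refine (norm_add_le _ _).trans ?_
  rw [norm_smul, norm_smul, norm_neg, norm_neg, norm_innerSL_dir hx.2, mul_one, Real.norm_eq_abs,
    Real.norm_eq_abs]
  calc _ ≤ ε * (‖ζ‖ * ‖x‖) + K * (‖ζ‖ * ‖x‖) * ‖ζ‖ := by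
        refine add_le_add (h1.trans (by gcongr)) ?_
        exact mul_le_mul (h2.trans (by gcongr)) (ζ.grad_le hx) (norm_nonneg _) (by positivity)
    _ = _ := by ring

/-- The remainder of the potential of the perturbed density. -/
theorem RadialState.norm_grad_pot_remainder (h : RadialState U ρ u r c C) {ζ : SpaceX}
    (hζ : ‖ζ‖ ≤ 1 / 4) {K ε : ℝ} (hK : ∀ s ∈ Icc (0 : ℝ) 5, |deriv r s| ≤ K)
    (hε : SrcL (fun y => srcOf ρ ζ y - linSrc u r ζ y) (ε * ‖ζ‖)) {x : E3} (hx : x ∈ B4') :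
    ‖grad (cutComp (pot (srcOf ρ ζ)) ζ) x - innerSL ℝ (gradPot (linSrc u r ζ) x)‖
      ≤ (45 * K * Ck * ‖ζ‖ + 512 * K * Ck * √‖ζ‖ + 6 * ε * Ck) * ‖ζ‖ * ‖x‖ := by
  have hK0 : 0 ≤ K := (abs_nonneg _).trans (hK 0 (by simp))
  have hCk := Ck_nonneg
  have hs := h.srcL_srcOf hK hζ
  have hl := h.srcL_linSrc hK ζ
  have hse : ∀ y, srcOf ρ ζ (-y) = srcOf ρ ζ y := even_of_reflect (h.srcOf_reflect hζ)
  have hle : ∀ y, linSrc u r ζ (-y) = linSrc u r ζ y := even_of_reflect (linSrc_reflect u r ζ)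
  have hg5 : ‖deform ζ.fn x‖ ≤ 5 := mem_B.1 (deform_mem_B5 hζ hx.1)
  have h1 := hs.norm_gradPot_le hse hg5
  have h2 := hs.norm_gradPot_sub_le_of_near (norm_nonneg ζ) (hζ.trans (by norm_num))
    (by rw [norm_deform_sub_self]; exact ζ.abs_le hx.1 : ‖deform ζ.fn x - x‖ ≤ ‖ζ‖ * ‖x‖)
    (norm_le_five hx.1)
  have h3 := hε.norm_gradPot_le (fun y => by rw [hse, hle]) (norm_le_five hx.1)
  rw [hs.src.gradPot_sub hl.src] at h3
  rw [(h.isPotential_srcOf hζ).grad_comp ζ hx, compD, ContinuousLinearMap.comp_add,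
    ContinuousLinearMap.comp_id]
  -- Three errors: the derivative of the deformation differs from the identity, the gradient is
  -- evaluated at a shifted point, and the density is replaced by its linearisation. The source is
  -- already of order `‖ζ‖`, so each of the first two gains another small factor.
  have e : (innerSL ℝ (gradPot (srcOf ρ ζ) (deform ζ.fn x)) : E3 →L[ℝ] ℝ)
      + (innerSL ℝ (gradPot (srcOf ρ ζ) (deform ζ.fn x)) : E3 →L[ℝ] ℝ).comp (dispD ζ x)
      - innerSL ℝ (gradPot (linSrc u r ζ) x)
      = (innerSL ℝ (gradPot (srcOf ρ ζ) (deform ζ.fn x)) : E3 →L[ℝ] ℝ).comp (dispD ζ x)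
        + innerSL ℝ (gradPot (srcOf ρ ζ) (deform ζ.fn x) - gradPot (srcOf ρ ζ) x)
        + innerSL ℝ (gradPot (srcOf ρ ζ) x - gradPot (linSrc u r ζ) x) := by
    rw [map_sub, map_sub]
    abel
  rw [e]
  refine (norm_add₃_le).trans ?_
  rw [innerSL_apply_norm, innerSL_apply_norm]
  have h4 : ‖(innerSL ℝ (gradPot (srcOf ρ ζ) (deform ζ.fn x)) : E3 →L[ℝ] ℝ).comp (dispD ζ x)‖
      ≤ (6 * (2 * K * ‖ζ‖) * Ck * (5 / 4 * ‖x‖)) * (3 * ‖ζ‖) := by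
    refine (ContinuousLinearMap.opNorm_comp_le _ _).trans ?_
    rw [innerSL_apply_norm]
    gcongr
    · exact h1.trans (by gcongr; exact deform_mem hζ hx.1)
    · exact norm_dispD_le ζ hx
  calc _ ≤ (6 * (2 * K * ‖ζ‖) * Ck * (5 / 4 * ‖x‖)) * (3 * ‖ζ‖)
        + 256 * (2 * K * ‖ζ‖) * Ck * √‖ζ‖ * ‖x‖ + 6 * (ε * ‖ζ‖) * Ck * ‖x‖ :=
        add_le_add (add_le_add h4 h2) h3
    _ = _ := by ring

theorem RadialState.grad_potOf_mulEquiv (h : RadialState U ρ u r c C) (ζ : SpaceX) {x : E3}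
    (hx : x ∈ B4') : grad (h.potOf (h.mulEquiv ζ)).fn x = innerSL ℝ (gradPot (linSrc u r ζ) x) :=
  h.grad_potY _ _ _ hx

theorem RadialState.grad_val_sub (h : RadialState U ρ u r c C) {ζ : SpaceX} (hζ : ‖ζ‖ ≤ 1 / 4)
    {x : E3} (hx : x ∈ B4') :
    grad (h.val ζ hζ - h.linOp (h.mulEquiv ζ)).fn x
      = (grad (cutComp U 0) x - grad (cutComp U ζ) x + grad (h.mulEquiv ζ).fn x)
        + (grad (cutComp (pot (srcOf ρ ζ)) ζ) x - innerSL ℝ (gradPot (linSrc u r ζ) x)) := by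
  rw [SpaceY.grad_sub hx.1, val, SpaceY.grad_add hx.1, SpaceY.grad_sub hx.1, h.linOp_apply,
    SpaceY.grad_sub hx.1, h.grad_potOf_mulEquiv ζ hx, mkY_fn, mkY_fn, mkY_fn]
  abel

/-- The operator is differentiable at `ζ = 0`. -/
theorem RadialState.isLittleO_val (h : RadialState U ρ u r c C) {ε : ℝ} (hε : 0 < ε) :
    ∃ δ > 0, ∀ ζ : SpaceX, ‖ζ‖ < δ → ∃ hζ : ‖ζ‖ ≤ 1 / 4,
      ‖h.val ζ hζ - h.linOp (h.mulEquiv ζ)‖ ≤ ε * ‖ζ‖ := by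
  obtain ⟨Kr, hKr0, hKr⟩ := exists_abs_deriv_le h.contDiff_r
  obtain ⟨Ku, hKu0, hKu⟩ := exists_abs_deriv_le h.contDiff_deriv_u
  have hCk := Ck_nonneg
  -- Chosen so that the two terms containing `η` add up to `ε/2`; the remaining terms tend to zero
  -- with `‖ζ‖` and take the other half.
  set η := ε / (2 * (1 + 6 * Ck)) with hη
  have hη0 : 0 < η := by positivity
  obtain ⟨δ₁, hδ₁, hT⟩ := exists_taylor_modulus h.contDiff_deriv_u hη0
  obtain ⟨δ₂, hδ₂, hδ₂', hS⟩ := h.exists_srcL_sub hη0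
  have hlim : Tendsto (fun t : ℝ => (Ku + 45 * Kr * Ck) * t + 512 * Kr * Ck * √t) (𝓝 0) (𝓝 0) := by
    have : Continuous fun t : ℝ => (Ku + 45 * Kr * Ck) * t + 512 * Kr * Ck * √t := by fun_prop
    simpa using this.tendsto 0
  obtain ⟨δ₃, hδ₃, hL⟩ := Metric.eventually_nhds_iff.1
    (hlim.eventually_lt_const (half_pos hε))
  refine ⟨min (min (δ₁ / 4) δ₂) δ₃, by positivity, fun ζ hζ => ?_⟩
  have hζ1 : ‖ζ‖ < δ₁ / 4 := hζ.trans_le ((min_le_left _ _).trans (min_le_left _ _))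
  have hζ2 : ‖ζ‖ < δ₂ := hζ.trans_le ((min_le_left _ _).trans (min_le_right _ _))
  have hζ3 : ‖ζ‖ < δ₃ := hζ.trans_le (min_le_right _ _)
  have hq : ‖ζ‖ ≤ 1 / 4 := hζ2.le.trans hδ₂'
  refine ⟨hq, SpaceY.norm_le (by positivity) fun x hx => ?_⟩
  rw [h.grad_val_sub hq hx]
  refine (norm_add_le _ _).trans ?_
  have h1 := h.norm_grad_comp_remainder hq hKu hη0.le hT (by linarith) hx
  have h2 := h.norm_grad_pot_remainder hq hKr (hS ζ hζ2) hx
  have h3 := hL (y := ‖ζ‖) (by rwa [Real.dist_eq, sub_zero, abs_of_nonneg (norm_nonneg ζ)])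
  have h4 : η + 6 * η * Ck = ε / 2 := by
    rw [hη]; field_simp
  have h5 : (η + Ku * ‖ζ‖) + (45 * Kr * Ck * ‖ζ‖ + 512 * Kr * Ck * √‖ζ‖ + 6 * η * Ck) ≤ ε := by
    linarith
  calc _ ≤ (η + Ku * ‖ζ‖) * ‖ζ‖ * ‖x‖
        + (45 * Kr * Ck * ‖ζ‖ + 512 * Kr * Ck * √‖ζ‖ + 6 * η * Ck) * ‖ζ‖ * ‖x‖ := add_le_add h1 h2
    _ = ((η + Ku * ‖ζ‖) + (45 * Kr * Ck * ‖ζ‖ + 512 * Kr * Ck * √‖ζ‖ + 6 * η * Ck)) *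
        (‖ζ‖ * ‖x‖) := by ring
    _ ≤ ε * (‖ζ‖ * ‖x‖) := by gcongr
    _ = _ := by ring

theorem RadialState.exists_src_ρ (h : RadialState U ρ u r c C) : ∃ M, Src ρ M := by
  obtain ⟨M, hM0, hM⟩ := exists_bound_ball h.contDiff_ρ.continuous 3
  refine ⟨M, h.contDiff_ρ.continuous.aestronglyMeasurable, fun y => ?_, fun y hy => ?_⟩
  · rcases le_or_gt ‖y‖ 3 with h1 | h1
    · exact hM y h1
    · rw [h.ρ_eq, h.r_eq_zero _ (by linarith), abs_zero]
      exact hM0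
  · rw [h.ρ_eq, h.r_eq_zero _ (by linarith)]

theorem RadialState.setIntegral_eq (h : RadialState U ρ u r c C) {ζ : SpaceX} (hζ : ‖ζ‖ ≤ 1 / 4)
    (z : E3) : ∫ y in B 3, ρ (deformInv ζ.fn y) / ‖z - y‖ = pot (srcOf ρ ζ) z + pot ρ z := by
  obtain ⟨K, -, hK⟩ := exists_abs_deriv_le h.contDiff_r
  obtain ⟨M, hM⟩ := h.exists_src_ρ
  rw [← (h.srcL_srcOf hK hζ).src.pot_add hM, pot,
    ← integral_indicator Metric.isClosed_closedBall.measurableSet]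
  refine integral_congr_ae (Eventually.of_forall fun y => ?_)
  by_cases hy : y ∈ B 3
  · beta_reduce
    rw [indicator_of_mem hy, srcOf_of_mem _ _ hy, sub_add_cancel]
  · have hy' : 3 < ‖y‖ := by rwa [mem_B, not_le] at hy
    beta_reduce
    rw [indicator_of_notMem hy, h.srcOf_of_notMem ζ hy, h.ρ_eq, h.r_eq_zero _ (by linarith),
      add_zero, zero_div]

end

/-! ### Identification with the operator `T` and conclusion. -/

theorem opT_eq {φ : ℝ → ℝ} {E₀ : ℝ} {f₀ : E3 → E3 → ℝ} {ρ₀ U₀ : E3 → ℝ} (hφ : IsAnsatz φ E₀)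
    (hs : IsSphericalSteadyState φ f₀ ρ₀ U₀) {c C : ℝ}
    (h : RadialState U₀ ρ₀ (profile U₀) (profile ρ₀) c C) {ζ : SpaceX} (hζ : ‖ζ‖ ≤ 1 / 4) {x : E3}
    (hx : x ∈ B 4) : (h.val ζ hζ).fn x = opT φ E₀ U₀ 0 ζ.fn x := by
  have e : deformedDensity φ E₀ U₀ 0 ζ.fn = fun y => ρ₀ (deformInv ζ.fn y) :=
    funext fun y => hTilde_zero_eq hφ hs _ _
  have h0 := h.setIntegral_eq hζ 0
  -- The last integral of the operator is the potential at the origin, which the deformation fixes.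
  simp only [zero_sub, norm_neg] at h0
  rw [h.val_apply hζ hx, opT, e, h.setIntegral_eq hζ, h0]
  have h1 := h.newton (deform ζ.fn x)
  linarith

end RotatingVP

end

theorem proposition3p1 (φ : ℝ → ℝ) (E₀ : ℝ) (f₀ : RotatingVP.E3 → RotatingVP.E3 → ℝ)
    (ρ₀ U₀ : RotatingVP.E3 → ℝ) (hφ : RotatingVP.IsAnsatz φ E₀)
    (hsteady : RotatingVP.IsSphericalSteadyState φ f₀ ρ₀ U₀) :
    ∃ r : ℝ, 0 < r ∧ ∃ T₀ : RotatingVP.SpaceX → RotatingVP.SpaceY,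
      (∀ ζ : RotatingVP.SpaceX, ‖ζ‖ < r →
        InjOn (RotatingVP.deform ζ.fn) (RotatingVP.B 4) ∧
        RotatingVP.B 3 ⊆ RotatingVP.deform ζ.fn '' RotatingVP.B 4 ∧
        ∀ x ∈ RotatingVP.B 4, (T₀ ζ).fn x = RotatingVP.opT φ E₀ U₀ 0 ζ.fn x) ∧
      ∃ L : RotatingVP.SpaceX ≃L[ℝ] RotatingVP.SpaceY,
        HasFDerivAt T₀ (L : RotatingVP.SpaceX →L[ℝ] RotatingVP.SpaceY) 0 := by
  classical
  obtain ⟨c, C, h⟩ := RotatingVP.exists_radialState hφ hsteady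
  obtain ⟨L, hL⟩ := h.exists_derivative
  -- At `‖ζ‖ = 1/4` the expansion factor `1 - 3‖ζ‖` is still positive and the image still covers
  -- `B_3`. The value `0` farther out is immaterial for the derivative at the origin.
  refine ⟨1 / 4, by norm_num, fun ζ => if hζ : ‖ζ‖ ≤ 1 / 4 then h.val ζ hζ else 0,
    fun ζ hζ => ⟨RotatingVP.injOn_deform hζ.le, RotatingVP.subset_image_deform hζ.le,
      fun x hx => ?_⟩, L, ?_⟩
  · beta_reduce
    rw [dif_pos hζ.le]
    exact RotatingVP.opT_eq hφ hsteady h hζ.le hx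
  · refine HasFDerivAt.of_isLittleO (Asymptotics.isLittleO_iff.2 fun ε hε => ?_)
    obtain ⟨δ, hδ, hd⟩ := h.isLittleO_val hε
    filter_upwards [Metric.ball_mem_nhds (0 : RotatingVP.SpaceX) hδ] with ζ hζ
    obtain ⟨hq, hb⟩ := hd ζ (mem_ball_zero_iff.1 hζ)
    rw [dif_pos hq, dif_pos RotatingVP.norm_zero_le_quarter, h.val_zero, sub_zero, sub_zero]
    change ‖h.val ζ hq - L ζ‖ ≤ _
    rwa [hL]
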